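/- Let $W:[0,\infty)^2\to[0,1]$ be a symmetric measurable function with $0<\overline W=\int_{\mathbb R_+^2}W(x,y)\,dx\,dy<\infty$ and $\int_0^\infty W(x,x)\,dx<\infty$. Let $M=\sum_{i\in\mathbb N}\delta_{(\theta_i,\vartheta_i)}$ be a unit-rate Poisson random measure on $(0,\infty)^2$, where $(\theta_i,\vartheta_i)_{i\in\mathbb N}$ is a measurable enumeration of its atoms, and let $(U_{ij})_{i,j\in\mathbb N}$ be a symmetric array ($U_{ij}=U_{ji}$) such that the variables $U_{ij}$, $i\le j$, are independent and uniform on $(0,1)$, and such that the array is independent of $(\theta_i,\vartheta_i)_{i\in\mathbb N}$. Put $Z_{ij}=\mathbf 1\{U_{ij}\le W(\vartheta_i,\vartheta_j)\}$ and, for $\alpha>0$, let $$N^{(e)}_\alpha=\frac12\sum_{i\ne j}Z_{ij}\mathbf 1\{\theta_i\le\alpha\}\mathbf 1\{\theta_j\le\alpha\}+\sum_i Z_{ii}\mathbf 1\{\theta_i\le\alpha\}$$ be the number of edges of the graph of size $\alpha$. Then almost surely $N^{(e)}_\alpha<\infty$ for all $\alpha>0$ and $N^{(e)}_\alpha/(\alpha^2\overline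 W/2)\to1$ as $\alpha\to\infty$; moreover $E(N^{(e)}_\alpha)<\infty$ for all $\alpha>0$ and $E(N^{(e)}_\alpha)/(\alpha^2\overline W/2)\to1$ as $\alpha\to\infty$. -/

import Mathlib

open MeasureTheory ProbabilityTheory Filter Set Asymptotics
open scoped ENNReal NNReal Topology

noncomputable section

/-- `M` is a Poisson random measure on `E` with intensity (mean) measure `Λ`, under the
probability `P`: counts of measurable sets of finite intensity are Poisson distributed, and the
counts of finitely many pairwise disjoint measurable sets are independent. -/
structure IsPoissonRandomMeasure {Ω E : Type*} [MeasurableSpace Ω] [MeasurableSpace E]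
    (M : Ω → Measure E) (Λ : Measure E) (P : Measure Ω) : Prop where
  measurable_count : ∀ B : Set E, MeasurableSet B → Measurable fun ω => M ω B
  law_count : ∀ B : Set E, MeasurableSet B → Λ B ≠ ∞ →
    P.map (fun ω => M ω B) =
      (poissonMeasure (Λ B).toNNReal).map (fun n : ℕ => (n : ℝ≥0∞))
  indep_count : ∀ (n : ℕ) (B : Fin n → Set E), (∀ k, MeasurableSet (B k)) →
    Pairwise (fun k l => Disjoint (B k) (B l)) → iIndepFun (fun k ω => M ω (B k)) P

/-- `W` is (on `[0,∞)²`) a symmetric measurable `[0,1]`-valued function, with finite and positive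
integral over the quadrant, and with integrable diagonal. Values of `W` outside `[0,∞)²` play
no role. -/
structure IsGraphonFunction (W : ℝ → ℝ → ℝ) : Prop where
  measurable : Measurable fun p : Ici (0 : ℝ) × Ici (0 : ℝ) => W p.1 p.2
  symm : ∀ x y, 0 ≤ x → 0 ≤ y → W x y = W y x
  mem_Icc : ∀ x y, 0 ≤ x → 0 ≤ y → W x y ∈ Icc (0 : ℝ) 1
  integrable : IntegrableOn (fun p : ℝ × ℝ => W p.1 p.2) (Ioi 0 ×ˢ Ioi 0)
  integral_pos : 0 < ∫ p in Ioi (0 : ℝ) ×ˢ Ioi (0 : ℝ), W p.1 p.2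
  integrable_diag : IntegrableOn (fun x : ℝ => W x x) (Ioi 0)

/-- The total mass `∫_{ℝ₊²} W(x, y) dx dy`. -/
def graphonMass (W : ℝ → ℝ → ℝ) : ℝ := ∫ p in Ioi (0 : ℝ) ×ˢ Ioi (0 : ℝ), W p.1 p.2

/-- The random objects driving the graph: `(θ i, ϑ i)` enumerates the atoms of a unit-rate Poisson
random measure on `(0,∞)²`, and `U` is a symmetric array of uniform variables, independent for
`i ≤ j`, and independent of the atoms. -/
structure IsGraphInput {Ω : Type*} [MeasurableSpace Ω] (P : Measure Ω)
    (θ ϑ : ℕ → Ω → ℝ) (U : ℕ → ℕ → Ω → ℝ) : Prop where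
  measurable_θ : ∀ i, Measurable (θ i)
  measurable_ϑ : ∀ i, Measurable (ϑ i)
  poisson : IsPoissonRandomMeasure
    (fun ω => Measure.sum fun i => Measure.dirac (θ i ω, ϑ i ω))
    ((volume : Measure (ℝ × ℝ)).restrict (Ioi 0 ×ˢ Ioi 0)) P
  measurable_U : ∀ i j, Measurable (U i j)
  symm_U : ∀ i j, U i j = U j i
  uniform_U : ∀ i j, P.map (U i j) = (volume : Measure ℝ).restrict (Ioo 0 1)
  indep_U : iIndepFun (fun (p : {p : ℕ × ℕ // p.1 ≤ p.2}) => U p.1.1 p.1.2) P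
  indep_atoms : IndepFun (fun ω (i : ℕ) => (θ i ω, ϑ i ω)) (fun ω (p : ℕ × ℕ) => U p.1 p.2 ω) P

/-- The link indicator `Z i j = 1{U i j ≤ W (ϑ i) (ϑ j)}`. -/
def link {Ω : Type*} (W : ℝ → ℝ → ℝ) (ϑ : ℕ → Ω → ℝ) (U : ℕ → ℕ → Ω → ℝ)
    (i j : ℕ) (ω : Ω) : ℝ≥0∞ :=
  if U i j ω ≤ W (ϑ i ω) (ϑ j ω) then 1 else 0

/-- The indicator `1{θ i ≤ α}` that node `i` belongs to the graph of size `α`. -/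
def present {Ω : Type*} (θ : ℕ → Ω → ℝ) (α : ℝ) (i : ℕ) (ω : Ω) : ℝ≥0∞ :=
  if θ i ω ≤ α then 1 else 0

/-- The number of edges of the graph of size `α`, as an element of `[0,∞]`. -/
def numEdges {Ω : Type*} (W : ℝ → ℝ → ℝ) (θ ϑ : ℕ → Ω → ℝ) (U : ℕ → ℕ → Ω → ℝ)
    (α : ℝ) (ω : Ω) : ℝ≥0∞ :=
  (1 / 2) * (∑' i : ℕ, ∑' j : ℕ,
      if i ≠ j then link W ϑ U i j ω * present θ α i ω * present θ α j ω else 0)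
    + ∑' i : ℕ, link W ϑ U i i ω * present θ α i ω

end

/-! Given the points, the expected number of non-loop edges at time `t` is half of `S t`, the sum of
`W (ϑ i) (ϑ j)` over ordered pairs of distinct points born by time `t`. The second factorial moment
of the Poisson process (`IsPoissonRandomMeasure.lintegral_pairSum`) gives `S t` the mean `t ^ 2 *
graphonMass W`, and Campbell's formula gives the loops a mean linear in `t`. This settles the claim
on expectations.

For the almost sure claim the edge count is monotone in `t`, so it is enough to follow squares `t =
(m + 1) ^ 2` (`tendsto_div_sq_of_monotone`). Along squares an error of normalised mean `O(1 / t)` is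
summable, hence negligible. This disposes of the loops, of the fluctuation of the links around `S t`
(given the points, the variance over ordered pairs is at most twice the mean,
`IsGraphInput.lintegral_sq_linkSum_sub_le`), and of the pairs of points in a common unit time slab
(`ae_tendsto_sameSlab`).

There remains a strong law for pairs in distinct slabs. Since `W` is merely integrable, the square
of its marginal `∫ W(x, y) dy` need not be integrable, so `S t` may have infinite variance and
Chebyshev's inequality is not available. Instead, the slabs are exchangeable and the slab mean is a
`U`-statistic of order two, that is, a reverse martingale. The maximal inequality bounds the chance
that some deviation after `n₀` is large by the mean deviation at `n₀`
(`mul_measure_exists_slabDev_le`), and this mean tends to zero (`tendsto_lintegral_slabDev`). Both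
facts are proved for step functions, where only vectors of Poisson counts matter, and carried to
integrable functions by density in `L¹`; the mean of a slab mean is the same for every `n ≥ 2`, so
approximation errors are uniform in `n`. -/

/-! ### First two moments of the Poisson distribution. -/

theorem hasSum_poisson_mul_cast (r : ℝ≥0) :
    HasSum (fun n : ℕ => Real.exp (-r) * r ^ n / n.factorial * n) (r : ℝ) := by
  -- The term at `0` vanishes, and the Poisson weights satisfy `(n + 1) * p (n + 1) = r * p n`.
  rw [← hasSum_nat_add_iff' 1]
  have h := (hasSum_one_poissonMeasure r).mul_left (r : ℝ)
  simp only [mul_one] at h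
  simp only [Finset.range_one, Finset.sum_singleton, Nat.cast_zero, mul_zero, sub_zero]
  have e : (fun n : ℕ => Real.exp (-r) * r ^ (n + 1) / (n + 1).factorial * ((n + 1 : ℕ) : ℝ)) =
      fun n : ℕ => r * (Real.exp (-r) * r ^ n / n.factorial) := by
    ext n
    rw [Nat.factorial_succ]
    push_cast
    field_simp
    ring
  rwa [e]

theorem hasSum_poisson_mul_cast_sq (r : ℝ≥0) :
    HasSum (fun n : ℕ => Real.exp (-r) * r ^ n / n.factorial * (n : ℝ) ^ 2)
      ((r : ℝ) ^ 2 + r) := by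
  rw [← hasSum_nat_add_iff' 1]
  have h := ((hasSum_poisson_mul_cast r).mul_left (r : ℝ)).add
    ((hasSum_one_poissonMeasure r).mul_left (r : ℝ))
  simp only [Finset.range_one, Finset.sum_singleton, Nat.cast_zero, mul_zero, sub_zero,
    ne_eq, OfNat.ofNat_ne_zero, not_false_eq_true, zero_pow]
  have e : (fun n : ℕ => Real.exp (-r) * r ^ (n + 1) / (n + 1).factorial *
      ((n + 1 : ℕ) : ℝ) ^ 2) = fun n : ℕ => r * (Real.exp (-r) * r ^ n / n.factorial * n) +
        r * (Real.exp (-r) * r ^ n / n.factorial) := by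
    ext n
    rw [Nat.factorial_succ]
    push_cast
    field_simp
    ring
  rw [e]
  convert! h using 1
  ring

theorem lintegral_poissonMeasure_ofReal {r : ℝ≥0} {f : ℕ → ℝ} {a : ℝ} (hf : ∀ n, 0 ≤ f n)
    (h : HasSum (fun n : ℕ => Real.exp (-r) * r ^ n / n.factorial * f n) a) :
    ∫⁻ n : ℕ, ENNReal.ofReal (f n) ∂(poissonMeasure r) = ENNReal.ofReal a := by
  rw [poissonMeasure, lintegral_sum_measure, ← h.tsum_eq,
    ENNReal.ofReal_tsum_of_nonneg (fun n => mul_nonneg (by positivity) (hf n)) h.summable]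
  refine tsum_congr fun n => ?_
  rw [lintegral_smul_measure, lintegral_dirac, smul_eq_mul, ENNReal.ofReal_mul (by positivity)]

theorem lintegral_poissonMeasure_cast (r : ℝ≥0) :
    ∫⁻ n : ℕ, (n : ℝ≥0∞) ∂(poissonMeasure r) = r := by
  have := lintegral_poissonMeasure_ofReal (fun n => Nat.cast_nonneg n) (hasSum_poisson_mul_cast r)
  simpa using this

theorem lintegral_poissonMeasure_cast_sq (r : ℝ≥0) :
    ∫⁻ n : ℕ, (n : ℝ≥0∞) ^ 2 ∂(poissonMeasure r) = (r : ℝ≥0∞) ^ 2 + r := by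
  have := lintegral_poissonMeasure_ofReal (fun n => sq_nonneg (n : ℝ))
    (hasSum_poisson_mul_cast_sq r)
  rw [ENNReal.ofReal_add (by positivity) (by positivity)] at this
  simpa [ENNReal.ofReal_pow] using this

/-! ### Point measures, Campbell's formula and the second factorial moment measure. -/

section AtomMeasure

variable {Ω E : Type*} [MeasurableSpace E]

/-- The random measure with unit atoms at the points `x i`. -/
noncomputable abbrev atomMeasure (x : ℕ → Ω → E) (ω : Ω) : Measure E :=
  Measure.sum fun i => Measure.dirac (x i ω)

/-- The sum of `G` over ordered pairs of distinct indices. -/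
noncomputable def pairSum (x : ℕ → Ω → E) (G : E × E → ℝ≥0∞) (ω : Ω) : ℝ≥0∞ :=
  ∑' i, ∑' j, if i ≠ j then G (x i ω, x j ω) else 0

theorem lintegral_atomMeasure (x : ℕ → Ω → E) {g : E → ℝ≥0∞} (hg : Measurable g) (ω : Ω) :
    ∫⁻ e, g e ∂(atomMeasure x ω) = ∑' i, g (x i ω) := by
  rw [lintegral_sum_measure]
  exact tsum_congr fun i => lintegral_dirac' _ hg

theorem atomMeasure_apply (x : ℕ → Ω → E) {B : Set E} (hB : MeasurableSet B) (ω : Ω) :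
    atomMeasure x ω B = ∑' i, B.indicator 1 (x i ω) := by
  rw [← lintegral_atomMeasure x (measurable_one.indicator hB), lintegral_indicator_one hB]

/-- The product is a double sum over indices, whose diagonal counts the points in `A ∩ B`.
Distinctness refers to indices, so coinciding points do no harm. -/
theorem atomMeasure_mul (x : ℕ → Ω → E) {A B : Set E} (hA : MeasurableSet A)
    (hB : MeasurableSet B) (ω : Ω) :
    atomMeasure x ω A * atomMeasure x ω B =
      pairSum x ((A ×ˢ B).indicator 1) ω + atomMeasure x ω (A ∩ B) := by
  rw [atomMeasure_apply x hA, atomMeasure_apply x hB, atomMeasure_apply x (hA.inter hB),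
    ← ENNReal.tsum_mul_right, pairSum, ← ENNReal.tsum_add]
  refine tsum_congr fun i => ?_
  rw [← ENNReal.tsum_mul_left]
  have : (A ∩ B).indicator (1 : E → ℝ≥0∞) (x i ω) =
      ∑' j, if j = i then (A ∩ B).indicator (1 : E → ℝ≥0∞) (x i ω) else 0 := by
    rw [tsum_ite_eq]
  rw [this, ← ENNReal.tsum_add]
  refine tsum_congr fun j => ?_
  rcases eq_or_ne i j with rfl | hij
  · by_cases h1 : x i ω ∈ A <;> by_cases h2 : x i ω ∈ B <;> simp [h1, h2]
  · by_cases h1 : x i ω ∈ A <;> by_cases h2 : x j ω ∈ B <;> simp [h1, h2, hij, hij.symm]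

variable [MeasurableSpace Ω]

theorem measurable_pairSum {x : ℕ → Ω → E} (hx : ∀ i, Measurable (x i)) {G : E × E → ℝ≥0∞}
    (hG : Measurable G) : Measurable (pairSum x G) := by
  unfold pairSum
  refine Measurable.tsum fun i => Measurable.tsum fun j => ?_
  split_ifs
  · exact hG.comp ((hx i).prodMk (hx j))
  · exact measurable_const

/-- Poisson laws are given only on sets of finite intensity, so the uniqueness theorems for measures
are applied with these sets as generating `π`-system. -/
theorem generateFrom_measurableSet_finite (Λ : Measure E) [SigmaFinite Λ] :
    MeasurableSpace.generateFrom {s : Set E | MeasurableSet s ∧ Λ s ≠ ∞} = ‹MeasurableSpace E› := by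
  refine le_antisymm (MeasurableSpace.generateFrom_le fun s hs => hs.1) fun s hs => ?_
  rw [show s = ⋃ n, s ∩ spanningSets Λ n by rw [← inter_iUnion, iUnion_spanningSets, inter_univ]]
  refine MeasurableSet.iUnion fun n => MeasurableSpace.measurableSet_generateFrom
    ⟨hs.inter (measurableSet_spanningSets Λ n), ?_⟩
  exact (measure_mono inter_subset_right).trans_lt (measure_spanningSets_lt_top Λ n) |>.ne

theorem isPiSystem_measurableSet_finite (Λ : Measure E) :
    IsPiSystem {s : Set E | MeasurableSet s ∧ Λ s ≠ ∞} := fun _ hs _ ht _ =>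
  ⟨hs.1.inter ht.1, ((measure_mono inter_subset_left).trans_lt hs.2.lt_top).ne⟩

/-- The spanning sets of a `σ`-finite measure, as measurable sets of finite measure. -/
noncomputable def finiteSpanningSetsInFinite (Λ : Measure E) [SigmaFinite Λ] :
    Λ.FiniteSpanningSetsIn {s : Set E | MeasurableSet s ∧ Λ s ≠ ∞} where
  set := spanningSets Λ
  set_mem n := ⟨measurableSet_spanningSets Λ n, (measure_spanningSets_lt_top Λ n).ne⟩
  finite := measure_spanningSets_lt_top Λ
  spanning := iUnion_spanningSets Λ

section Moments

variable {P : Measure Ω} {Λ : Measure E} {x : ℕ → Ω → E}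

theorem IsPoissonRandomMeasure.lintegral_count_comp {M : Ω → Measure E}
    (hM : IsPoissonRandomMeasure M Λ P) {B : Set E} (hB : MeasurableSet B) (hB' : Λ B ≠ ∞)
    {f : ℝ≥0∞ → ℝ≥0∞} (hf : Measurable f) :
    ∫⁻ ω, f (M ω B) ∂P = ∫⁻ n : ℕ, f n ∂(poissonMeasure (Λ B).toNNReal) := by
  rw [← lintegral_map (f := f) hf (hM.measurable_count B hB), hM.law_count B hB hB',
    lintegral_map hf (by fun_prop)]

theorem IsPoissonRandomMeasure.lintegral_count {M : Ω → Measure E}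
    (hM : IsPoissonRandomMeasure M Λ P) {B : Set E} (hB : MeasurableSet B) (hB' : Λ B ≠ ∞) :
    ∫⁻ ω, M ω B ∂P = Λ B := by
  rw [hM.lintegral_count_comp hB hB' (f := fun t => t) measurable_id]
  simp [lintegral_poissonMeasure_cast, ENNReal.coe_toNNReal hB']

theorem IsPoissonRandomMeasure.lintegral_count_sq {M : Ω → Measure E}
    (hM : IsPoissonRandomMeasure M Λ P) {B : Set E} (hB : MeasurableSet B) (hB' : Λ B ≠ ∞) :
    ∫⁻ ω, M ω B ^ 2 ∂P = Λ B ^ 2 + Λ B := by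
  rw [hM.lintegral_count_comp hB hB' (f := fun t => t ^ 2) (by fun_prop)]
  simp [lintegral_poissonMeasure_cast_sq, ENNReal.coe_toNNReal hB']

theorem IsPoissonRandomMeasure.lintegral_count_mul {M : Ω → Measure E}
    (hM : IsPoissonRandomMeasure M Λ P) {A B : Set E} (hA : MeasurableSet A) (hA' : Λ A ≠ ∞)
    (hB : MeasurableSet B) (hB' : Λ B ≠ ∞) (hAB : Disjoint A B) :
    ∫⁻ ω, M ω A * M ω B ∂P = Λ A * Λ B := by
  have hI := hM.indep_count 2 ![A, B] (by intro k; fin_cases k <;> simpa)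
    (by
      intro k l hkl
      fin_cases k <;> fin_cases l <;> first | exact absurd rfl hkl | simpa | simpa using hAB.symm)
  have := lintegral_mul_eq_lintegral_mul_lintegral_of_indepFun (hM.measurable_count A hA)
    (hM.measurable_count B hB) (hI.indepFun (i := 0) (j := 1) (by decide))
  simpa [hM.lintegral_count hA hA', hM.lintegral_count hB hB'] using this

/-- The joint intensity of ordered pairs of distinct points. -/
noncomputable def pairIntensity (P : Measure Ω) (x : ℕ → Ω → E) : Measure (E × E) :=
  Measure.sum fun i => Measure.sum fun j =>
    if i ≠ j then P.map (fun ω => (x i ω, x j ω)) else 0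

theorem lintegral_pairIntensity (hx : ∀ i, Measurable (x i)) {G : E × E → ℝ≥0∞}
    (hG : Measurable G) : ∫⁻ e, G e ∂(pairIntensity P x) = ∫⁻ ω, pairSum x G ω ∂P := by
  have hm : ∀ i j, Measurable fun ω => if i ≠ j then G (x i ω, x j ω) else 0 := fun i j => by
    split_ifs
    · exact hG.comp ((hx i).prodMk (hx j))
    · exact measurable_const
  simp_rw [pairIntensity, pairSum, lintegral_sum_measure]
  rw [lintegral_tsum fun i => (Measurable.tsum fun j => hm i j).aemeasurable]
  refine tsum_congr fun i => ?_
  rw [lintegral_tsum fun j => (hm i j).aemeasurable]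
  refine tsum_congr fun j => ?_
  split_ifs
  · rw [lintegral_map hG ((hx i).prodMk (hx j))]
  · simp

theorem pairIntensity_prod_disjoint (hx : ∀ i, Measurable (x i))
    (hM : IsPoissonRandomMeasure (atomMeasure x) Λ P) {A B : Set E} (hA : MeasurableSet A)
    (hA' : Λ A ≠ ∞) (hB : MeasurableSet B) (hB' : Λ B ≠ ∞) (hAB : Disjoint A B) :
    pairIntensity P x (A ×ˢ B) = Λ A * Λ B := by
  rw [← lintegral_indicator_one (hA.prod hB),
    lintegral_pairIntensity hx (measurable_one.indicator (hA.prod hB)),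
    ← hM.lintegral_count_mul hA hA' hB hB' hAB]
  refine lintegral_congr fun ω => ?_
  rw [atomMeasure_mul x hA hB, hAB.inter_eq, measure_empty, add_zero]

theorem pairIntensity_prod_self (hx : ∀ i, Measurable (x i))
    (hM : IsPoissonRandomMeasure (atomMeasure x) Λ P) {A : Set E} (hA : MeasurableSet A)
    (hA' : Λ A ≠ ∞) : pairIntensity P x (A ×ˢ A) = Λ A * Λ A := by
  rw [← lintegral_indicator_one (hA.prod hA),
    lintegral_pairIntensity hx (measurable_one.indicator (hA.prod hA))]
  -- Restoring the diagonal, of mean `Λ A`, turns the pair count into the squared count, whose mean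
  -- is `Λ A ^ 2 + Λ A`.
  refine (ENNReal.add_left_inj hA').1 ?_
  rw [← sq (Λ A), ← hM.lintegral_count_sq hA hA']
  conv_lhs => rw [← hM.lintegral_count hA hA']
  rw [← lintegral_add_right _ (hM.measurable_count A hA)]
  refine lintegral_congr fun ω => ?_
  rw [sq, atomMeasure_mul x hA hA, inter_self]

variable [SigmaFinite Λ]

/-- Campbell's formula. -/
theorem IsPoissonRandomMeasure.campbell (hx : ∀ i, Measurable (x i))
    (hM : IsPoissonRandomMeasure (atomMeasure x) Λ P) {g : E → ℝ≥0∞} (hg : Measurable g) :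
    ∫⁻ ω, ∑' i, g (x i ω) ∂P = ∫⁻ e, g e ∂Λ := by
  -- The intensity is the sum of the laws of the individual points; integrating `g` against both
  -- sides is the formula.
  have key : Λ = Measure.sum fun i => P.map (x i) := by
    refine (finiteSpanningSetsInFinite Λ).ext (generateFrom_measurableSet_finite Λ).symm
      (isPiSystem_measurableSet_finite Λ) fun s hs => ?_
    rw [Measure.sum_apply _ hs.1, ← hM.lintegral_count hs.1 hs.2]
    simp_rw [atomMeasure_apply x hs.1]
    have hm i : Measurable fun ω => s.indicator (1 : E → ℝ≥0∞) (x i ω) :=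
      (measurable_one.indicator hs.1).comp (hx i)
    rw [lintegral_tsum fun i => (hm i).aemeasurable]
    refine tsum_congr fun i => ?_
    rw [← lintegral_map (measurable_one.indicator hs.1) (hx i), lintegral_indicator_one hs.1]
  have hm i : Measurable fun ω => g (x i ω) := hg.comp (hx i)
  rw [lintegral_tsum fun i => (hm i).aemeasurable]
  conv_rhs => rw [key, lintegral_sum_measure]
  exact tsum_congr fun i => (lintegral_map hg (hx i)).symm

/-- Rectangles determine the product measure, and `A ×ˢ B` splits into the square of `A ∩ B` and the
rectangles `(A ∩ B) ×ˢ (B \ A)` and `(A \ B) ×ˢ B`. The square is handled by the Poisson second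
moment, the rectangles with disjoint sides by independence. -/
theorem prod_eq_pairIntensity (hx : ∀ i, Measurable (x i))
    (hM : IsPoissonRandomMeasure (atomMeasure x) Λ P) : Λ.prod Λ = pairIntensity P x := by
  refine Measure.prod_eq_generateFrom (generateFrom_measurableSet_finite Λ)
    (generateFrom_measurableSet_finite Λ) (isPiSystem_measurableSet_finite Λ)
    (isPiSystem_measurableSet_finite Λ) (finiteSpanningSetsInFinite Λ)
    (finiteSpanningSetsInFinite Λ) ?_
  rintro A ⟨hA, hA'⟩ B ⟨hB, hB'⟩
  have hfin : ∀ {s t : Set E}, s ⊆ t → Λ t ≠ ∞ → Λ s ≠ ∞ := fun h ht =>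
    ((measure_mono h).trans_lt ht.lt_top).ne
  have split_left : ∀ {S T : Set E}, MeasurableSet S → MeasurableSet T → ∀ C, MeasurableSet C →
      pairIntensity P x (S ×ˢ T) =
        pairIntensity P x ((S ∩ C) ×ˢ T) + pairIntensity P x ((S \ C) ×ˢ T) := by
    intro S T hS hT C hC
    rw [← measure_union (disjoint_prod.2 (Or.inl
      (disjoint_sdiff_right.mono_left inter_subset_right))) ((hS.diff hC).prod hT), ← union_prod,
      inter_union_sdiff]
  have split_right : ∀ {S T : Set E}, MeasurableSet S → MeasurableSet T → ∀ C, MeasurableSet C →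
      pairIntensity P x (S ×ˢ T) =
        pairIntensity P x (S ×ˢ (T ∩ C)) + pairIntensity P x (S ×ˢ (T \ C)) := by
    intro S T hS hT C hC
    rw [← measure_union (disjoint_prod.2 (Or.inr
      (disjoint_sdiff_right.mono_left inter_subset_right))) (hS.prod (hT.diff hC)), ← prod_union,
      inter_union_sdiff]
  rw [split_left hA hB B hB, split_right (hA.inter hB) hB A hA, inter_comm B A,
    pairIntensity_prod_self hx hM (hA.inter hB) (hfin inter_subset_left hA'),
    pairIntensity_prod_disjoint hx hM (hA.inter hB) (hfin inter_subset_left hA') (hB.diff hA)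
      (hfin sdiff_subset hB') (disjoint_sdiff_right.mono_left inter_subset_left),
    pairIntensity_prod_disjoint hx hM (hA.diff hB) (hfin sdiff_subset hA') hB hB'
      disjoint_sdiff_left]
  have h1 : Λ A = Λ (A ∩ B) + Λ (A \ B) := (measure_inter_add_sdiff A hB).symm
  have h2 : Λ B = Λ (A ∩ B) + Λ (B \ A) := by
    rw [inter_comm]; exact (measure_inter_add_sdiff B hA).symm
  rw [h1, add_mul, ← mul_add, ← h2]

/-- The second factorial moment formula for a Poisson random measure. -/
theorem IsPoissonRandomMeasure.lintegral_pairSum (hx : ∀ i, Measurable (x i))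
    (hM : IsPoissonRandomMeasure (atomMeasure x) Λ P) {G : E × E → ℝ≥0∞} (hG : Measurable G) :
    ∫⁻ ω, pairSum x G ω ∂P = ∫⁻ e, G e ∂(Λ.prod Λ) := by
  rw [prod_eq_pairIntensity hx hM, lintegral_pairIntensity hx hG]

end Moments

end AtomMeasure

/-! ### Moments of the number of links with the points frozen. -/

section Links

variable {Ω : Type*} [MeasurableSpace Ω] {P : Measure Ω}

/-- Fubini for the product of the two laws. It plays the role of conditioning: the points are frozen
at `ω` while the array is averaged over `ω'`. -/
theorem lintegral_lintegral_of_indepFun {A B : Type*} [MeasurableSpace A]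
    [MeasurableSpace B] [IsProbabilityMeasure P] {X : Ω → A} {Y : Ω → B} (hX : Measurable X)
    (hY : Measurable Y) (h : IndepFun X Y P) {F : A × B → ℝ≥0∞} (hF : Measurable F) :
    ∫⁻ ω, F (X ω, Y ω) ∂P = ∫⁻ ω, ∫⁻ ω', F (X ω, Y ω') ∂P ∂P := by
  have hYm := Measure.isProbabilityMeasure_map (μ := P) hY.aemeasurable
  rw [← lintegral_map (f := F) hF (hX.prodMk hY),
    (indepFun_iff_map_prod_eq_prod_map_map hX.aemeasurable hY.aemeasurable).1 h,
    lintegral_prod _ hF.aemeasurable, lintegral_map hF.lintegral_prod_right' hX]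
  refine lintegral_congr fun ω => ?_
  exact lintegral_map (hF.comp measurable_prodMk_left) hY

/-- The variance identity in the additive form `(X - s)² + 2 s X = X² + s²`, which avoids
subtraction in `ℝ≥0∞`. -/
theorem lintegral_ofReal_sq_sub_le [IsProbabilityMeasure P] {X : Ω → ℝ≥0∞} (hX : Measurable X)
    {s c : ℝ≥0∞} (hs : s ≠ ∞) (h1 : ∫⁻ ω, X ω ∂P = s) (h2 : ∫⁻ ω, X ω ^ 2 ∂P ≤ s ^ 2 + c) :
    ∫⁻ ω, ENNReal.ofReal (((X ω).toReal - s.toReal) ^ 2) ∂P ≤ c := by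
  have hfin : ∀ᵐ ω ∂P, X ω < ∞ := ae_lt_top hX (h1 ▸ hs)
  have hid : ∀ᵐ ω ∂P, ENNReal.ofReal (((X ω).toReal - s.toReal) ^ 2) + 2 * s * X ω =
      X ω ^ 2 + s ^ 2 := by
    filter_upwards [hfin] with ω hω
    lift X ω to ℝ≥0 using hω.ne with y
    lift s to ℝ≥0 using hs
    have e1 : (2 * s * y : ℝ≥0∞) = ENNReal.ofReal (2 * s * y) := by
      rw [ENNReal.ofReal_mul (by positivity), ENNReal.ofReal_mul (by positivity)]; simp
    have e2 : ((y : ℝ≥0∞) ^ 2 + (s : ℝ≥0∞) ^ 2) = ENNReal.ofReal (y ^ 2 + s ^ 2) := by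
      rw [ENNReal.ofReal_add (by positivity) (by positivity), ENNReal.ofReal_pow (by positivity),
        ENNReal.ofReal_pow (by positivity)]
      simp
    rw [e1, e2, ← ENNReal.ofReal_add (by positivity) (by positivity)]
    congr 1
    simp only [ENNReal.coe_toReal]
    ring
  have hI := lintegral_congr_ae hid
  rw [lintegral_add_right _ (hX.const_mul _), lintegral_const_mul _ hX, h1,
    lintegral_add_right _ measurable_const, lintegral_const, measure_univ, mul_one] at hI
  have h3 : ∫⁻ ω, ENNReal.ofReal (((X ω).toReal - s.toReal) ^ 2) ∂P + 2 * s * s ≤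
      c + 2 * s * s := by
    rw [hI]
    calc ∫⁻ ω, X ω ^ 2 ∂P + s ^ 2 ≤ s ^ 2 + c + s ^ 2 := by gcongr
      _ = c + 2 * s * s := by ring
  exact (ENNReal.add_le_add_iff_right (by finiteness)).1 h3

variable {θ ϑ : ℕ → Ω → ℝ} {U : ℕ → ℕ → Ω → ℝ}

/-- The indicator of `{u ≤ t}`. -/
noncomputable def leInd (u t : ℝ) : ℝ≥0∞ := if u ≤ t then 1 else 0

theorem measurable_leInd {A : Type*} [MeasurableSpace A] {f g : A → ℝ} (hf : Measurable f)
    (hg : Measurable g) : Measurable fun a => leInd (f a) (g a) :=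
  Measurable.ite (measurableSet_le hf hg) measurable_const measurable_const

theorem IsGraphInput.lintegral_leInd (hG : IsGraphInput P θ ϑ U) (i j : ℕ) {t : ℝ}
    (ht : t ∈ Icc (0 : ℝ) 1) : ∫⁻ ω, leInd (U i j ω) t ∂P = ENNReal.ofReal t := by
  rw [← lintegral_map (f := fun u => leInd u t) (measurable_leInd measurable_id measurable_const)
    (hG.measurable_U i j), hG.uniform_U]
  have : (fun u => leInd u t) = (Iic t).indicator 1 := by
    ext u; simp [leInd, indicator_apply]
  rw [this, lintegral_indicator_one measurableSet_Iic,
    Measure.restrict_apply measurableSet_Iic]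
  -- The intersection is `Ioc 0 t` when `t < 1` but `Ioo 0 1` when `t = 1`; it is squeezed between
  -- two intervals of length `t`.
  have h1 : Ioo 0 t ⊆ Iic t ∩ Ioo (0 : ℝ) 1 := fun u hu =>
    ⟨hu.2.le, hu.1, hu.2.trans_le ht.2⟩
  have h2 : Iic t ∩ Ioo (0 : ℝ) 1 ⊆ Ioc 0 t := fun u hu => ⟨hu.2.1, hu.1⟩
  refine le_antisymm ?_ ?_
  · simpa using measure_mono (μ := volume) h2
  · simpa using measure_mono (μ := volume) h1

/-- By symmetry each entry is the one at `(min, max)`, and the two hypotheses say that the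
underlying unordered pairs differ. -/
theorem IsGraphInput.indepFun_U (hG : IsGraphInput P θ ϑ U) {e f : ℕ × ℕ} (h1 : f ≠ e)
    (h2 : f ≠ e.swap) : IndepFun (U e.1 e.2) (U f.1 f.2) P := by
  obtain ⟨i, j⟩ := e
  obtain ⟨k, l⟩ := f
  have hmm : ∀ a b, U a b = U (min a b) (max a b) := fun a b => by
    rcases le_total a b with h | h
    · simp [h]
    · simp only [h, min_eq_right, max_eq_left]; exact hG.symm_U a b
  have := hG.indep_U.indepFun (i := ⟨(min i j, max i j), min_le_max⟩)
    (j := ⟨(min k l, max k l), min_le_max⟩) (by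
      intro h
      simp only [Subtype.mk.injEq, Prod.mk.injEq] at h
      simp only [ne_eq, Prod.mk.injEq, Prod.swap_prod_mk] at h1 h2
      omega)
  simp only [hmm i j, hmm k l]
  exact this

theorem IsGraphInput.lintegral_leInd_mul (hG : IsGraphInput P θ ϑ U) {e f : ℕ × ℕ} (h1 : f ≠ e)
    (h2 : f ≠ e.swap) {s t : ℝ} (hs : s ∈ Icc (0 : ℝ) 1) (ht : t ∈ Icc (0 : ℝ) 1) :
    ∫⁻ ω, leInd (U e.1 e.2 ω) s * leInd (U f.1 f.2 ω) t ∂P =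
      ENNReal.ofReal s * ENNReal.ofReal t := by
  have hm : ∀ r, Measurable fun u => leInd u r := fun r =>
    measurable_leInd measurable_id measurable_const
  have := lintegral_mul_eq_lintegral_mul_lintegral_of_indepFun
    ((hm s).comp (hG.measurable_U e.1 e.2)) ((hm t).comp (hG.measurable_U f.1 f.2))
    ((hG.indepFun_U h1 h2).comp (hm s) (hm t))
  simpa [hG.lintegral_leInd _ _ hs, hG.lintegral_leInd _ _ ht] using this

theorem leInd_le_one (u t : ℝ) : leInd u t ≤ 1 := by unfold leInd; split_ifs <;> simp

theorem IsGraphInput.lintegral_tsum_leInd (hG : IsGraphInput P θ ϑ U) (c : ℕ × ℕ → ℝ≥0∞)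
    {p : ℕ × ℕ → ℝ} (hp : ∀ e, p e ∈ Icc (0 : ℝ) 1) :
    ∫⁻ ω, ∑' e : ℕ × ℕ, c e * leInd (U e.1 e.2 ω) (p e) ∂P =
      ∑' e, c e * ENNReal.ofReal (p e) := by
  have hm : ∀ e : ℕ × ℕ, Measurable fun ω => leInd (U e.1 e.2 ω) (p e) := fun e =>
    measurable_leInd (hG.measurable_U e.1 e.2) measurable_const
  rw [lintegral_tsum fun e => ((hm e).const_mul _).aemeasurable]
  exact tsum_congr fun e => by rw [lintegral_const_mul _ (hm e), hG.lintegral_leInd _ _ (hp e)]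

/-- Expand the square over pairs `e`, `f`. Unless `f` is `e` or `e.swap` the indicators are
independent and contribute `q e * q f`; in the two exceptional cases the term is at most `q e`, as
all factors are at most `1`. These two cases give the factor `2`. -/
theorem IsGraphInput.lintegral_tsum_leInd_sq_le (hG : IsGraphInput P θ ϑ U) {c : ℕ × ℕ → ℝ≥0∞}
    (hc : ∀ e, c e ≤ 1) {p : ℕ × ℕ → ℝ} (hp : ∀ e, p e ∈ Icc (0 : ℝ) 1) :
    ∫⁻ ω, (∑' e : ℕ × ℕ, c e * leInd (U e.1 e.2 ω) (p e)) ^ 2 ∂P ≤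
      (∑' e, c e * ENNReal.ofReal (p e)) ^ 2 + 2 * ∑' e, c e * ENNReal.ofReal (p e) := by
  set q : ℕ × ℕ → ℝ≥0∞ := fun e => c e * ENNReal.ofReal (p e) with hq
  have hm : ∀ e : ℕ × ℕ, Measurable fun ω => leInd (U e.1 e.2 ω) (p e) := fun e =>
    measurable_leInd (hG.measurable_U e.1 e.2) measurable_const
  have hterm : ∀ e f : ℕ × ℕ,
      ∫⁻ ω, c e * leInd (U e.1 e.2 ω) (p e) * (c f * leInd (U f.1 f.2 ω) (p f)) ∂P ≤
        q e * q f + ((if f = e then q e else 0) + if f = e.swap then q e else 0) := by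
    intro e f
    by_cases h : f = e ∨ f = e.swap
    · have : ∫⁻ ω, c e * leInd (U e.1 e.2 ω) (p e) * (c f * leInd (U f.1 f.2 ω) (p f)) ∂P ≤
          q e := by
        calc _ ≤ ∫⁻ ω, c e * leInd (U e.1 e.2 ω) (p e) ∂P := by
              refine lintegral_mono fun ω => ?_
              exact mul_le_of_le_one_right' (mul_le_one' (hc f) (leInd_le_one _ _))
          _ = q e := by rw [lintegral_const_mul _ (hm e), hG.lintegral_leInd _ _ (hp e)]
      refine this.trans (le_add_left ?_)
      rcases h with h | h
      · rw [if_pos h]; exact le_self_add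
      · rw [if_pos h]; exact le_add_self
    · push Not at h
      refine le_trans (le_of_eq ?_) le_self_add
      calc _ = ∫⁻ ω, (c e * c f) * (leInd (U e.1 e.2 ω) (p e) * leInd (U f.1 f.2 ω) (p f)) ∂P :=
            lintegral_congr fun ω => by ring
        _ = _ := by
            have hmef : Measurable fun ω =>
                leInd (U e.1 e.2 ω) (p e) * leInd (U f.1 f.2 ω) (p f) := (hm e).mul (hm f)
            rw [lintegral_const_mul _ hmef,
              hG.lintegral_leInd_mul h.1 h.2 (hp e) (hp f)]
            simp only [hq]; ring
  calc ∫⁻ ω, (∑' e : ℕ × ℕ, c e * leInd (U e.1 e.2 ω) (p e)) ^ 2 ∂P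
      = ∫⁻ ω, ∑' e : ℕ × ℕ, ∑' f : ℕ × ℕ,
          c e * leInd (U e.1 e.2 ω) (p e) * (c f * leInd (U f.1 f.2 ω) (p f)) ∂P := by
        refine lintegral_congr fun ω => ?_
        rw [sq, ← ENNReal.tsum_mul_right]
        exact tsum_congr fun e => ENNReal.tsum_mul_left.symm
    _ = ∑' e : ℕ × ℕ, ∑' f : ℕ × ℕ,
          ∫⁻ ω, c e * leInd (U e.1 e.2 ω) (p e) * (c f * leInd (U f.1 f.2 ω) (p f)) ∂P := by
        have hm2 : ∀ e f : ℕ × ℕ, Measurable fun ω =>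
            c e * leInd (U e.1 e.2 ω) (p e) * (c f * leInd (U f.1 f.2 ω) (p f)) := fun e f =>
          ((hm e).const_mul _).mul ((hm f).const_mul _)
        rw [lintegral_tsum fun e => (Measurable.tsum fun f => hm2 e f).aemeasurable]
        exact tsum_congr fun e => lintegral_tsum fun f => (hm2 e f).aemeasurable
    _ ≤ ∑' e : ℕ × ℕ, ∑' f : ℕ × ℕ,
          (q e * q f + ((if f = e then q e else 0) + if f = e.swap then q e else 0)) :=
        ENNReal.tsum_le_tsum fun e => ENNReal.tsum_le_tsum fun f => hterm e f
    _ = (∑' e, q e) ^ 2 + 2 * ∑' e, q e := by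
        simp_rw [ENNReal.tsum_add, tsum_ite_eq, ENNReal.tsum_mul_left]
        rw [ENNReal.tsum_mul_right]
        ring

theorem IsGraphInput.measurable_atoms (hG : IsGraphInput P θ ϑ U) :
    Measurable fun ω (i : ℕ) => (θ i ω, ϑ i ω) :=
  measurable_pi_lambda _ fun i => (hG.measurable_θ i).prodMk (hG.measurable_ϑ i)

theorem IsGraphInput.measurable_array (hG : IsGraphInput P θ ϑ U) :
    Measurable fun ω (e : ℕ × ℕ) => U e.1 e.2 ω :=
  measurable_pi_lambda _ fun e => hG.measurable_U e.1 e.2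

variable [IsProbabilityMeasure P] {c : (ℕ → ℝ × ℝ) → ℕ × ℕ → ℝ≥0∞}
  {p : (ℕ → ℝ × ℝ) → ℕ × ℕ → ℝ}

theorem measurable_tsum_leInd (hcm : ∀ e, Measurable fun a => c a e)
    (hpm : ∀ e, Measurable fun a => p a e) :
    Measurable fun au : (ℕ → ℝ × ℝ) × (ℕ × ℕ → ℝ) =>
      ∑' e : ℕ × ℕ, c au.1 e * leInd (au.2 e) (p au.1 e) :=
  Measurable.tsum fun e => ((hcm e).comp measurable_fst).mul
    (measurable_leInd ((measurable_pi_apply e).comp measurable_snd)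
      ((hpm e).comp measurable_fst))

theorem measurable_tsum_ofReal (hcm : ∀ e, Measurable fun a => c a e)
    (hpm : ∀ e, Measurable fun a => p a e) :
    Measurable fun a => ∑' e : ℕ × ℕ, c a e * ENNReal.ofReal (p a e) :=
  Measurable.tsum fun e => (hcm e).mul (hpm e).ennreal_ofReal

/-- The mean of a weighted link count is the mean of the sum of the link probabilities. -/
theorem IsGraphInput.lintegral_linkSum (hG : IsGraphInput P θ ϑ U)
    (hcm : ∀ e, Measurable fun a => c a e) (hpm : ∀ e, Measurable fun a => p a e)
    (hp : ∀ a e, p a e ∈ Icc (0 : ℝ) 1) :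
    ∫⁻ ω, ∑' e : ℕ × ℕ, c (fun i => (θ i ω, ϑ i ω)) e *
        leInd (U e.1 e.2 ω) (p (fun i => (θ i ω, ϑ i ω)) e) ∂P =
      ∫⁻ ω, ∑' e : ℕ × ℕ, c (fun i => (θ i ω, ϑ i ω)) e *
        ENNReal.ofReal (p (fun i => (θ i ω, ϑ i ω)) e) ∂P := by
  rw [lintegral_lintegral_of_indepFun hG.measurable_atoms hG.measurable_array hG.indep_atoms
    (measurable_tsum_leInd hcm hpm)]
  exact lintegral_congr fun ω => hG.lintegral_tsum_leInd (c fun i => (θ i ω, ϑ i ω))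
    (hp fun i => (θ i ω, ϑ i ω))

/-- The mean square distance of a link count from the sum of the link probabilities. -/
theorem IsGraphInput.lintegral_sq_linkSum_sub_le (hG : IsGraphInput P θ ϑ U)
    (hcm : ∀ e, Measurable fun a => c a e) (hpm : ∀ e, Measurable fun a => p a e)
    (hc : ∀ a e, c a e ≤ 1) (hp : ∀ a e, p a e ∈ Icc (0 : ℝ) 1)
    (hfin : ∫⁻ ω, ∑' e : ℕ × ℕ, c (fun i => (θ i ω, ϑ i ω)) e *
        ENNReal.ofReal (p (fun i => (θ i ω, ϑ i ω)) e) ∂P ≠ ∞) :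
    ∫⁻ ω, ENNReal.ofReal (((∑' e : ℕ × ℕ, c (fun i => (θ i ω, ϑ i ω)) e *
        leInd (U e.1 e.2 ω) (p (fun i => (θ i ω, ϑ i ω)) e)).toReal -
        (∑' e : ℕ × ℕ, c (fun i => (θ i ω, ϑ i ω)) e *
        ENNReal.ofReal (p (fun i => (θ i ω, ϑ i ω)) e)).toReal) ^ 2) ∂P ≤
      2 * ∫⁻ ω, ∑' e : ℕ × ℕ, c (fun i => (θ i ω, ϑ i ω)) e *
        ENNReal.ofReal (p (fun i => (θ i ω, ϑ i ω)) e) ∂P := by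
  have hS := measurable_tsum_ofReal hcm hpm
  have hF : Measurable fun au : (ℕ → ℝ × ℝ) × (ℕ × ℕ → ℝ) => ENNReal.ofReal
      (((∑' e : ℕ × ℕ, c au.1 e * leInd (au.2 e) (p au.1 e)).toReal -
        (∑' e : ℕ × ℕ, c au.1 e * ENNReal.ofReal (p au.1 e)).toReal) ^ 2) :=
    (((measurable_tsum_leInd hcm hpm).ennreal_toReal.sub
      (hS.comp measurable_fst).ennreal_toReal).pow_const 2).ennreal_ofReal
  have hS' : Measurable fun ω => ∑' e : ℕ × ℕ, c (fun i => (θ i ω, ϑ i ω)) e *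
        ENNReal.ofReal (p (fun i => (θ i ω, ϑ i ω)) e) := hS.comp hG.measurable_atoms
  rw [lintegral_lintegral_of_indepFun hG.measurable_atoms hG.measurable_array hG.indep_atoms hF,
    ← lintegral_const_mul 2 hS']
  -- For almost every configuration of points the sum of link probabilities is finite; it is the
  -- mean over the array, and the variance over the array is at most twice it.
  refine lintegral_mono_ae ?_
  filter_upwards [ae_lt_top hS' hfin] with ω hω
  refine lintegral_ofReal_sq_sub_le (Measurable.tsum fun e => ?_) hω.ne
    (hG.lintegral_tsum_leInd (c fun i => (θ i ω, ϑ i ω)) (hp fun i => (θ i ω, ϑ i ω)))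
    (hG.lintegral_tsum_leInd_sq_le (hc fun i => (θ i ω, ϑ i ω)) (hp fun i => (θ i ω, ϑ i ω)))
  exact measurable_const.mul (measurable_leInd (hG.measurable_U e.1 e.2) measurable_const)

end Links

/-! ### A maximal inequality for `U`-statistics of exchangeable sequences. -/

section Exchangeable

variable {V : Type*}

/-- The `U`-statistic of order two with kernel `H`, based on the first `n` terms of `v`. -/
noncomputable def uStat (H : V × V → ℝ) (n : ℕ) (v : ℕ → V) : ℝ :=
  (∑ k ∈ Finset.range n, ∑ l ∈ Finset.range n, if k ≠ l then H (v k, v l) else 0) /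
    (n * (n - 1))

/-- A permutation of the first `n` indices also permutes the first `m`, so it only reorders the
double sum. Hence events built from the statistics at times `m ≥ n` are invariant under such
permutations. -/
theorem uStat_comp_perm (H : V × V → ℝ) {n m : ℕ} (hnm : n ≤ m) {σ : Equiv.Perm ℕ}
    (hσ : ∀ k, n ≤ k → σ k = k) (v : ℕ → V) : uStat H m (fun k => v (σ k)) = uStat H m v := by
  have hmem : ∀ k, k ∈ Finset.range m ↔ σ k ∈ Finset.range m := by
    intro k
    simp only [Finset.mem_range]
    rcases lt_or_ge k n with h | h
    · refine iff_of_true (h.trans_le hnm) ?_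
      by_contra h'
      have h1 := hσ (σ k) (by omega)
      have := σ.injective h1
      omega
    · rw [hσ k h]
  unfold uStat
  congr 1
  refine Finset.sum_equiv σ hmem fun k _ => Finset.sum_equiv σ hmem fun l _ => ?_
  simp [σ.injective.eq_iff]

theorem uStat_neg (H : V × V → ℝ) (n : ℕ) (v : ℕ → V) :
    uStat (fun p => -H p) n v = -uStat H n v := by
  unfold uStat
  rw [← neg_div, ← Finset.sum_neg_distrib]
  congr 1
  refine Finset.sum_congr rfl fun k _ => ?_
  rw [← Finset.sum_neg_distrib]
  refine Finset.sum_congr rfl fun l _ => ?_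
  split_ifs <;> simp

/-- With exchangeability this reduces every off-diagonal kernel term to the one at `(0, 1)`, without
disturbing events invariant under permutations of the first `n` indices. -/
theorem exists_perm_apply_pair {n k l : ℕ} (hn : 2 ≤ n) (hk : k < n) (hl : l < n) (hkl : k ≠ l) :
    ∃ σ : Equiv.Perm ℕ, σ 0 = k ∧ σ 1 = l ∧ ∀ j, n ≤ j → σ j = j := by
  set τ : Equiv.Perm ℕ := Equiv.swap 0 k with hτ
  have h0 : τ 0 = k := Equiv.swap_apply_left 0 k
  have h1 : k ≠ τ 1 := by
    rw [← h0]; exact fun h => zero_ne_one (τ.injective h)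
  have h1n : τ 1 < n := by
    rw [hτ, Equiv.swap_apply_def]; split_ifs <;> omega
  refine ⟨τ.trans (Equiv.swap (τ 1) l), ?_, ?_, fun j hj => ?_⟩
  · rw [Equiv.trans_apply, h0, Equiv.swap_apply_of_ne_of_ne h1 hkl]
  · rw [Equiv.trans_apply, Equiv.swap_apply_left]
  · have hj' : τ j = j := Equiv.swap_apply_of_ne_of_ne (by omega) (by omega)
    rw [Equiv.trans_apply, hj', Equiv.swap_apply_of_ne_of_ne (by omega) (by omega)]

variable [MeasurableSpace V] {Q : Measure (ℕ → V)}

/-- Invariance of the law of a sequence under permutations of the indices. -/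
def IsExchangeable (Q : Measure (ℕ → V)) : Prop :=
  ∀ σ : Equiv.Perm ℕ, Q.map (fun v k => v (σ k)) = Q

theorem measurable_comp_perm (σ : Equiv.Perm ℕ) :
    Measurable fun (v : ℕ → V) (k : ℕ) => v (σ k) :=
  measurable_pi_lambda _ fun k => measurable_pi_apply (σ k)

theorem measurable_kernel {H : V × V → ℝ} (hH : Measurable H) (k l : ℕ) :
    Measurable fun v : ℕ → V => H (v k, v l) :=
  hH.comp ((measurable_pi_apply k).prodMk (measurable_pi_apply l))

theorem measurable_uStat {H : V × V → ℝ} (hH : Measurable H) (n : ℕ) :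
    Measurable (uStat H n) := by
  refine Measurable.div_const (Finset.measurable_fun_sum _ fun k _ =>
    Finset.measurable_fun_sum _ fun l _ => ?_) _
  split_ifs
  · exact measurable_kernel hH k l
  · exact measurable_const

theorem IsExchangeable.integrable_kernel (hQ : IsExchangeable Q) {H : V × V → ℝ}
    (hH : Measurable H) (hint : Integrable (fun v => H (v 0, v 1)) Q) {k l : ℕ} (hkl : k ≠ l) :
    Integrable (fun v => H (v k, v l)) Q := by
  obtain ⟨σ, h0, h1, -⟩ := exists_perm_apply_pair (n := k + l + 2) (by omega) (by omega)
    (by omega) hkl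
  rw [← hQ σ] at hint
  have := (integrable_map_measure (measurable_kernel hH 0 1).aestronglyMeasurable
    (measurable_comp_perm σ).aemeasurable).1 hint
  simpa [Function.comp_def, h0, h1] using this

theorem IsExchangeable.integrable_uStat (hQ : IsExchangeable Q) {H : V × V → ℝ}
    (hH : Measurable H) (hint : Integrable (fun v => H (v 0, v 1)) Q) (n : ℕ) :
    Integrable (uStat H n) Q := by
  refine Integrable.div_const (integrable_finsetSum _ fun k _ =>
    integrable_finsetSum _ fun l _ => ?_) _
  split_ifs with h
  · exact hQ.integrable_kernel hH hint h
  · exact integrable_zero _ _ _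

/-- This is the reverse martingale property without conditional expectations: on an invariant event
all `n (n - 1)` kernel terms have the same integral, so the average does too, whatever `n` is. -/
theorem IsExchangeable.setIntegral_uStat (hQ : IsExchangeable Q) {H : V × V → ℝ}
    (hH : Measurable H) (hint : Integrable (fun v => H (v 0, v 1)) Q) {n : ℕ} (hn : 2 ≤ n)
    {D : Set (ℕ → V)} (hD : MeasurableSet D)
    (hinv : ∀ σ : Equiv.Perm ℕ, (∀ k, n ≤ k → σ k = k) → (fun v k => v (σ k)) ⁻¹' D = D) :
    ∫ v in D, uStat H n v ∂Q = ∫ v in D, H (v 0, v 1) ∂Q := by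
  have hterm : ∀ k ∈ Finset.range n, ∀ l ∈ Finset.range n,
      ∫ v in D, (if k ≠ l then H (v k, v l) else 0) ∂Q =
        if k ≠ l then ∫ v in D, H (v 0, v 1) ∂Q else 0 := by
    intro k hk l hl
    rw [Finset.mem_range] at hk hl
    split_ifs with hkl
    · obtain ⟨σ, h0, h1, hσ⟩ := exists_perm_apply_pair hn hk hl hkl
      conv_rhs => rw [← hQ σ]
      rw [setIntegral_map hD (measurable_kernel hH 0 1).aestronglyMeasurable
        (measurable_comp_perm σ).aemeasurable, hinv σ hσ]
      simp [h0, h1]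
    · simp
  have hI : ∀ k l, Integrable (fun v => if k ≠ l then H (v k, v l) else 0) (Q.restrict D) := by
    intro k l
    split_ifs with h
    · exact (hQ.integrable_kernel hH hint h).integrableOn
    · exact integrable_zero _ _ _
  unfold uStat
  rw [integral_div, integral_finsetSum _ fun k _ => integrable_finsetSum _ fun l _ => hI k l]
  have hcount : ∑ k ∈ Finset.range n, ∑ l ∈ Finset.range n,
      (if k ≠ l then ∫ v in D, H (v 0, v 1) ∂Q else 0) =
        (n * (n - 1)) * ∫ v in D, H (v 0, v 1) ∂Q := by
    have : ∀ k ∈ Finset.range n, ∑ l ∈ Finset.range n,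
        (if k ≠ l then ∫ v in D, H (v 0, v 1) ∂Q else 0) =
          (n - 1) * ∫ v in D, H (v 0, v 1) ∂Q := by
      intro k hk
      have h1 : ∀ l, (if k ≠ l then ∫ v in D, H (v 0, v 1) ∂Q else 0) =
          ∫ v in D, H (v 0, v 1) ∂Q - if k = l then ∫ v in D, H (v 0, v 1) ∂Q else 0 := by
        intro l; by_cases h : k = l <;> simp [h]
      simp_rw [h1]
      rw [Finset.sum_sub_distrib, Finset.sum_ite_eq, if_pos hk]
      simp only [Finset.sum_const, Finset.card_range, nsmul_eq_mul]
      ring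
    rw [Finset.sum_congr rfl this]
    simp only [Finset.sum_const, Finset.card_range, nsmul_eq_mul]
    ring
  rw [Finset.sum_congr rfl fun k hk => by
    rw [integral_finsetSum _ fun l _ => hI k l, Finset.sum_congr rfl fun l hl => hterm k hk l hl],
    hcount]
  have h2 : (2 : ℝ) ≤ n := by exact_mod_cast hn
  have h3 : (n : ℝ) * (n - 1) ≠ 0 := mul_ne_zero (by linarith) (by linarith)
  rw [mul_div_cancel_left₀ _ h3]

variable [IsProbabilityMeasure Q]

/-- The event that `n` is the last index up to `N` at which the `U`-statistic exceeds `ε` in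
absolute value, intersected with the event that it is positive there. -/
def lastExceedPos (H : V × V → ℝ) (ε : ℝ) (N n : ℕ) : Set (ℕ → V) :=
  {v | ε < uStat H n v ∧ ∀ m, n < m → m ≤ N → |uStat H m v| ≤ ε}

theorem measurableSet_lastExceedPos {H : V × V → ℝ} (hH : Measurable H) (ε : ℝ) (N n : ℕ) :
    MeasurableSet (lastExceedPos H ε N n) := by
  refine (measurableSet_lt measurable_const (measurable_uStat hH n)).inter ?_
  have : {v : ℕ → V | ∀ m, n < m → m ≤ N → |uStat H m v| ≤ ε} =
      ⋂ m, ⋂ (_ : n < m), ⋂ (_ : m ≤ N), {v | |uStat H m v| ≤ ε} := by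
    ext v; simp
  change MeasurableSet {v : ℕ → V | ∀ m, n < m → m ≤ N → |uStat H m v| ≤ ε}
  rw [this]
  exact MeasurableSet.iInter fun m => MeasurableSet.iInter fun _ => MeasurableSet.iInter fun _ =>
    measurableSet_le (measurable_uStat hH m).abs measurable_const

/-- The event involves only the statistics from time `n` on, so it is invariant under permutations
of the first `n` indices. On it the statistics at `n` and at the earlier `n₀` therefore have equal
integrals, and the former exceeds `ε`. -/
theorem IsExchangeable.mul_measureReal_lastExceedPos_le (hQ : IsExchangeable Q) {H : V × V → ℝ}
    (hH : Measurable H) (hint : Integrable (fun v => H (v 0, v 1)) Q) {n₀ n N : ℕ} (hn₀ : 2 ≤ n₀)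
    (hn : n₀ ≤ n) (ε : ℝ) :
    ε * Q.real (lastExceedPos H ε N n) ≤ ∫ v in lastExceedPos H ε N n, |uStat H n₀ v| ∂Q := by
  have hD := measurableSet_lastExceedPos hH ε N n
  have hinv : ∀ σ : Equiv.Perm ℕ, (∀ k, n ≤ k → σ k = k) →
      (fun v k => v (σ k)) ⁻¹' lastExceedPos H ε N n = lastExceedPos H ε N n := by
    intro σ hσ
    ext v
    simp only [lastExceedPos, mem_preimage, mem_ofPred_eq]
    rw [uStat_comp_perm H le_rfl hσ v]
    refine and_congr_right fun _ => forall_congr' fun m => forall_congr' fun hm => ?_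
    rw [uStat_comp_perm H hm.le hσ v]
  calc ε * Q.real (lastExceedPos H ε N n)
      = ∫ v in lastExceedPos H ε N n, ε ∂Q := by
        rw [setIntegral_const, smul_eq_mul, mul_comm]
    _ ≤ ∫ v in lastExceedPos H ε N n, uStat H n v ∂Q :=
        setIntegral_mono_on (integrable_const _).integrableOn
          (hQ.integrable_uStat hH hint n).integrableOn hD fun v hv => hv.1.le
    _ = ∫ v in lastExceedPos H ε N n, uStat H n₀ v ∂Q := by
        rw [hQ.setIntegral_uStat hH hint (hn₀.trans hn) hD hinv,
          hQ.setIntegral_uStat hH hint hn₀ hD fun σ hσ => hinv σ fun k hk => hσ k (hn.trans hk)]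
    _ ≤ _ := setIntegral_mono (hQ.integrable_uStat hH hint n₀).integrableOn
          (hQ.integrable_uStat hH hint n₀).abs.integrableOn fun v => le_abs_self _

/-- A maximal inequality for `U`-statistics of an exchangeable sequence. -/
theorem IsExchangeable.mul_measureReal_exists_uStat_le (hQ : IsExchangeable Q) {H : V × V → ℝ}
    (hH : Measurable H) (hint : Integrable (fun v => H (v 0, v 1)) Q) {n₀ : ℕ} (hn₀ : 2 ≤ n₀)
    (N : ℕ) {ε : ℝ} (hε : 0 ≤ ε) :
    ε * Q.real {v | ∃ n, n₀ ≤ n ∧ n ≤ N ∧ ε < |uStat H n v|} ≤ ∫ v, |uStat H n₀ v| ∂Q := by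
  classical
  -- The exceedance event is cut according to the last time of exceedance, which gives disjoint
  -- pieces. Negative exceedances are positive ones for `-H`.
  set D : ℕ → Set (ℕ → V) := fun n =>
    lastExceedPos H ε N n ∪ lastExceedPos (fun p => -H p) ε N n with hDdef
  have hDm : ∀ n, MeasurableSet (D n) := fun n => (measurableSet_lastExceedPos hH ε N n).union
    (measurableSet_lastExceedPos hH.neg ε N n)
  have hmemD : ∀ n v, v ∈ D n ↔
      ε < |uStat H n v| ∧ ∀ m, n < m → m ≤ N → |uStat H m v| ≤ ε := by
    intro n v
    simp only [hDdef, lastExceedPos, mem_union, mem_ofPred_eq, uStat_neg, abs_neg, lt_abs]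
    tauto
  have hI : Integrable (fun v => |uStat H n₀ v|) Q := (hQ.integrable_uStat hH hint n₀).abs
  have hDn : ∀ n, n₀ ≤ n → ε * Q.real (D n) ≤ ∫ v in D n, |uStat H n₀ v| ∂Q := by
    intro n hn
    have hdisj : Disjoint (lastExceedPos H ε N n) (lastExceedPos (fun p => -H p) ε N n) := by
      rw [Set.disjoint_left]
      intro v h1 h2
      have h3 := h2.1
      rw [uStat_neg] at h3
      linarith [h1.1]
    have h1 := hQ.mul_measureReal_lastExceedPos_le hH hint (N := N) hn₀ hn ε
    have h2 := hQ.mul_measureReal_lastExceedPos_le (H := fun p => -H p) hH.neg hint.neg (N := N)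
      hn₀ hn ε
    simp only [uStat_neg, abs_neg] at h2
    rw [measureReal_union hdisj (measurableSet_lastExceedPos hH.neg ε N n),
      setIntegral_union hdisj (measurableSet_lastExceedPos hH.neg ε N n) hI.integrableOn
        hI.integrableOn, mul_add]
    exact add_le_add h1 h2
  have hpair : (Finset.Icc n₀ N : Set ℕ).PairwiseDisjoint D := by
    have hlt : ∀ m n, m < n → n ≤ N → Disjoint (D m) (D n) := by
      intro m n hmn hnN
      rw [Set.disjoint_left]
      intro v h1 h2
      exact absurd (((hmemD m v).1 h1).2 n hmn hnN) (not_le.2 ((hmemD n v).1 h2).1)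
    intro m hm n hn hmn
    have hm := Finset.mem_Icc.1 (Finset.mem_coe.1 hm)
    have hn := Finset.mem_Icc.1 (Finset.mem_coe.1 hn)
    rcases lt_or_gt_of_ne hmn with h | h
    · exact hlt m n h hn.2
    · exact (hlt n m h hm.2).symm
  have hsub : {v | ∃ n, n₀ ≤ n ∧ n ≤ N ∧ ε < |uStat H n v|} ⊆ ⋃ n ∈ Finset.Icc n₀ N, D n := by
    rintro v ⟨n, h1, h2, h3⟩
    set A := (Finset.Icc n₀ N).filter fun n => ε < |uStat H n v|
    have hA : A.Nonempty := ⟨n, by simp [A, h1, h2, h3]⟩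
    have hmax := A.max'_mem hA
    rw [Finset.mem_filter] at hmax
    refine mem_iUnion₂.2 ⟨A.max' hA, hmax.1, (hmemD _ v).2 ⟨hmax.2, fun m hm hmN => ?_⟩⟩
    by_contra hcon
    push Not at hcon
    have hmA : m ∈ A := by
      simp only [A, Finset.mem_filter, Finset.mem_Icc]
      exact ⟨⟨(Finset.mem_Icc.1 hmax.1).1.trans hm.le, hmN⟩, hcon⟩
    exact absurd (A.le_max' m hmA) (not_le.2 hm)
  calc ε * Q.real {v | ∃ n, n₀ ≤ n ∧ n ≤ N ∧ ε < |uStat H n v|}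
      ≤ ε * Q.real (⋃ n ∈ Finset.Icc n₀ N, D n) :=
        mul_le_mul_of_nonneg_left (measureReal_mono hsub (measure_ne_top _ _)) hε
    _ = ∑ n ∈ Finset.Icc n₀ N, ε * Q.real (D n) := by
        rw [measureReal_biUnion_finset hpair fun n _ => hDm n, Finset.mul_sum]
    _ ≤ ∑ n ∈ Finset.Icc n₀ N, ∫ v in D n, |uStat H n₀ v| ∂Q :=
        Finset.sum_le_sum fun n hn => hDn n (Finset.mem_Icc.1 hn).1
    _ = ∫ v in ⋃ n ∈ Finset.Icc n₀ N, D n, |uStat H n₀ v| ∂Q :=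
        (integral_biUnion_finset _ (fun n _ => hDm n) hpair fun n _ => hI.integrableOn).symm
    _ ≤ ∫ v, |uStat H n₀ v| ∂Q :=
        setIntegral_le_integral hI (ae_of_all _ fun v => abs_nonneg _)

end Exchangeable

/-! ### Exchangeability of Poisson counts. -/

section PoissonCounts

variable {Ω E : Type*} [MeasurableSpace Ω] [MeasurableSpace E] {P : Measure Ω}
  {M : Ω → Measure E} {Λ : Measure E}

theorem IsPoissonRandomMeasure.iIndepFun_count (hM : IsPoissonRandomMeasure M Λ P) {ι : Type*}
    {B : ι → Set E} (hB : ∀ k, MeasurableSet (B k))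
    (hd : Pairwise fun k l => Disjoint (B k) (B l)) : iIndepFun (fun k ω => M ω (B k)) P := by
  rw [iIndepFun_iff_finset]
  intro s
  have := hM.indep_count s.card (fun k => B (s.equivFin.symm k)) (fun k => hB _) fun k l hkl =>
    hd fun h => hkl (s.equivFin.symm.injective (Subtype.ext h))
  have h2 := this.precomp s.equivFin.injective
  simpa [Finset.restrict_def] using h2

/-- The counts in the cells of a grid whose rows have equal intensities form an exchangeable
sequence of vectors. -/
theorem IsPoissonRandomMeasure.isExchangeable_count (hM : IsPoissonRandomMeasure M Λ P)
    {ι : Type*} [Countable ι] {B : ℕ → ι → Set E} (hB : ∀ k p, MeasurableSet (B k p))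
    (hfin : ∀ k p, Λ (B k p) ≠ ∞) (heq : ∀ k l p, Λ (B k p) = Λ (B l p))
    (hd : Pairwise fun e f : ℕ × ι => Disjoint (B e.1 e.2) (B f.1 f.2)) :
    IsExchangeable (P.map fun ω k p => (M ω (B k p)).toReal) := by
  intro σ
  have hm : ∀ e : ℕ × ι, Measurable fun ω => M ω (B e.1 e.2) := fun e =>
    hM.measurable_count _ (hB _ _)
  have hI := hM.iIndepFun_count (B := fun e : ℕ × ι => B e.1 e.2) (fun e => hB _ _) hd
  have hmarg : ∀ e : ℕ × ι, P.map (fun ω => M ω (B (σ e.1) e.2)) =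
      P.map (fun ω => M ω (B e.1 e.2)) := fun e => by
    rw [hM.law_count _ (hB _ _) (hfin _ _), hM.law_count _ (hB _ _) (hfin _ _),
      heq (σ e.1) e.1 e.2]
  -- By independence the joint law is the product of its marginals, and by `hmarg` permuting the
  -- rows does not change the marginals.
  have h1 := hI.map_fun_eq_infinitePi_map hm
  have hinj : Function.Injective fun e : ℕ × ι => ((σ e.1, e.2) : ℕ × ι) := by
    rintro ⟨a, b⟩ ⟨c, d⟩ h
    simp only [Prod.mk.injEq, σ.injective.eq_iff] at h
    exact Prod.ext h.1 h.2
  have h2 := (hI.precomp hinj).map_fun_eq_infinitePi_map fun e => hm _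
  simp only [hmarg] at h2
  rw [← h1] at h2
  have hcur : Measurable fun (u : ℕ × ι → ℝ≥0∞) (k : ℕ) (p : ι) => (u (k, p)).toReal :=
    measurable_pi_lambda _ fun k => measurable_pi_lambda _ fun p =>
      (measurable_pi_apply (k, p)).ennreal_toReal
  have h3 := congrArg (Measure.map fun (u : ℕ × ι → ℝ≥0∞) (k : ℕ) (p : ι) => (u (k, p)).toReal) h2
  have hm1 : Measurable fun ω k p => (M ω (B k p)).toReal :=
    measurable_pi_lambda _ fun k => measurable_pi_lambda _ fun p =>
      (hm (k, p)).ennreal_toReal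
  rw [Measure.map_map hcur (measurable_pi_lambda _ fun e => hm (σ e.1, e.2)),
    Measure.map_map hcur (measurable_pi_lambda _ fun e => hm e)] at h3
  rw [Measure.map_map (measurable_comp_perm σ) hm1]
  exact h3

end PoissonCounts

/-! ### Approximation in `L¹` by step functions on a grid. -/

section Grid

/-- The step function with value `c p q` on the cell `C p ×ˢ C q`. -/
noncomputable def gridFun {r : ℕ} (c : Fin r → Fin r → ℝ≥0) (C : Fin r → Set ℝ)
    (z : ℝ × ℝ) : ℝ≥0∞ :=
  ∑ p, ∑ q, c p q * ((C p).indicator 1 z.1 * (C q).indicator 1 z.2)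

theorem measurable_gridFun {r : ℕ} (c : Fin r → Fin r → ℝ≥0) {C : Fin r → Set ℝ}
    (hC : ∀ p, MeasurableSet (C p)) : Measurable (gridFun c C) :=
  Finset.measurable_fun_sum _ fun p _ => Finset.measurable_fun_sum _ fun q _ =>
    (((measurable_one.indicator (hC p)).comp measurable_fst).mul
      ((measurable_one.indicator (hC q)).comp measurable_snd)).const_mul _

theorem gridFun_of_mem {r : ℕ} (c : Fin r → Fin r → ℝ≥0) {C : Fin r → Set ℝ}
    (hd : Pairwise fun p q => Disjoint (C p) (C q)) {p q : Fin r} {z : ℝ × ℝ} (hp : z.1 ∈ C p)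
    (hq : z.2 ∈ C q) : gridFun c C z = c p q := by
  have hne : ∀ {p p' : Fin r} {x : ℝ}, x ∈ C p → p' ≠ p → x ∉ C p' := fun hx hpp hx' =>
    Set.disjoint_left.1 (hd hpp) hx' hx
  unfold gridFun
  rw [Finset.sum_eq_single p, Finset.sum_eq_single q]
  · simp [hp, hq]
  · intro q' _ h; simp [hne hq h]
  · simp
  · intro p' _ h; simp [hne hp h]
  · simp

theorem gridFun_of_notMem {r : ℕ} (c : Fin r → Fin r → ℝ≥0) {C : Fin r → Set ℝ} {z : ℝ × ℝ}
    (h : (∀ p, z.1 ∉ C p) ∨ ∀ p, z.2 ∉ C p) : gridFun c C z = 0 := by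
  unfold gridFun
  refine Finset.sum_eq_zero fun p _ => Finset.sum_eq_zero fun q _ => ?_
  rcases h with h | h
  · simp [h p]
  · simp [h q]

/-- The `p`-th cell of the partition of `[-K, K)` into intervals of length `1 / m`. -/
def gridCell (K m : ℕ) (p : Fin (2 * K * m)) : Set ℝ :=
  Ico (-K + (p : ℝ) / m) (-K + ((p : ℝ) + 1) / m)

theorem exists_mem_gridCell {K m : ℕ} (hm : 0 < m) {x : ℝ} (h1 : -(K : ℝ) ≤ x) (h2 : x < K) :
    ∃ p, x ∈ gridCell K m p := by
  have hm' : (0 : ℝ) < m := by exact_mod_cast hm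
  have h0 : 0 ≤ (x + K) * m := mul_nonneg (by linarith) hm'.le
  have hlt : ⌊(x + K) * m⌋₊ < 2 * K * m := by
    rw [Nat.floor_lt h0]
    push_cast
    exact mul_lt_mul_of_pos_right (by linarith) hm'
  refine ⟨⟨_, hlt⟩, ?_, ?_⟩
  · have := Nat.floor_le h0
    rw [← div_le_iff₀ hm'] at this
    simp only
    linarith
  · have := Nat.lt_floor_add_one ((x + K) * m)
    rw [← lt_div_iff₀ hm'] at this
    simp only
    linarith

theorem gridCell_subset {K m : ℕ} (hm : 0 < m) (p : Fin (2 * K * m)) :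
    gridCell K m p ⊆ Ico (-(K : ℝ)) K := by
  have hm' : (0 : ℝ) < m := by exact_mod_cast hm
  refine Ico_subset_Ico ?_ ?_
  · have : (0 : ℝ) ≤ (p : ℝ) / m := by positivity
    linarith
  · have h : ((p : ℕ) : ℝ) + 1 ≤ 2 * K * m := by exact_mod_cast p.2
    have := (div_le_iff₀ hm').2 h
    linarith

theorem disjoint_gridCell {K m : ℕ} (hm : 0 < m) :
    Pairwise fun p q => Disjoint (gridCell K m p) (gridCell K m q) := by
  have hm' : (0 : ℝ) < m := by exact_mod_cast hm
  have hlt : ∀ p q : Fin (2 * K * m), p < q → Disjoint (gridCell K m p) (gridCell K m q) := by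
    intro p q hpq
    rw [Set.disjoint_left]
    intro x hx hx'
    have h1 := hx.2
    have h2 := hx'.1
    have h : ((p : ℕ) : ℝ) + 1 ≤ (q : ℕ) := by exact_mod_cast hpq
    have := div_le_div_of_nonneg_right h hm'.le
    linarith
  intro p q hpq
  rcases lt_or_gt_of_ne hpq with h | h
  · exact hlt p q h
  · exact (hlt q p h).symm

theorem abs_sub_le_of_mem_gridCell {K m : ℕ} {p : Fin (2 * K * m)} {x : ℝ}
    (hx : x ∈ gridCell K m p) : |x - (-K + (p : ℝ) / m)| ≤ 1 / m := by
  have h1 := hx.1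
  have h2 := hx.2
  rw [add_div] at h2
  rw [abs_le]
  constructor
  · have : (0 : ℝ) ≤ 1 / m := by positivity
    linarith
  · linarith

/-- Step functions on grids with disjoint cells are dense in `L¹` among nonnegative functions. -/
theorem exists_gridFun_approx {f : ℝ × ℝ → ℝ} (hf0 : ∀ z, 0 ≤ f z) (hf : Integrable f)
    {ε : ℝ≥0∞} (hε : ε ≠ 0) :
    ∃ (r : ℕ) (c : Fin r → Fin r → ℝ≥0) (C : Fin r → Set ℝ),
      (∀ p, MeasurableSet (C p)) ∧ (Pairwise fun p q => Disjoint (C p) (C q)) ∧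
      (∀ p, volume (C p) ≠ ∞) ∧ ∫⁻ z, ‖f z - (gridFun c C z).toReal‖ₑ ≤ ε := by
  -- Half of `ε` pays for replacing `f` by a continuous `g` supported in a box. The other half pays
  -- for sampling `g` at the corners of cells so fine that `g` oscillates by less than `η`, where
  -- `η` times the volume of the box is at most `ε / 2`.
  obtain ⟨g, hgs, hgf, hgc, -⟩ := hf.exists_hasCompactSupport_lintegral_sub_le
    (ENNReal.half_pos hε).ne'
  obtain ⟨R, hR⟩ := hgs.isBounded.subset_closedBall 0
  obtain ⟨K, hK⟩ := exists_nat_gt (max R 0)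
  have hK0 : (0 : ℝ) < K := (le_max_right _ _).trans_lt hK
  have hgu := hgs.uniformContinuous_of_continuous hgc
  obtain ⟨η, hη0, hη⟩ : ∃ η : ℝ≥0, 0 < η ∧
      (η : ℝ≥0∞) * volume (Ico (-(K : ℝ)) K ×ˢ Ico (-(K : ℝ)) K) ≤ ε / 2 := by
    have hv : volume (Ico (-(K : ℝ)) K ×ˢ Ico (-(K : ℝ)) K) ≠ ∞ := by
      rw [Measure.volume_eq_prod, Measure.prod_prod, Real.volume_Ico]
      finiteness
    obtain ⟨η, h1, h2⟩ := ENNReal.exists_nnreal_pos_mul_lt hv (ENNReal.half_pos hε).ne'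
    exact ⟨η, h1, h2.le⟩
  obtain ⟨δ, hδ0, hδ⟩ := Metric.uniformContinuous_iff.1 hgu η (by exact_mod_cast hη0)
  obtain ⟨m', hm'⟩ := exists_nat_one_div_lt hδ0
  set m := m' + 1 with hmdef
  have hm : 0 < m := Nat.succ_pos _
  have hm1 : (1 : ℝ) / m < δ := by simpa [hmdef] using hm'
  set b : Fin (2 * K * m) → ℝ := fun p => -K + (p : ℝ) / m with hb
  refine ⟨2 * K * m, fun p q => (g (b p, b q)).toNNReal, gridCell K m, fun p => measurableSet_Ico,
    disjoint_gridCell hm, fun p => by simp [gridCell], ?_⟩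
  set h : ℝ × ℝ → ℝ≥0∞ := gridFun (fun p q => (g (b p, b q)).toNNReal) (gridCell K m) with hh
  set S := Ico (-(K : ℝ)) K ×ˢ Ico (-(K : ℝ)) K with hS
  have hSm : MeasurableSet S := measurableSet_Ico.prod measurableSet_Ico
  have key : ∀ z, ‖f z - (h z).toReal‖ₑ ≤ ‖f z - g z‖ₑ + S.indicator (fun _ => (η : ℝ≥0∞)) z := by
    intro z
    by_cases hz : z ∈ S
    · obtain ⟨p, hp⟩ := exists_mem_gridCell hm hz.1.1 hz.1.2
      obtain ⟨q, hq⟩ := exists_mem_gridCell hm hz.2.1 hz.2.2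
      have hval : (h z).toReal = max (g (b p, b q)) 0 := by
        rw [hh, gridFun_of_mem _ (disjoint_gridCell hm) hp hq]
        simp [Real.coe_toNNReal']
      have hdist : dist z (b p, b q) < δ := by
        rw [Prod.dist_eq, max_lt_iff, Real.dist_eq, Real.dist_eq]
        exact ⟨(abs_sub_le_of_mem_gridCell hp).trans_lt hm1,
          (abs_sub_le_of_mem_gridCell hq).trans_lt hm1⟩
      have hg := hδ hdist
      rw [Real.dist_eq] at hg
      rw [indicator_of_mem hz, hval]
      have h1 : |f z - max (g (b p, b q)) 0| ≤ |f z - g z| + η := by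
        -- Truncating the sampled value at `0` brings it no farther from `f z`, since `f z` is
        -- nonnegative.
        have h2 : |f z - max (g (b p, b q)) 0| ≤ |f z - g (b p, b q)| := by
          conv_lhs => rw [← max_eq_left (hf0 z)]
          exact abs_max_sub_max_le_abs _ _ _
        have h3 := abs_sub_le (f z) (g z) (g (b p, b q))
        linarith
      rw [← ofReal_norm, ← ofReal_norm, Real.norm_eq_abs, Real.norm_eq_abs]
      refine (ENNReal.ofReal_le_ofReal h1).trans ?_
      rw [ENNReal.ofReal_add (abs_nonneg _) η.coe_nonneg]
      simp
    · have hgz : g z = 0 := by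
        by_contra hne
        have hz' := hR (subset_tsupport g hne)
        rw [mem_closedBall_zero_iff, Prod.norm_def, max_le_iff, Real.norm_eq_abs,
          Real.norm_eq_abs, abs_le, abs_le] at hz'
        have hRK : R < K := (le_max_left _ _).trans_lt hK
        exact hz ⟨⟨by linarith [hz'.1.1], by linarith [hz'.1.2]⟩,
          ⟨by linarith [hz'.2.1], by linarith [hz'.2.2]⟩⟩
      have hhz : h z = 0 := by
        refine gridFun_of_notMem _ ?_
        by_contra hcon
        push Not at hcon
        obtain ⟨⟨p, hp⟩, q, hq⟩ := hcon
        exact hz ⟨gridCell_subset hm p hp, gridCell_subset hm q hq⟩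
      simp [hgz, hhz]
  calc ∫⁻ z, ‖f z - (h z).toReal‖ₑ
      ≤ ∫⁻ z, (‖f z - g z‖ₑ + S.indicator (fun _ => (η : ℝ≥0∞)) z) := lintegral_mono key
    _ = (∫⁻ z, ‖f z - g z‖ₑ) + η * volume S := by
        rw [lintegral_add_right _ (measurable_const.indicator hSm), lintegral_indicator_const hSm]
    _ ≤ ε / 2 + ε / 2 := add_le_add hgf hη
    _ = ε := ENNReal.add_halves ε

end Grid

/-! ### Linearity of pair sums. -/

section PairSumAlgebra

variable {Ω E : Type*} {x : ℕ → Ω → E}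

theorem pairSum_mono {G G' : E × E → ℝ≥0∞} (h : ∀ e, G e ≤ G' e) (ω : Ω) :
    pairSum x G ω ≤ pairSum x G' ω :=
  ENNReal.tsum_le_tsum fun i => ENNReal.tsum_le_tsum fun j => by split_ifs <;> simp [h]

theorem pairSum_add (G G' : E × E → ℝ≥0∞) (ω : Ω) :
    pairSum x (fun e => G e + G' e) ω = pairSum x G ω + pairSum x G' ω := by
  unfold pairSum
  rw [← ENNReal.tsum_add]
  refine tsum_congr fun i => ?_
  rw [← ENNReal.tsum_add]
  exact tsum_congr fun j => by split_ifs <;> simp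

theorem pairSum_const_mul (c : ℝ≥0∞) (G : E × E → ℝ≥0∞) (ω : Ω) :
    pairSum x (fun e => c * G e) ω = c * pairSum x G ω := by
  unfold pairSum
  rw [← ENNReal.tsum_mul_left]
  refine tsum_congr fun i => ?_
  rw [← ENNReal.tsum_mul_left]
  exact tsum_congr fun j => by split_ifs <;> simp

theorem pairSum_zero (ω : Ω) : pairSum x (fun _ => 0) ω = 0 := by simp [pairSum]

theorem pairSum_finsetSum {ι : Type*} (s : Finset ι) (G : ι → E × E → ℝ≥0∞) (ω : Ω) :
    pairSum x (fun e => ∑ a ∈ s, G a e) ω = ∑ a ∈ s, pairSum x (G a) ω := by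
  classical
  induction s using Finset.induction_on with
  | empty => simp [pairSum]
  | insert a s ha ih => simp only [Finset.sum_insert ha, pairSum_add, ih]

end PairSumAlgebra

/-! ### Averages over pairs of points in distinct time slabs. -/

section SlabMean

/-- Lebesgue measure on the positive half-line. -/
noncomputable abbrev halfLine : Measure ℝ := volume.restrict (Ioi 0)

theorem halfLine_prod :
    halfLine.prod halfLine = (volume : Measure (ℝ × ℝ)).restrict (Ioi 0 ×ˢ Ioi 0) := by
  rw [Measure.prod_restrict, Measure.volume_eq_prod]

/-- The `k`-th slab of the half-line. -/
def slab (k : ℕ) : Set ℝ := Ioc k (k + 1)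

theorem measurableSet_slab (k : ℕ) : MeasurableSet (slab k) := measurableSet_Ioc

theorem halfLine_slab (k : ℕ) : halfLine (slab k) = 1 := by
  have h : slab k ⊆ Ioi 0 := fun t ht => (Nat.cast_nonneg k).trans_lt ht.1
  rw [Measure.restrict_apply (measurableSet_slab k), inter_eq_left.2 h, slab, Real.volume_Ioc]
  simp

theorem disjoint_slab {k l : ℕ} (h : k ≠ l) : Disjoint (slab k) (slab l) := by
  have hlt : ∀ k l : ℕ, k < l → Disjoint (slab k) (slab l) := by
    intro k l hkl
    rw [Set.disjoint_left]
    intro t ht ht'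
    have h1 : (k : ℝ) + 1 ≤ l := by exact_mod_cast hkl
    linarith [ht.2, ht'.1]
  rcases lt_or_gt_of_ne h with h | h
  · exact hlt k l h
  · exact (hlt l k h).symm

/-- The product kernel `a(t) b(s) f(x, y)`. -/
noncomputable def timeKernel (a b : ℝ → ℝ≥0∞) (f : ℝ × ℝ → ℝ≥0∞) (e : (ℝ × ℝ) × (ℝ × ℝ)) : ℝ≥0∞ :=
  a e.1.1 * b e.2.1 * f (e.1.2, e.2.2)

theorem measurable_timeKernel {a b : ℝ → ℝ≥0∞} {f : ℝ × ℝ → ℝ≥0∞} (ha : Measurable a)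
    (hb : Measurable b) (hf : Measurable f) : Measurable (timeKernel a b f) := by
  unfold timeKernel
  fun_prop

theorem lintegral_timeKernel {μ : Measure ℝ} [SFinite μ] {a b : ℝ → ℝ≥0∞} {f : ℝ × ℝ → ℝ≥0∞}
    (ha : Measurable a) (hb : Measurable b) (hf : Measurable f) :
    ∫⁻ e, timeKernel a b f e ∂((μ.prod μ).prod (μ.prod μ)) =
      (∫⁻ t, a t ∂μ) * (∫⁻ t, b t ∂μ) * ∫⁻ z, f z ∂(μ.prod μ) := by
  have hinner : ∀ e : ℝ × ℝ, ∫⁻ e', timeKernel a b f (e, e') ∂(μ.prod μ) =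
      a e.1 * ((∫⁻ t, b t ∂μ) * ∫⁻ y, f (e.2, y) ∂μ) := by
    intro e
    have h1 : Measurable fun y => f (e.2, y) := by fun_prop
    calc ∫⁻ e', timeKernel a b f (e, e') ∂(μ.prod μ)
        = ∫⁻ e' : ℝ × ℝ, a e.1 * (b e'.1 * f (e.2, e'.2)) ∂(μ.prod μ) :=
          lintegral_congr fun e' => by simp only [timeKernel]; ring
      _ = a e.1 * ∫⁻ e' : ℝ × ℝ, b e'.1 * f (e.2, e'.2) ∂(μ.prod μ) :=
          lintegral_const_mul _ (by fun_prop)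
      _ = _ := by rw [lintegral_prod_mul hb.aemeasurable h1.aemeasurable]
  have h2 : Measurable fun z => ∫⁻ y, f (z, y) ∂μ := hf.lintegral_prod_right'
  rw [lintegral_prod _ (measurable_timeKernel ha hb hf).aemeasurable]
  simp_rw [hinner]
  rw [lintegral_prod_mul (f := a) (g := fun z => (∫⁻ t, b t ∂μ) * ∫⁻ y, f (z, y) ∂μ)
    ha.aemeasurable (h2.const_mul _).aemeasurable, lintegral_const_mul _ h2,
    lintegral_prod _ hf.aemeasurable]
  ring

/-- The kernel `f` on pairs of points in distinct slabs among the first `n`. -/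
noncomputable def slabKernel (n : ℕ) (f : ℝ × ℝ → ℝ≥0∞) (e : (ℝ × ℝ) × (ℝ × ℝ)) : ℝ≥0∞ :=
  ∑ k ∈ Finset.range n, ∑ l ∈ Finset.range n,
    if k ≠ l then timeKernel ((slab k).indicator 1) ((slab l).indicator 1) f e else 0

theorem measurable_slabKernel (n : ℕ) {f : ℝ × ℝ → ℝ≥0∞} (hf : Measurable f) :
    Measurable (slabKernel n f) := by
  refine Finset.measurable_fun_sum _ fun k _ => Finset.measurable_fun_sum _ fun l _ => ?_
  split_ifs
  · exact measurable_timeKernel (measurable_one.indicator (measurableSet_slab k))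
      (measurable_one.indicator (measurableSet_slab l)) hf
  · exact measurable_const

theorem sum_range_ite_ne_const {R : Type*} [CommSemiring R] (n : ℕ) (a : R) :
    ∑ k ∈ Finset.range n, ∑ l ∈ Finset.range n, (if k ≠ l then a else 0) =
      ((n * (n - 1) : ℕ) : R) * a := by
  have : ∀ k ∈ Finset.range n, ∑ l ∈ Finset.range n, (if k ≠ l then a else 0) =
      ((n - 1 : ℕ) : R) * a := by
    intro k hk
    rw [← Finset.sum_filter, Finset.sum_const, nsmul_eq_mul, Finset.filter_ne,
      Finset.card_erase_of_mem hk, Finset.card_range]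
  rw [Finset.sum_congr rfl this, Finset.sum_const, nsmul_eq_mul, Finset.card_range]
  push_cast
  ring

theorem lintegral_slabKernel (n : ℕ) {f : ℝ × ℝ → ℝ≥0∞} (hf : Measurable f) :
    ∫⁻ e, slabKernel n f e ∂((halfLine.prod halfLine).prod (halfLine.prod halfLine)) =
      ((n * (n - 1) : ℕ) : ℝ≥0∞) * ∫⁻ z, f z ∂(halfLine.prod halfLine) := by
  have hI : ∀ k, Measurable ((slab k).indicator (1 : ℝ → ℝ≥0∞)) := fun k =>
    measurable_one.indicator (measurableSet_slab k)
  have hm : ∀ k l : ℕ, Measurable fun e =>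
      if k ≠ l then timeKernel ((slab k).indicator 1) ((slab l).indicator 1) f e else 0 := by
    intro k l
    split_ifs
    · exact measurable_timeKernel (hI k) (hI l) hf
    · exact measurable_const
  unfold slabKernel
  rw [lintegral_finsetSum _ fun k _ => Finset.measurable_fun_sum _ fun l _ => hm k l,
    ← sum_range_ite_ne_const]
  refine Finset.sum_congr rfl fun k _ => ?_
  rw [lintegral_finsetSum _ fun l _ => hm k l]
  refine Finset.sum_congr rfl fun l _ => ?_
  split_ifs
  · rw [lintegral_timeKernel (hI k) (hI l) hf, lintegral_indicator_one (measurableSet_slab k),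
      lintegral_indicator_one (measurableSet_slab l), halfLine_slab, halfLine_slab]
    simp
  · simp

variable {Ω : Type*} {x : ℕ → Ω → ℝ × ℝ}

/-- The average of `f` over pairs of points in distinct slabs among the first `n`, normalised by
the number of pairs of slabs. -/
noncomputable def slabMean (x : ℕ → Ω → ℝ × ℝ) (n : ℕ) (f : ℝ × ℝ → ℝ≥0∞) (ω : Ω) : ℝ≥0∞ :=
  pairSum x (slabKernel n f) ω / ((n * (n - 1) : ℕ) : ℝ≥0∞)

theorem timeKernel_add (a b : ℝ → ℝ≥0∞) (f g : ℝ × ℝ → ℝ≥0∞) (e : (ℝ × ℝ) × (ℝ × ℝ)) :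
    timeKernel a b (fun z => f z + g z) e = timeKernel a b f e + timeKernel a b g e :=
  mul_add _ _ _

theorem slabMean_add (n : ℕ) (f g : ℝ × ℝ → ℝ≥0∞) (ω : Ω) :
    slabMean x n (fun z => f z + g z) ω = slabMean x n f ω + slabMean x n g ω := by
  unfold slabMean
  rw [← ENNReal.add_div, ← pairSum_add]
  congr 2
  ext e
  unfold slabKernel
  rw [← Finset.sum_add_distrib]
  refine Finset.sum_congr rfl fun k _ => ?_
  rw [← Finset.sum_add_distrib]
  refine Finset.sum_congr rfl fun l _ => ?_
  split_ifs
  · exact timeKernel_add _ _ _ _ _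
  · simp

theorem slabMean_mono (n : ℕ) {f g : ℝ × ℝ → ℝ≥0∞} (h : ∀ z, f z ≤ g z) (ω : Ω) :
    slabMean x n f ω ≤ slabMean x n g ω := by
  refine ENNReal.div_le_div_right (pairSum_mono (fun e => ?_) ω) _
  refine Finset.sum_le_sum fun k _ => Finset.sum_le_sum fun l _ => ?_
  split_ifs
  · exact mul_le_mul_right (h _) _
  · exact le_rfl

variable [MeasurableSpace Ω] {P : Measure Ω}

theorem measurable_slabMean (hx : ∀ i, Measurable (x i)) (n : ℕ) {f : ℝ × ℝ → ℝ≥0∞}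
    (hf : Measurable f) : Measurable (slabMean x n f) :=
  (measurable_pairSum hx (measurable_slabKernel n hf)).div_const _

/-- Each of the `n (n - 1)` ordered pairs of distinct unit slabs contributes the integral of `f`, so
the mean does not depend on `n`. The bound `2 ≤ n` keeps the normalising factor nonzero. -/
theorem lintegral_slabMean (hx : ∀ i, Measurable (x i))
    (hM : IsPoissonRandomMeasure (atomMeasure x) (halfLine.prod halfLine) P) {n : ℕ} (hn : 2 ≤ n)
    {f : ℝ × ℝ → ℝ≥0∞} (hf : Measurable f) :
    ∫⁻ ω, slabMean x n f ω ∂P = ∫⁻ z, f z ∂(halfLine.prod halfLine) := by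
  have h0 : ((n * (n - 1) : ℕ) : ℝ≥0∞) ≠ 0 := by
    rw [Nat.cast_ne_zero]
    exact Nat.mul_ne_zero (by omega) (by omega)
  unfold slabMean
  simp_rw [div_eq_mul_inv]
  rw [lintegral_mul_const _ (measurable_pairSum hx (measurable_slabKernel n hf)),
    hM.lintegral_pairSum hx (measurable_slabKernel n hf), lintegral_slabKernel n hf, mul_comm,
    ← mul_assoc, ENNReal.inv_mul_cancel h0 (ENNReal.natCast_ne_top _), one_mul]

theorem enorm_toReal_sub_le {a b d : ℝ≥0∞} (ha : a ≠ ∞) (hb : b ≠ ∞) (hab : a ≤ b + d)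
    (hba : b ≤ a + d) : ‖a.toReal - b.toReal‖ₑ ≤ d := by
  rcases eq_or_ne d ∞ with rfl | hd
  · exact le_top
  lift a to ℝ≥0 using ha
  lift b to ℝ≥0 using hb
  lift d to ℝ≥0 using hd
  have h1 : (a : ℝ) ≤ b + d := by exact_mod_cast hab
  have h2 : (b : ℝ) ≤ a + d := by exact_mod_cast hba
  rw [← ofReal_norm, Real.norm_eq_abs, ENNReal.coe_toReal, ENNReal.coe_toReal,
    ← ENNReal.ofReal_coe_nnreal]
  exact ENNReal.ofReal_le_ofReal (abs_le.2 ⟨by linarith, by linarith⟩)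

/-- The distance of the slab mean of `f` from its expectation. -/
noncomputable def slabDev (x : ℕ → Ω → ℝ × ℝ) (n : ℕ) (f : ℝ × ℝ → ℝ≥0∞) (ω : Ω) : ℝ≥0∞ :=
  ‖(slabMean x n f ω).toReal - (∫⁻ z, f z ∂(halfLine.prod halfLine)).toReal‖ₑ

theorem ae_slabMean_ne_top (hx : ∀ i, Measurable (x i))
    (hM : IsPoissonRandomMeasure (atomMeasure x) (halfLine.prod halfLine) P)
    {f : ℝ × ℝ → ℝ≥0∞} (hf : Measurable f) (hfin : ∫⁻ z, f z ∂(halfLine.prod halfLine) ≠ ∞) :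
    ∀ᵐ ω ∂P, ∀ n, 2 ≤ n → slabMean x n f ω ≠ ∞ := by
  rw [ae_all_iff]
  intro n
  by_cases hn : 2 ≤ n
  · have := ae_lt_top (measurable_slabMean hx n hf)
      (by rw [lintegral_slabMean hx hM hn hf]; exact hfin)
    filter_upwards [this] with ω hω _ using hω.ne
  · exact ae_of_all _ fun ω h => absurd h hn

/-- Triangle inequality through the slab mean and the integral of `g`. The two one-sided bounds say
that `d` dominates the distance of `f` from `g`. One null set serves all `n`. -/
theorem ae_slabDev_le (hx : ∀ i, Measurable (x i))
    (hM : IsPoissonRandomMeasure (atomMeasure x) (halfLine.prod halfLine) P)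
    {f g d : ℝ × ℝ → ℝ≥0∞} (hf : Measurable f) (hg : Measurable g)
    (hfin : ∫⁻ z, f z ∂(halfLine.prod halfLine) ≠ ∞)
    (hgfin : ∫⁻ z, g z ∂(halfLine.prod halfLine) ≠ ∞) (hfg : ∀ z, f z ≤ g z + d z)
    (hgf : ∀ z, g z ≤ f z + d z) :
    ∀ᵐ ω ∂P, ∀ n, 2 ≤ n → slabDev x n f ω ≤
      slabDev x n g ω + slabMean x n d ω + ∫⁻ z, d z ∂(halfLine.prod halfLine) := by
  filter_upwards [ae_slabMean_ne_top hx hM hf hfin, ae_slabMean_ne_top hx hM hg hgfin]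
    with ω h1 h2 n hn
  have hI : ∀ {u v : ℝ × ℝ → ℝ≥0∞}, Measurable v → (∀ z, u z ≤ v z + d z) →
      ∫⁻ z, u z ∂(halfLine.prod halfLine) ≤
        ∫⁻ z, v z ∂(halfLine.prod halfLine) + ∫⁻ z, d z ∂(halfLine.prod halfLine) := by
    intro u v hv h
    rw [← lintegral_add_left hv]
    exact lintegral_mono h
  have e1 : ‖(slabMean x n f ω).toReal - (slabMean x n g ω).toReal‖ₑ ≤ slabMean x n d ω :=
    enorm_toReal_sub_le (h1 n hn) (h2 n hn)
      ((slabMean_mono n hfg ω).trans (slabMean_add n g d ω).le)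
      ((slabMean_mono n hgf ω).trans (slabMean_add n f d ω).le)
  have e2 := enorm_toReal_sub_le hgfin hfin (hI hf hgf) (hI hg hfg)
  unfold slabDev
  set A := (slabMean x n f ω).toReal
  set B := (slabMean x n g ω).toReal
  set a := (∫⁻ z, f z ∂(halfLine.prod halfLine)).toReal
  set b := (∫⁻ z, g z ∂(halfLine.prod halfLine)).toReal
  calc ‖A - a‖ₑ = ‖(B - b) + (A - B) + (b - a)‖ₑ := by congr 1; ring
    _ ≤ ‖B - b‖ₑ + ‖A - B‖ₑ + ‖b - a‖ₑ :=
        (enorm_add_le _ _).trans (add_le_add_left (enorm_add_le _ _) _)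
    _ ≤ _ := by gcongr

end SlabMean

/-! ### Slab means of step functions as `U`-statistics of count vectors. -/

section GridCounts

variable {Ω : Type*} {x : ℕ → Ω → ℝ × ℝ} {r : ℕ}

theorem timeKernel_gridFun (a b : ℝ → ℝ≥0∞) (c : Fin r → Fin r → ℝ≥0) (C : Fin r → Set ℝ)
    (e : (ℝ × ℝ) × (ℝ × ℝ)) :
    timeKernel a b (gridFun c C) e =
      ∑ p, ∑ q, c p q *
        timeKernel a b (fun z => (C p).indicator 1 z.1 * (C q).indicator 1 z.2) e := by
  unfold timeKernel gridFun
  rw [Finset.mul_sum]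
  refine Finset.sum_congr rfl fun p _ => ?_
  rw [Finset.mul_sum]
  refine Finset.sum_congr rfl fun q _ => ?_
  ring

theorem timeKernel_indicator (A B C D : Set ℝ) (e : (ℝ × ℝ) × (ℝ × ℝ)) :
    timeKernel (A.indicator 1) (B.indicator 1)
        (fun z => C.indicator 1 z.1 * D.indicator 1 z.2) e =
      ((A ×ˢ C) ×ˢ (B ×ˢ D)).indicator 1 e := by
  obtain ⟨⟨t, y⟩, s, z⟩ := e
  by_cases h1 : t ∈ A <;> by_cases h2 : s ∈ B <;> by_cases h3 : y ∈ C <;> by_cases h4 : z ∈ D <;>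
    simp [timeKernel, h1, h2, h3, h4]

theorem pairSum_indicator_of_disjoint {A B C D : Set ℝ} (hA : MeasurableSet A)
    (hB : MeasurableSet B) (hC : MeasurableSet C) (hD : MeasurableSet D) (hAB : Disjoint A B)
    (ω : Ω) :
    pairSum x (timeKernel (A.indicator 1) (B.indicator 1)
        fun z => C.indicator 1 z.1 * D.indicator 1 z.2) ω =
      atomMeasure x ω (A ×ˢ C) * atomMeasure x ω (B ×ˢ D) := by
  rw [atomMeasure_mul x (hA.prod hC) (hB.prod hD), prod_inter_prod, hAB.inter_eq, empty_prod,
    measure_empty, add_zero]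
  congr 1
  ext e
  exact timeKernel_indicator _ _ _ _ _

/-- For a step function only the counts in the cells matter, and distinct slabs are disjoint, so no
diagonal term spoils the products of counts. -/
theorem pairSum_slabKernel_gridFun (n : ℕ) (c : Fin r → Fin r → ℝ≥0) {C : Fin r → Set ℝ}
    (hC : ∀ p, MeasurableSet (C p)) (ω : Ω) :
    pairSum x (slabKernel n (gridFun c C)) ω =
      ∑ k ∈ Finset.range n, ∑ l ∈ Finset.range n, if k ≠ l then
        ∑ p, ∑ q, c p q * (atomMeasure x ω (slab k ×ˢ C p) * atomMeasure x ω (slab l ×ˢ C q))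
        else 0 := by
  have : slabKernel n (gridFun c C) = fun e => ∑ k ∈ Finset.range n, ∑ l ∈ Finset.range n,
      if k ≠ l then timeKernel ((slab k).indicator 1) ((slab l).indicator 1) (gridFun c C) e
        else 0 := rfl
  rw [this, pairSum_finsetSum]
  refine Finset.sum_congr rfl fun k _ => ?_
  rw [pairSum_finsetSum]
  refine Finset.sum_congr rfl fun l _ => ?_
  split_ifs with hkl
  · simp_rw [timeKernel_gridFun]
    rw [pairSum_finsetSum]
    refine Finset.sum_congr rfl fun p _ => ?_
    rw [pairSum_finsetSum]
    refine Finset.sum_congr rfl fun q _ => ?_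
    rw [pairSum_const_mul, pairSum_indicator_of_disjoint (measurableSet_slab k)
      (measurableSet_slab l) (hC p) (hC q) (disjoint_slab hkl)]
  · exact pairSum_zero ω

theorem iUnion_slab (n : ℕ) : ⋃ k ∈ Finset.range n, slab k = Ioc (0 : ℝ) n := by
  induction n with
  | zero => simp
  | succ n ih =>
    rw [Finset.range_add_one, Finset.set_biUnion_insert, ih, slab, union_comm,
      Ioc_union_Ioc_eq_Ioc (Nat.cast_nonneg n) (by linarith)]
    push_cast
    rfl

theorem sum_measure_slab (m : Measure (ℝ × ℝ)) {A : Set ℝ} (hA : MeasurableSet A) (n : ℕ) :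
    ∑ k ∈ Finset.range n, m (slab k ×ˢ A) = m (Ioc (0 : ℝ) n ×ˢ A) := by
  rw [← iUnion_slab, Set.iUnion₂_prod_const, measure_biUnion_finset]
  · intro k _ l _ hkl
    exact disjoint_prod.2 (Or.inl (disjoint_slab hkl))
  · exact fun k _ => (measurableSet_slab k).prod hA

/-- The sum of a step function over all pairs of points up to time `n`, including repetitions. -/
noncomputable def gridTotal (x : ℕ → Ω → ℝ × ℝ) (n : ℕ) (c : Fin r → Fin r → ℝ≥0)
    (C : Fin r → Set ℝ) (ω : Ω) : ℝ≥0∞ :=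
  ∑ p, ∑ q, c p q *
    (atomMeasure x ω (Ioc (0 : ℝ) n ×ˢ C p) * atomMeasure x ω (Ioc (0 : ℝ) n ×ˢ C q))

/-- Admitting `k = l` lets the sums over slabs factor into products of counts up to time `n`, whose
deviations are controlled by Poisson variances. -/
theorem pairSum_slabKernel_gridFun_le (n : ℕ) (c : Fin r → Fin r → ℝ≥0) {C : Fin r → Set ℝ}
    (hC : ∀ p, MeasurableSet (C p)) (ω : Ω) :
    pairSum x (slabKernel n (gridFun c C)) ω ≤ gridTotal x n c C ω := by
  rw [pairSum_slabKernel_gridFun n c hC]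
  calc _ ≤ ∑ k ∈ Finset.range n, ∑ l ∈ Finset.range n, ∑ p, ∑ q,
        c p q * (atomMeasure x ω (slab k ×ˢ C p) * atomMeasure x ω (slab l ×ˢ C q)) :=
        Finset.sum_le_sum fun k _ => Finset.sum_le_sum fun l _ => by
          split_ifs
          · exact le_rfl
          · exact zero_le
    _ = ∑ p, ∑ q, ∑ k ∈ Finset.range n, ∑ l ∈ Finset.range n,
        c p q * (atomMeasure x ω (slab k ×ˢ C p) * atomMeasure x ω (slab l ×ˢ C q)) := by
        simp_rw [Finset.sum_comm (s := Finset.range n) (t := Finset.univ)]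
    _ = _ := by
        refine Finset.sum_congr rfl fun p _ => Finset.sum_congr rfl fun q _ => ?_
        rw [← sum_measure_slab _ (hC p), ← sum_measure_slab _ (hC q), Finset.sum_mul_sum,
          Finset.mul_sum]
        exact Finset.sum_congr rfl fun k _ => (Finset.mul_sum _ _ _).symm

theorem lintegral_gridFun (c : Fin r → Fin r → ℝ≥0) {C : Fin r → Set ℝ}
    (hC : ∀ p, MeasurableSet (C p)) :
    ∫⁻ z, gridFun c C z ∂(halfLine.prod halfLine) =
      ∑ p, ∑ q, c p q * (halfLine (C p) * halfLine (C q)) := by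
  have hm : ∀ p q, Measurable fun z : ℝ × ℝ =>
      ((C p).indicator 1 z.1 * (C q).indicator 1 z.2 : ℝ≥0∞) := fun p q =>
    ((measurable_one.indicator (hC p)).comp measurable_fst).mul
      ((measurable_one.indicator (hC q)).comp measurable_snd)
  unfold gridFun
  rw [lintegral_finsetSum _ fun p _ => Finset.measurable_fun_sum _ fun q _ => (hm p q).const_mul _]
  refine Finset.sum_congr rfl fun p _ => ?_
  rw [lintegral_finsetSum _ fun q _ => (hm p q).const_mul _]
  refine Finset.sum_congr rfl fun q _ => ?_
  rw [lintegral_const_mul _ (hm p q), lintegral_prod_mul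
    (measurable_one.indicator (hC p)).aemeasurable (measurable_one.indicator (hC q)).aemeasurable,
    lintegral_indicator_one (hC p), lintegral_indicator_one (hC q)]

/-- The kernel on count vectors that corresponds to a step function. -/
noncomputable def gridKernel (c : Fin r → Fin r → ℝ≥0) (u : (Fin r → ℝ) × (Fin r → ℝ)) : ℝ :=
  ∑ p, ∑ q, c p q * (u.1 p * u.2 q)

theorem measurable_gridKernel (c : Fin r → Fin r → ℝ≥0) : Measurable (gridKernel c) := by
  unfold gridKernel
  fun_prop

theorem uStat_sub_const {V : Type*} (H : V × V → ℝ) (b : ℝ) {n : ℕ} (hn : 2 ≤ n) (v : ℕ → V) :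
    uStat (fun u => H u - b) n v = uStat H n v - b := by
  have h2 : (2 : ℝ) ≤ n := by exact_mod_cast hn
  have h3 : (n : ℝ) * (n - 1) ≠ 0 := mul_ne_zero (by linarith) (by linarith)
  have hs : ∑ k ∈ Finset.range n, ∑ l ∈ Finset.range n, (if k ≠ l then H (v k, v l) - b else 0) =
      ∑ k ∈ Finset.range n, ∑ l ∈ Finset.range n, (if k ≠ l then H (v k, v l) else 0) -
        (n * (n - 1)) * b := by
    have := sum_range_ite_ne_const n b
    rw [Nat.cast_mul, Nat.cast_sub (by omega), Nat.cast_one] at this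
    rw [← this, ← Finset.sum_sub_distrib]
    refine Finset.sum_congr rfl fun k _ => ?_
    rw [← Finset.sum_sub_distrib]
    refine Finset.sum_congr rfl fun l _ => ?_
    split_ifs <;> simp
  unfold uStat
  rw [hs, sub_div, mul_div_cancel_left₀ _ h3]

theorem toReal_slabMean_gridFun {n : ℕ} (hn : 2 ≤ n) (c : Fin r → Fin r → ℝ≥0)
    {C : Fin r → Set ℝ} (hC : ∀ p, MeasurableSet (C p)) {ω : Ω}
    (hω : ∀ k p, atomMeasure x ω (slab k ×ˢ C p) ≠ ∞) :
    (slabMean x n (gridFun c C) ω).toReal =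
      uStat (gridKernel c) n fun k p => (atomMeasure x ω (slab k ×ˢ C p)).toReal := by
  have hfin : ∀ k l p q, (c p q : ℝ≥0∞) *
      (atomMeasure x ω (slab k ×ˢ C p) * atomMeasure x ω (slab l ×ˢ C q)) ≠ ∞ := fun k l p q =>
    ENNReal.mul_ne_top ENNReal.coe_ne_top (ENNReal.mul_ne_top (hω k p) (hω l q))
  have hfin2 : ∀ k l p, ∑ q, (c p q : ℝ≥0∞) *
      (atomMeasure x ω (slab k ×ˢ C p) * atomMeasure x ω (slab l ×ˢ C q)) ≠ ∞ := fun k l p =>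
    ENNReal.sum_ne_top.2 fun q _ => hfin k l p q
  have hfin3 : ∀ k l, (if k ≠ l then ∑ p, ∑ q, (c p q : ℝ≥0∞) *
      (atomMeasure x ω (slab k ×ˢ C p) * atomMeasure x ω (slab l ×ˢ C q)) else 0) ≠ ∞ := by
    intro k l
    split_ifs
    · exact ENNReal.sum_ne_top.2 fun p _ => hfin2 k l p
    · simp
  unfold slabMean uStat gridKernel
  rw [ENNReal.toReal_div, pairSum_slabKernel_gridFun n c hC, ENNReal.toReal_natCast, Nat.cast_mul,
    Nat.cast_sub (by omega), Nat.cast_one]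
  congr 1
  rw [ENNReal.toReal_sum fun k _ => ENNReal.sum_ne_top.2 fun l _ => hfin3 k l]
  refine Finset.sum_congr rfl fun k _ => ?_
  rw [ENNReal.toReal_sum fun l _ => hfin3 k l]
  refine Finset.sum_congr rfl fun l _ => ?_
  split_ifs
  · rw [ENNReal.toReal_sum fun p _ => hfin2 k l p]
    refine Finset.sum_congr rfl fun p _ => ?_
    rw [ENNReal.toReal_sum fun q _ => hfin k l p q]
    refine Finset.sum_congr rfl fun q _ => ?_
    simp [ENNReal.toReal_mul]
  · simp

variable [MeasurableSpace Ω] {P : Measure Ω}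

theorem ae_count_slab_ne_top
    (hM : IsPoissonRandomMeasure (atomMeasure x) (halfLine.prod halfLine) P)
    {C : Fin r → Set ℝ} (hC : ∀ p, MeasurableSet (C p))
    (hCfin : ∀ p, halfLine (C p) ≠ ∞) :
    ∀ᵐ ω ∂P, ∀ k p, atomMeasure x ω (slab k ×ˢ C p) ≠ ∞ := by
  rw [ae_all_iff]
  intro k
  rw [ae_all_iff]
  intro p
  have hB := (measurableSet_slab k).prod (hC p)
  have hfin : (halfLine.prod halfLine) (slab k ×ˢ C p) ≠ ∞ := by
    rw [Measure.prod_prod, halfLine_slab, one_mul]; exact hCfin p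
  filter_upwards [ae_lt_top (hM.measurable_count _ hB) (by rwa [hM.lintegral_count hB hfin])]
    with ω hω using hω.ne

/-- The maximal inequality for slab means of step functions. -/
theorem mul_measure_exists_slabDev_gridFun_le [IsProbabilityMeasure P]
    (hM : IsPoissonRandomMeasure (atomMeasure x) (halfLine.prod halfLine) P)
    (c : Fin r → Fin r → ℝ≥0) {C : Fin r → Set ℝ}
    (hC : ∀ p, MeasurableSet (C p)) (hd : Pairwise fun p q => Disjoint (C p) (C q))
    (hCfin : ∀ p, halfLine (C p) ≠ ∞) {n₀ : ℕ} (hn₀ : 2 ≤ n₀) (N : ℕ) (ε : ℝ≥0) :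
    ε * P {ω | ∃ n, n₀ ≤ n ∧ n ≤ N ∧ ε < slabDev x n (gridFun c C) ω} ≤
      ∫⁻ ω, slabDev x n₀ (gridFun c C) ω ∂P := by
  set V : Ω → ℕ → Fin r → ℝ := fun ω k p => (atomMeasure x ω (slab k ×ˢ C p)).toReal with hV
  have hB : ∀ k p, MeasurableSet (slab k ×ˢ C p) := fun k p => (measurableSet_slab k).prod (hC p)
  have hΛ : ∀ k p, (halfLine.prod halfLine) (slab k ×ˢ C p) = halfLine (C p) := fun k p => by
    rw [Measure.prod_prod, halfLine_slab, one_mul]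
  have hVm : Measurable V := measurable_pi_lambda _ fun k => measurable_pi_lambda _ fun p =>
    (hM.measurable_count _ (hB k p)).ennreal_toReal
  have hQ : IsExchangeable (P.map V) := by
    refine hM.isExchangeable_count (B := fun k p => slab k ×ˢ C p) hB
      (fun k p => by rw [hΛ]; exact hCfin p) (fun k l p => by rw [hΛ, hΛ]) ?_
    rintro ⟨k, p⟩ ⟨l, q⟩ hne
    rw [Set.disjoint_prod]
    by_cases hkl : k = l
    · right
      refine hd fun hpq => hne ?_
      exact Prod.ext hkl hpq
    · exact Or.inl (disjoint_slab hkl)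
  have hQp := Measure.isProbabilityMeasure_map (μ := P) hVm.aemeasurable
  set b := (∫⁻ z, gridFun c C z ∂(halfLine.prod halfLine)).toReal with hb
  set H : (Fin r → ℝ) × (Fin r → ℝ) → ℝ := fun u => gridKernel c u - b with hHdef
  -- With the kernel centred at `b`, its `U`-statistic is the signed deviation whose size is
  -- `slabDev`.
  have hH : Measurable H := (measurable_gridKernel c).sub_const b
  have hae := ae_count_slab_ne_top hM hC hCfin
  have hdev : ∀ᵐ ω ∂P, ∀ n, 2 ≤ n → slabDev x n (gridFun c C) ω = ‖uStat H n (V ω)‖ₑ := by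
    filter_upwards [hae] with ω hω n hn
    rw [slabDev, toReal_slabMean_gridFun hn c hC hω, hHdef, uStat_sub_const _ _ hn]
  have hint : Integrable (fun v => H (v 0, v 1)) (P.map V) := by
    rw [integrable_map_measure (measurable_kernel hH 0 1).aestronglyMeasurable hVm.aemeasurable]
    refine Integrable.sub ?_ (integrable_const b)
    refine integrable_finsetSum _ fun p _ => integrable_finsetSum _ fun q _ =>
      Integrable.const_mul ?_ _
    have hmul : Measurable fun ω =>
        atomMeasure x ω (slab 0 ×ˢ C p) * atomMeasure x ω (slab 1 ×ˢ C q) :=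
      (hM.measurable_count _ (hB 0 p)).mul (hM.measurable_count _ (hB 1 q))
    have : Integrable (fun ω =>
        (atomMeasure x ω (slab 0 ×ˢ C p) * atomMeasure x ω (slab 1 ×ˢ C q)).toReal) P := by
      refine integrable_toReal_of_lintegral_ne_top hmul.aemeasurable ?_
      rw [hM.lintegral_count_mul (hB 0 p) (by rw [hΛ]; exact hCfin p) (hB 1 q)
        (by rw [hΛ]; exact hCfin q) (disjoint_prod.2 (Or.inl (disjoint_slab zero_ne_one))), hΛ, hΛ]
      exact ENNReal.mul_ne_top (hCfin p) (hCfin q)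
    simpa [ENNReal.toReal_mul] using this
  have hmax := hQ.mul_measureReal_exists_uStat_le hH hint hn₀ N ε.coe_nonneg
  have hset : MeasurableSet {v | ∃ n, n₀ ≤ n ∧ n ≤ N ∧ (ε : ℝ) < |uStat H n v|} := by
    have : {v | ∃ n, n₀ ≤ n ∧ n ≤ N ∧ (ε : ℝ) < |uStat H n v|} =
        ⋃ n ∈ Finset.Icc n₀ N, {v | (ε : ℝ) < |uStat H n v|} := by
      ext v; simp [and_assoc]
    rw [this]
    exact Finset.measurableSet_biUnion _ fun n _ =>
      measurableSet_lt measurable_const (measurable_uStat hH n).abs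
  rw [map_measureReal_apply hVm hset, integral_map hVm.aemeasurable
    (measurable_uStat hH n₀).abs.aestronglyMeasurable] at hmax
  have hmax' := ENNReal.ofReal_le_ofReal hmax
  rw [ENNReal.ofReal_mul ε.coe_nonneg, ENNReal.ofReal_coe_nnreal, ofReal_measureReal] at hmax'
  have hIU : Integrable (fun ω => uStat H n₀ (V ω)) P :=
    (integrable_map_measure (measurable_uStat hH n₀).aestronglyMeasurable hVm.aemeasurable).1
      (hQ.integrable_uStat hH hint n₀)
  calc ε * P {ω | ∃ n, n₀ ≤ n ∧ n ≤ N ∧ ε < slabDev x n (gridFun c C) ω}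
      = ε * P (V ⁻¹' {v | ∃ n, n₀ ≤ n ∧ n ≤ N ∧ (ε : ℝ) < |uStat H n v|}) := by
        congr 1
        refine measure_congr ?_
        filter_upwards [hdev] with ω hω
        refine propext (exists_congr fun n => and_congr_right fun hn => and_congr_right fun _ => ?_)
        rw [hω n (hn₀.trans hn), ← ofReal_norm, Real.norm_eq_abs, ← ENNReal.ofReal_coe_nnreal,
          ENNReal.ofReal_lt_ofReal_iff_of_nonneg ε.coe_nonneg]
    _ ≤ ENNReal.ofReal (∫ ω, |uStat H n₀ (V ω)| ∂P) := hmax'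
    _ = ∫⁻ ω, ‖uStat H n₀ (V ω)‖ₑ ∂P := by
        rw [ofReal_integral_eq_lintegral_ofReal hIU.abs (ae_of_all _ fun _ => abs_nonneg _)]
        exact lintegral_congr fun ω => by rw [← ofReal_norm, Real.norm_eq_abs]
    _ = ∫⁻ ω, slabDev x n₀ (gridFun c C) ω ∂P :=
        lintegral_congr_ae (by filter_upwards [hdev] with ω hω using (hω n₀ hn₀).symm)

end GridCounts

/-! ### Convergence in mean for step functions. -/

section GridLimit

/-- Expand around `(a, b)` and bound the linear terms by `|u| ≤ t / 2 + u² / (2 t)`. Only squared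
deviations remain, whose means are variances; `t` is free for optimisation. -/
theorem abs_mul_sub_mul_le {X Y a b t : ℝ} (ha : 0 ≤ a) (hb : 0 ≤ b) (ht : 0 < t) :
    |X * Y - a * b| ≤ (1 / 2 + b / (2 * t)) * (X - a) ^ 2 + (1 / 2 + a / (2 * t)) * (Y - b) ^ 2 +
      (a + b) * t / 2 := by
  have h1 : |X * Y - a * b| ≤ |X - a| * |Y - b| + b * |X - a| + a * |Y - b| := by
    calc |X * Y - a * b| = |(X - a) * (Y - b) + b * (X - a) + a * (Y - b)| := by congr 1; ring
      _ ≤ |(X - a) * (Y - b)| + |b * (X - a)| + |a * (Y - b)| := abs_add_three _ _ _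
      _ = _ := by rw [abs_mul, abs_mul, abs_mul, abs_of_nonneg ha, abs_of_nonneg hb]
  have h2 : |X - a| * |Y - b| ≤ ((X - a) ^ 2 + (Y - b) ^ 2) / 2 := by
    nlinarith [sq_nonneg (|X - a| - |Y - b|), sq_abs (X - a), sq_abs (Y - b)]
  have h3 : ∀ u : ℝ, |u| ≤ t / 2 + u ^ 2 / (2 * t) := by
    intro u
    have : t / 2 + u ^ 2 / (2 * t) - |u| = (t - |u|) ^ 2 / (2 * t) := by
      rw [← sq_abs u]; field_simp; ring
    have h4 : 0 ≤ (t - |u|) ^ 2 / (2 * t) := by positivity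
    linarith
  have h4 := mul_le_mul_of_nonneg_left (h3 (X - a)) hb
  have h5 := mul_le_mul_of_nonneg_left (h3 (Y - b)) ha
  calc |X * Y - a * b| ≤ ((X - a) ^ 2 + (Y - b) ^ 2) / 2 + b * (t / 2 + (X - a) ^ 2 / (2 * t)) +
        a * (t / 2 + (Y - b) ^ 2 / (2 * t)) := by linarith
    _ = _ := by ring

variable {Ω E : Type*} [MeasurableSpace Ω] [MeasurableSpace E] {P : Measure Ω}
  [IsProbabilityMeasure P] {M : Ω → Measure E} {Λ : Measure E}

theorem IsPoissonRandomMeasure.lintegral_sq_count_sub_le (hM : IsPoissonRandomMeasure M Λ P)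
    {B : Set E} (hB : MeasurableSet B) (hB' : Λ B ≠ ∞) :
    ∫⁻ ω, ENNReal.ofReal (((M ω B).toReal - (Λ B).toReal) ^ 2) ∂P ≤ Λ B :=
  lintegral_ofReal_sq_sub_le (hM.measurable_count B hB) hB' (hM.lintegral_count hB hB')
    (hM.lintegral_count_sq hB hB').le

theorem IsPoissonRandomMeasure.lintegral_abs_mul_sub_le (hM : IsPoissonRandomMeasure M Λ P)
    {A B : Set E} (hA : MeasurableSet A) (hA' : Λ A ≠ ∞) (hB : MeasurableSet B) (hB' : Λ B ≠ ∞)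
    {t : ℝ} (ht : 0 < t) :
    ∫⁻ ω, ENNReal.ofReal |(M ω A).toReal * (M ω B).toReal - (Λ A).toReal * (Λ B).toReal| ∂P ≤
      ENNReal.ofReal (((Λ A).toReal + (Λ B).toReal) / 2 + (Λ A).toReal * (Λ B).toReal / t +
        ((Λ A).toReal + (Λ B).toReal) * t / 2) := by
  set a := (Λ A).toReal with ha
  set b := (Λ B).toReal with hb
  have ha0 : 0 ≤ a := ENNReal.toReal_nonneg
  have hb0 : 0 ≤ b := ENNReal.toReal_nonneg
  have hmA : Measurable fun ω => ENNReal.ofReal (((M ω A).toReal - a) ^ 2) :=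
    (((hM.measurable_count A hA).ennreal_toReal.sub_const a).pow_const 2).ennreal_ofReal
  have hmB : Measurable fun ω => ENNReal.ofReal (((M ω B).toReal - b) ^ 2) :=
    (((hM.measurable_count B hB).ennreal_toReal.sub_const b).pow_const 2).ennreal_ofReal
  have hvA := hM.lintegral_sq_count_sub_le hA hA'
  have hvB := hM.lintegral_sq_count_sub_le hB hB'
  rw [← ha, ← ENNReal.ofReal_toReal hA', ← ha] at hvA
  rw [← hb, ← ENNReal.ofReal_toReal hB', ← hb] at hvB
  have hcA : 0 ≤ 1 / 2 + b / (2 * t) := by positivity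
  have hcB : 0 ≤ 1 / 2 + a / (2 * t) := by positivity
  calc ∫⁻ ω, ENNReal.ofReal |(M ω A).toReal * (M ω B).toReal - a * b| ∂P
      ≤ ∫⁻ ω, (ENNReal.ofReal (1 / 2 + b / (2 * t)) *
            ENNReal.ofReal (((M ω A).toReal - a) ^ 2) +
          ENNReal.ofReal (1 / 2 + a / (2 * t)) * ENNReal.ofReal (((M ω B).toReal - b) ^ 2) +
          ENNReal.ofReal ((a + b) * t / 2)) ∂P := by
        refine lintegral_mono fun ω => ?_
        rw [← ENNReal.ofReal_mul hcA, ← ENNReal.ofReal_mul hcB,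
          ← ENNReal.ofReal_add (by positivity) (by positivity),
          ← ENNReal.ofReal_add (by positivity) (by positivity)]
        exact ENNReal.ofReal_le_ofReal (abs_mul_sub_mul_le ha0 hb0 ht)
    _ = ENNReal.ofReal (1 / 2 + b / (2 * t)) *
            ∫⁻ ω, ENNReal.ofReal (((M ω A).toReal - a) ^ 2) ∂P +
          ENNReal.ofReal (1 / 2 + a / (2 * t)) *
            ∫⁻ ω, ENNReal.ofReal (((M ω B).toReal - b) ^ 2) ∂P +
          ENNReal.ofReal ((a + b) * t / 2) := by
        rw [lintegral_add_right _ measurable_const, lintegral_add_right _ (hmB.const_mul _),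
          lintegral_const_mul _ hmA, lintegral_const_mul _ hmB, lintegral_const, measure_univ,
          mul_one]
    _ ≤ ENNReal.ofReal (1 / 2 + b / (2 * t)) * ENNReal.ofReal a +
          ENNReal.ofReal (1 / 2 + a / (2 * t)) * ENNReal.ofReal b +
          ENNReal.ofReal ((a + b) * t / 2) := by gcongr
    _ = _ := by
        rw [← ENNReal.ofReal_mul hcA, ← ENNReal.ofReal_mul hcB,
          ← ENNReal.ofReal_add (by positivity) (by positivity),
          ← ENNReal.ofReal_add (by positivity) (by positivity)]
        congr 1
        field_simp
        ring

end GridLimit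

section GridLimit

variable {Ω : Type*} [MeasurableSpace Ω] {P : Measure Ω}
  {x : ℕ → Ω → ℝ × ℝ} {r : ℕ}

theorem halfLine_prod_Ioc (n : ℕ) (A : Set ℝ) :
    (halfLine.prod halfLine) (Ioc (0 : ℝ) n ×ˢ A) = n * halfLine A := by
  rw [Measure.prod_prod, Measure.restrict_apply measurableSet_Ioc,
    inter_eq_left.2 Ioc_subset_Ioi_self, Real.volume_Ioc, sub_zero, ENNReal.ofReal_natCast]

theorem ae_count_Ioc_ne_top
    (hM : IsPoissonRandomMeasure (atomMeasure x) (halfLine.prod halfLine) P) {A : Set ℝ}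
    (hA : MeasurableSet A) (hA' : halfLine A ≠ ∞) (n : ℕ) :
    ∀ᵐ ω ∂P, atomMeasure x ω (Ioc (0 : ℝ) n ×ˢ A) ≠ ∞ := by
  have hB := (measurableSet_Ioc (a := (0 : ℝ)) (b := n)).prod hA
  have hfin : (halfLine.prod halfLine) (Ioc (0 : ℝ) n ×ˢ A) ≠ ∞ := by
    rw [halfLine_prod_Ioc]; exact ENNReal.mul_ne_top (ENNReal.natCast_ne_top n) hA'
  filter_upwards [ae_lt_top (hM.measurable_count _ hB) (by rwa [hM.lintegral_count hB hfin])]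
    with ω hω using hω.ne

theorem measurable_gridTotal
    (hM : IsPoissonRandomMeasure (atomMeasure x) (halfLine.prod halfLine) P) (n : ℕ)
    (c : Fin r → Fin r → ℝ≥0) {C : Fin r → Set ℝ} (hC : ∀ p, MeasurableSet (C p)) :
    Measurable (gridTotal x n c C) :=
  Finset.measurable_fun_sum _ fun p _ => Finset.measurable_fun_sum _ fun q _ =>
    ((hM.measurable_count _ (measurableSet_Ioc.prod (hC p))).mul
      (hM.measurable_count _ (measurableSet_Ioc.prod (hC q)))).const_mul _

variable [IsProbabilityMeasure P]

/-- Products of counts up to time `n`, normalised by the number of ordered pairs of slabs,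
converge in mean. -/
theorem tendsto_lintegral_count_mul
    (hM : IsPoissonRandomMeasure (atomMeasure x) (halfLine.prod halfLine) P) {A B : Set ℝ}
    (hA : MeasurableSet A) (hA' : halfLine A ≠ ∞) (hB : MeasurableSet B) (hB' : halfLine B ≠ ∞) :
    Tendsto (fun n : ℕ => ∫⁻ ω, ENNReal.ofReal |(atomMeasure x ω (Ioc (0 : ℝ) n ×ˢ A)).toReal *
      (atomMeasure x ω (Ioc (0 : ℝ) n ×ˢ B)).toReal / (n * (n - 1)) -
        (halfLine A).toReal * (halfLine B).toReal| ∂P) atTop (𝓝 0) := by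
  set a := (halfLine A).toReal with ha
  set b := (halfLine B).toReal with hb
  have ha0 : 0 ≤ a := ENNReal.toReal_nonneg
  have hb0 : 0 ≤ b := ENNReal.toReal_nonneg
  have hbound : ∀ n : ℕ, 2 ≤ n →
      ∫⁻ ω, ENNReal.ofReal |(atomMeasure x ω (Ioc (0 : ℝ) n ×ˢ A)).toReal *
        (atomMeasure x ω (Ioc (0 : ℝ) n ×ˢ B)).toReal / (n * (n - 1)) - a * b| ∂P ≤
      ENNReal.ofReal (2 * (a + b + a * b) * (1 / √n) + 2 * (a * b) * (1 / n)) := by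
    intro n hn
    have h2 : (2 : ℝ) ≤ n := by exact_mod_cast hn
    have hn0 : (0 : ℝ) < n := by linarith
    set D : ℝ := n * (n - 1) with hD
    have hD0 : 0 < D := mul_pos hn0 (by linarith)
    have hs0 : 0 < √(n : ℝ) := Real.sqrt_pos.2 hn0
    have hs1 : 1 ≤ √(n : ℝ) := Real.one_le_sqrt.2 (by linarith)
    have hss : √(n : ℝ) * √n = n := Real.mul_self_sqrt hn0.le
    have hfin : ∀ {S : Set ℝ}, halfLine S ≠ ∞ →
        (halfLine.prod halfLine) (Ioc (0 : ℝ) n ×ˢ S) ≠ ∞ := fun h => by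
      rw [halfLine_prod_Ioc]; exact ENNReal.mul_ne_top (ENNReal.natCast_ne_top n) h
    -- Means and variances are of order `n`, so `t = √n` balances `n² / t` with `n * t`. The error
    -- is of order `n * √n`, which is small against `n (n - 1)`.
    have hmain := hM.lintegral_abs_mul_sub_le (measurableSet_Ioc.prod hA) (hfin hA')
      (measurableSet_Ioc.prod hB) (hfin hB') hs0
    simp only [halfLine_prod_Ioc, ENNReal.toReal_mul, ENNReal.toReal_natCast] at hmain
    rw [← ha, ← hb] at hmain
    set X : Ω → ℝ := fun ω => (atomMeasure x ω (Ioc (0 : ℝ) n ×ˢ A)).toReal with hX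
    set Y : Ω → ℝ := fun ω => (atomMeasure x ω (Ioc (0 : ℝ) n ×ˢ B)).toReal with hY
    have hmeas : Measurable fun ω => ENNReal.ofReal |X ω * Y ω - n * a * (n * b)| := by
      have h1 : Measurable X :=
        (hM.measurable_count _ (measurableSet_Ioc.prod hA)).ennreal_toReal
      have h2 : Measurable Y :=
        (hM.measurable_count _ (measurableSet_Ioc.prod hB)).ennreal_toReal
      exact (((h1.mul h2).sub_const _).abs).ennreal_ofReal
    have hpt : ∀ ω, |X ω * Y ω / D - a * b| ≤
        (1 / D) * |X ω * Y ω - n * a * (n * b)| + a * b * (2 / n) := by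
      intro ω
      -- The product of the means is `n² a b` while `D` is `n (n - 1)`; the mismatch leaves the
      -- correction `a * b / (n - 1)`.
      have e : X ω * Y ω / D - a * b =
          (1 / D) * (X ω * Y ω - n * a * (n * b)) + a * b * (1 / (n - 1)) := by
        have : (n : ℝ) - 1 ≠ 0 := by linarith
        rw [hD]; field_simp; ring
      rw [e]
      refine (abs_add_le _ _).trans ?_
      rw [abs_mul, abs_of_pos (by positivity : 0 < 1 / D)]
      have h3 : 1 / ((n : ℝ) - 1) ≤ 2 / n := by
        rw [div_le_div_iff₀ (by linarith) hn0]; linarith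
      have h4 : 0 ≤ a * b * (1 / ((n : ℝ) - 1)) :=
        mul_nonneg (mul_nonneg ha0 hb0) (div_nonneg zero_le_one (by linarith))
      rw [abs_of_nonneg h4]
      have := mul_le_mul_of_nonneg_left h3 (mul_nonneg ha0 hb0)
      linarith
    calc ∫⁻ ω, ENNReal.ofReal |X ω * Y ω / D - a * b| ∂P
        ≤ ∫⁻ ω, (ENNReal.ofReal (1 / D) * ENNReal.ofReal |X ω * Y ω - n * a * (n * b)| +
            ENNReal.ofReal (a * b * (2 / n))) ∂P := by
          refine lintegral_mono fun ω => ?_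
          rw [← ENNReal.ofReal_mul (by positivity),
            ← ENNReal.ofReal_add (by positivity) (by positivity)]
          exact ENNReal.ofReal_le_ofReal (hpt ω)
      _ = ENNReal.ofReal (1 / D) * ∫⁻ ω, ENNReal.ofReal |X ω * Y ω - n * a * (n * b)| ∂P +
            ENNReal.ofReal (a * b * (2 / n)) := by
          rw [lintegral_add_right _ measurable_const, lintegral_const_mul _ hmeas,
            lintegral_const, measure_univ, mul_one]
      _ ≤ ENNReal.ofReal (1 / D) * ENNReal.ofReal ((n * a + n * b) / 2 + n * a * (n * b) / √n +
            (n * a + n * b) * √n / 2) + ENNReal.ofReal (a * b * (2 / n)) := by gcongr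
      _ ≤ _ := by
          rw [← ENNReal.ofReal_mul (by positivity),
            ← ENNReal.ofReal_add (by positivity) (by positivity)]
          refine ENNReal.ofReal_le_ofReal ?_
          have h5 : (n * a + n * b) / 2 + n * a * (n * b) / √n + (n * a + n * b) * √n / 2 ≤
              n * √n * (a + b + a * b) := by
            have e1 : n * a * (n * b) / √n = n * √n * (a * b) := by
              rw [div_eq_iff hs0.ne']
              calc n * a * (n * b) = n * (a * b) * n := by ring
                _ = n * (a * b) * (√n * √n) := by rw [hss]
                _ = _ := by ring
            rw [e1]
            have : 0 ≤ n * (a + b) * (√n - 1) :=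
              mul_nonneg (mul_nonneg hn0.le (by linarith)) (by linarith)
            nlinarith
          have h6 : 1 / D * (n * √n * (a + b + a * b)) ≤ 2 * (a + b + a * b) * (1 / √n) := by
            have e2 : 1 / D * (n * √n * (a + b + a * b)) =
                (√n / (n - 1)) * (a + b + a * b) := by
              have : (n : ℝ) - 1 ≠ 0 := by linarith
              rw [hD]; field_simp
            have h7 : √(n : ℝ) / (n - 1) ≤ 2 * (1 / √n) := by
              rw [mul_one_div, div_le_div_iff₀ (by linarith) hs0, hss]; linarith
            rw [e2]
            have := mul_le_mul_of_nonneg_right h7 (by positivity : 0 ≤ a + b + a * b)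
            linarith
          have h8 := mul_le_mul_of_nonneg_left h5 (by positivity : 0 ≤ 1 / D)
          have h9 : a * b * (2 / n) = 2 * (a * b) * (1 / n) := by ring
          linarith
  have hlim : Tendsto (fun n : ℕ => ENNReal.ofReal
      (2 * (a + b + a * b) * (1 / √n) + 2 * (a * b) * (1 / n))) atTop (𝓝 0) := by
    rw [← ENNReal.ofReal_zero]
    refine ENNReal.tendsto_ofReal ?_
    have h1 : Tendsto (fun n : ℕ => 1 / √(n : ℝ)) atTop (𝓝 0) := by
      simp_rw [one_div]
      exact tendsto_inv_atTop_zero.comp (Real.tendsto_sqrt_atTop.comp tendsto_natCast_atTop_atTop)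
    have h2 : Tendsto (fun n : ℕ => 1 / (n : ℝ)) atTop (𝓝 0) := tendsto_one_div_atTop_nhds_zero_nat
    simpa using (h1.const_mul (2 * (a + b + a * b))).add (h2.const_mul (2 * (a * b)))
  refine tendsto_of_tendsto_of_tendsto_of_le_of_le' tendsto_const_nhds hlim
    (Eventually.of_forall fun _ => zero_le) ?_
  filter_upwards [eventually_ge_atTop 2] with n hn using hbound n hn

theorem tendsto_lintegral_gridTotal
    (hM : IsPoissonRandomMeasure (atomMeasure x) (halfLine.prod halfLine) P)
    (c : Fin r → Fin r → ℝ≥0) {C : Fin r → Set ℝ} (hC : ∀ p, MeasurableSet (C p))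
    (hCfin : ∀ p, halfLine (C p) ≠ ∞) :
    Tendsto (fun n : ℕ => ∫⁻ ω, ‖(gridTotal x n c C ω / ((n * (n - 1) : ℕ) : ℝ≥0∞)).toReal -
      (∫⁻ z, gridFun c C z ∂(halfLine.prod halfLine)).toReal‖ₑ ∂P) atTop (𝓝 0) := by
  have hsum : Tendsto (fun n : ℕ => ∑ p, ∑ q, (c p q : ℝ≥0∞) *
      ∫⁻ ω, ENNReal.ofReal |(atomMeasure x ω (Ioc (0 : ℝ) n ×ˢ C p)).toReal *
        (atomMeasure x ω (Ioc (0 : ℝ) n ×ˢ C q)).toReal / (n * (n - 1)) -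
        (halfLine (C p)).toReal * (halfLine (C q)).toReal| ∂P) atTop (𝓝 0) := by
    have := tendsto_finsetSum Finset.univ fun p _ => tendsto_finsetSum Finset.univ fun q _ =>
      ENNReal.Tendsto.const_mul (a := (c p q : ℝ≥0∞))
        (tendsto_lintegral_count_mul hM (hC p) (hCfin p) (hC q) (hCfin q))
        (Or.inr ENNReal.coe_ne_top)
    simpa using this
  refine tendsto_of_tendsto_of_tendsto_of_le_of_le' tendsto_const_nhds hsum
    (Eventually.of_forall fun _ => zero_le) ?_
  filter_upwards [eventually_ge_atTop 2] with n hn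
  have hm : ∀ p, Measurable fun ω => (atomMeasure x ω (Ioc (0 : ℝ) n ×ˢ C p)).toReal := fun p =>
    (hM.measurable_count _ (measurableSet_Ioc.prod (hC p))).ennreal_toReal
  have hm2 : ∀ p q, Measurable fun ω =>
      ENNReal.ofReal |(atomMeasure x ω (Ioc (0 : ℝ) n ×ˢ C p)).toReal *
        (atomMeasure x ω (Ioc (0 : ℝ) n ×ˢ C q)).toReal / (n * (n - 1)) -
        (halfLine (C p)).toReal * (halfLine (C q)).toReal| := fun p q =>
    (((((hm p).mul (hm q)).div_const _).sub_const _).abs).ennreal_ofReal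
  have hae : ∀ᵐ ω ∂P, ∀ p, atomMeasure x ω (Ioc (0 : ℝ) n ×ˢ C p) ≠ ∞ :=
    ae_all_iff.2 fun p => ae_count_Ioc_ne_top hM (hC p) (hCfin p) n
  calc _ ≤ ∫⁻ ω, ∑ p, ∑ q, (c p q : ℝ≥0∞) *
        ENNReal.ofReal |(atomMeasure x ω (Ioc (0 : ℝ) n ×ˢ C p)).toReal *
        (atomMeasure x ω (Ioc (0 : ℝ) n ×ˢ C q)).toReal / (n * (n - 1)) -
        (halfLine (C p)).toReal * (halfLine (C q)).toReal| ∂P := by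
        refine lintegral_mono_ae ?_
        filter_upwards [hae] with ω hω
        have hf1 : ∀ p q, (c p q : ℝ≥0∞) * (atomMeasure x ω (Ioc (0 : ℝ) n ×ˢ C p) *
            atomMeasure x ω (Ioc (0 : ℝ) n ×ˢ C q)) ≠ ∞ := fun p q =>
          ENNReal.mul_ne_top ENNReal.coe_ne_top (ENNReal.mul_ne_top (hω p) (hω q))
        have hf2 : ∀ p q, (c p q : ℝ≥0∞) * (halfLine (C p) * halfLine (C q)) ≠ ∞ := fun p q =>
          ENNReal.mul_ne_top ENNReal.coe_ne_top (ENNReal.mul_ne_top (hCfin p) (hCfin q))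
        have e : (gridTotal x n c C ω / ((n * (n - 1) : ℕ) : ℝ≥0∞)).toReal -
            (∫⁻ z, gridFun c C z ∂(halfLine.prod halfLine)).toReal =
            ∑ p, ∑ q, (c p q : ℝ) * ((atomMeasure x ω (Ioc (0 : ℝ) n ×ˢ C p)).toReal *
        (atomMeasure x ω (Ioc (0 : ℝ) n ×ˢ C q)).toReal / (n * (n - 1)) -
        (halfLine (C p)).toReal * (halfLine (C q)).toReal) := by
          rw [lintegral_gridFun c hC, gridTotal, ENNReal.toReal_div, ENNReal.toReal_natCast,
            Nat.cast_mul, Nat.cast_sub (by omega), Nat.cast_one,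
            ENNReal.toReal_sum fun p _ => ENNReal.sum_ne_top.2 fun q _ => hf1 p q,
            ENNReal.toReal_sum fun p _ => ENNReal.sum_ne_top.2 fun q _ => hf2 p q,
            Finset.sum_div, ← Finset.sum_sub_distrib]
          refine Finset.sum_congr rfl fun p _ => ?_
          rw [ENNReal.toReal_sum fun q _ => hf1 p q, ENNReal.toReal_sum fun q _ => hf2 p q,
            Finset.sum_div, ← Finset.sum_sub_distrib]
          refine Finset.sum_congr rfl fun q _ => ?_
          simp only [ENNReal.toReal_mul, ENNReal.coe_toReal]
          ring
        rw [e]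
        refine (enorm_sum_le _ _).trans (Finset.sum_le_sum fun p _ => ?_)
        refine (enorm_sum_le _ _).trans (Finset.sum_le_sum fun q _ => ?_)
        rw [enorm_mul, ← ofReal_norm, ← ofReal_norm, Real.norm_eq_abs, Real.norm_eq_abs,
          abs_of_nonneg (c p q).coe_nonneg, ENNReal.ofReal_coe_nnreal]
    _ = _ := by
        rw [lintegral_finsetSum _ fun p _ => Finset.measurable_fun_sum _ fun q _ =>
          (hm2 p q).const_mul _]
        refine Finset.sum_congr rfl fun p _ => ?_
        rw [lintegral_finsetSum _ fun q _ => (hm2 p q).const_mul _]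
        exact Finset.sum_congr rfl fun q _ => lintegral_const_mul _ (hm2 p q)

/-- If `A ≤ G` almost surely and `A` has mean `b`, then the mean distance of `A` from `b` is at
most twice that of `G`. -/
theorem lintegral_enorm_sub_le_two_mul {A G : Ω → ℝ≥0∞} {b : ℝ≥0∞} (hA : Measurable A)
    (hG : Measurable G) (hb : b ≠ ∞) (hAG : ∀ ω, A ω ≤ G ω) (hGfin : ∀ᵐ ω ∂P, G ω ≠ ∞)
    (hAb : ∫⁻ ω, A ω ∂P = b) :
    ∫⁻ ω, ‖(A ω).toReal - b.toReal‖ₑ ∂P ≤ 2 * ∫⁻ ω, ‖(G ω).toReal - b.toReal‖ₑ ∂P := by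
  have hmG : Measurable fun ω => ‖(G ω).toReal - b.toReal‖ₑ :=
    (hG.ennreal_toReal.sub_const _).enorm
  have hle : ∀ᵐ ω ∂P, G ω ≤ b + ‖(G ω).toReal - b.toReal‖ₑ := by
    filter_upwards [hGfin] with ω hω
    calc G ω = ENNReal.ofReal ((G ω).toReal) := (ENNReal.ofReal_toReal hω).symm
      _ ≤ ENNReal.ofReal (b.toReal + ‖(G ω).toReal - b.toReal‖) :=
          ENNReal.ofReal_le_ofReal (by
            have := le_abs_self ((G ω).toReal - b.toReal)
            rw [Real.norm_eq_abs]; linarith)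
      _ = _ := by
          rw [ENNReal.ofReal_add ENNReal.toReal_nonneg (norm_nonneg _), ENNReal.ofReal_toReal hb,
            ofReal_norm]
  -- As `A ≤ G` and `A` has mean `b`, the left side is the mean of `G` minus `b`.
  have h1 : ∫⁻ ω, (G ω - A ω) ∂P ≤ ∫⁻ ω, ‖(G ω).toReal - b.toReal‖ₑ ∂P := by
    refine (ENNReal.add_le_add_iff_left hb).1 ?_
    calc b + ∫⁻ ω, (G ω - A ω) ∂P = ∫⁻ ω, (A ω + (G ω - A ω)) ∂P := by
          rw [lintegral_add_left hA, hAb]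
      _ = ∫⁻ ω, G ω ∂P := lintegral_congr fun ω => add_tsub_cancel_of_le (hAG ω)
      _ ≤ ∫⁻ ω, (b + ‖(G ω).toReal - b.toReal‖ₑ) ∂P := lintegral_mono_ae hle
      _ = _ := by rw [lintegral_add_left measurable_const, lintegral_const, measure_univ, mul_one]
  calc ∫⁻ ω, ‖(A ω).toReal - b.toReal‖ₑ ∂P
      ≤ ∫⁻ ω, ((G ω - A ω) + ‖(G ω).toReal - b.toReal‖ₑ) ∂P := by
        refine lintegral_mono_ae ?_
        filter_upwards [hGfin] with ω hω
        have hAω : A ω ≠ ∞ := ((hAG ω).trans_lt hω.lt_top).ne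
        calc ‖(A ω).toReal - b.toReal‖ₑ
            = ‖((A ω).toReal - (G ω).toReal) + ((G ω).toReal - b.toReal)‖ₑ := by congr 1; ring
          _ ≤ ‖(A ω).toReal - (G ω).toReal‖ₑ + ‖(G ω).toReal - b.toReal‖ₑ := enorm_add_le _ _
          _ ≤ _ := by
              gcongr
              refine enorm_toReal_sub_le hAω hω ((hAG ω).trans le_self_add) ?_
              rw [add_tsub_cancel_of_le (hAG ω)]
    _ = ∫⁻ ω, (G ω - A ω) ∂P + ∫⁻ ω, ‖(G ω).toReal - b.toReal‖ₑ ∂P :=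
        lintegral_add_right _ hmG
    _ ≤ _ := by rw [two_mul]; gcongr

/-- Slab means of step functions converge in mean. -/
theorem tendsto_lintegral_slabDev_gridFun (hx : ∀ i, Measurable (x i))
    (hM : IsPoissonRandomMeasure (atomMeasure x) (halfLine.prod halfLine) P)
    (c : Fin r → Fin r → ℝ≥0) {C : Fin r → Set ℝ} (hC : ∀ p, MeasurableSet (C p))
    (hCfin : ∀ p, halfLine (C p) ≠ ∞) :
    Tendsto (fun n : ℕ => ∫⁻ ω, slabDev x n (gridFun c C) ω ∂P) atTop (𝓝 0) := by
  have h := ENNReal.Tendsto.const_mul (a := 2) (tendsto_lintegral_gridTotal hM c hC hCfin)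
    (Or.inr (by simp))
  rw [mul_zero] at h
  refine tendsto_of_tendsto_of_tendsto_of_le_of_le' tendsto_const_nhds h
    (Eventually.of_forall fun _ => zero_le) ?_
  filter_upwards [eventually_ge_atTop 2] with n hn
  have h0 : ((n * (n - 1) : ℕ) : ℝ≥0∞) ≠ 0 := by
    rw [Nat.cast_ne_zero]
    exact Nat.mul_ne_zero (by omega) (by omega)
  have hfin : ∫⁻ z, gridFun c C z ∂(halfLine.prod halfLine) ≠ ∞ := by
    rw [lintegral_gridFun c hC]
    exact ENNReal.sum_ne_top.2 fun p _ => ENNReal.sum_ne_top.2 fun q _ =>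
      ENNReal.mul_ne_top ENNReal.coe_ne_top (ENNReal.mul_ne_top (hCfin p) (hCfin q))
  have hae : ∀ᵐ ω ∂P, ∀ p, atomMeasure x ω (Ioc (0 : ℝ) n ×ˢ C p) ≠ ∞ :=
    ae_all_iff.2 fun p => ae_count_Ioc_ne_top hM (hC p) (hCfin p) n
  -- The slab mean has exactly the limit as its mean, and it lies below the normalised `gridTotal`,
  -- which converges in mean to the same limit.
  refine lintegral_enorm_sub_le_two_mul (measurable_slabMean hx n (measurable_gridFun c hC))
    ((measurable_gridTotal hM n c hC).div_const _) hfin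
    (fun ω => ENNReal.div_le_div_right (pairSum_slabKernel_gridFun_le n c hC ω) _) ?_
    (lintegral_slabMean hx hM hn (measurable_gridFun c hC))
  filter_upwards [hae] with ω hω
  refine ENNReal.div_ne_top ?_ h0
  exact ENNReal.sum_ne_top.2 fun p _ => ENNReal.sum_ne_top.2 fun q _ =>
    ENNReal.mul_ne_top ENNReal.coe_ne_top (ENNReal.mul_ne_top (hω p) (hω q))

end GridLimit

/-! ### Strong law for slab means of integrable functions. -/

section SlabLimit

variable {Ω : Type*} [MeasurableSpace Ω] {P : Measure Ω} [IsProbabilityMeasure P]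
  {x : ℕ → Ω → ℝ × ℝ} {f : ℝ × ℝ → ℝ}

theorem gridFun_ne_top {r : ℕ} (c : Fin r → Fin r → ℝ≥0) (C : Fin r → Set ℝ) (z : ℝ × ℝ) :
    gridFun c C z ≠ ∞ := by
  refine ENNReal.sum_ne_top.2 fun p _ => ENNReal.sum_ne_top.2 fun q _ =>
    ENNReal.mul_ne_top ENNReal.coe_ne_top ?_
  by_cases h1 : z.1 ∈ C p <;> by_cases h2 : z.2 ∈ C q <;> simp [h1, h2]

theorem exists_gridFun_near (hf0 : ∀ z, 0 ≤ f z) (hfm : Measurable f) (hf : Integrable f)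
    {κ : ℝ≥0∞} (hκ : κ ≠ 0) :
    ∃ (r : ℕ) (c : Fin r → Fin r → ℝ≥0) (C : Fin r → Set ℝ) (d : ℝ × ℝ → ℝ≥0∞),
      (∀ p, MeasurableSet (C p)) ∧ (Pairwise fun p q => Disjoint (C p) (C q)) ∧
      (∀ p, halfLine (C p) ≠ ∞) ∧ Measurable d ∧
      (∀ z, ENNReal.ofReal (f z) ≤ gridFun c C z + d z) ∧
      (∀ z, gridFun c C z ≤ ENNReal.ofReal (f z) + d z) ∧
      ∫⁻ z, d z ∂(halfLine.prod halfLine) ≤ κ := by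
  obtain ⟨r, c, C, h1, h2, h3, h4⟩ := exists_gridFun_approx hf0 hf hκ
  refine ⟨r, c, C, fun z => ‖f z - (gridFun c C z).toReal‖ₑ, h1, h2,
    fun p => ((Measure.restrict_apply_le _ _).trans_lt (h3 p).lt_top).ne,
    (hfm.sub (measurable_gridFun c h1).ennreal_toReal).enorm, fun z => ?_, fun z => ?_, ?_⟩
  · have hg := (ENNReal.ofReal_toReal (gridFun_ne_top c C z)).symm
    have := le_abs_self (f z - (gridFun c C z).toReal)
    calc ENNReal.ofReal (f z)
        ≤ ENNReal.ofReal ((gridFun c C z).toReal + ‖f z - (gridFun c C z).toReal‖) :=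
          ENNReal.ofReal_le_ofReal (by rw [Real.norm_eq_abs]; linarith)
      _ = _ := by
          rw [ENNReal.ofReal_add ENNReal.toReal_nonneg (norm_nonneg _), ← hg, ofReal_norm]
  · have := neg_abs_le (f z - (gridFun c C z).toReal)
    calc gridFun c C z = ENNReal.ofReal (gridFun c C z).toReal :=
          (ENNReal.ofReal_toReal (gridFun_ne_top c C z)).symm
      _ ≤ ENNReal.ofReal (f z + ‖f z - (gridFun c C z).toReal‖) :=
          ENNReal.ofReal_le_ofReal (by rw [Real.norm_eq_abs]; linarith)
      _ = _ := by rw [ENNReal.ofReal_add (hf0 z) (norm_nonneg _), ofReal_norm]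
  · rw [halfLine_prod]
    exact (setLIntegral_le_lintegral _ _).trans h4

/-- The error `2 * ∫ d` is uniform in `n`, because the slab mean of `d` has mean `∫ d` for each `n ≥
2`; this makes the density argument work. -/
theorem lintegral_slabDev_le (hx : ∀ i, Measurable (x i))
    (hM : IsPoissonRandomMeasure (atomMeasure x) (halfLine.prod halfLine) P)
    {u v d : ℝ × ℝ → ℝ≥0∞} (hu : Measurable u) (hv : Measurable v) (hd : Measurable d)
    (hufin : ∫⁻ z, u z ∂(halfLine.prod halfLine) ≠ ∞)
    (hvfin : ∫⁻ z, v z ∂(halfLine.prod halfLine) ≠ ∞) (huv : ∀ z, u z ≤ v z + d z)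
    (hvu : ∀ z, v z ≤ u z + d z) {n : ℕ} (hn : 2 ≤ n) :
    ∫⁻ ω, slabDev x n u ω ∂P ≤
      ∫⁻ ω, slabDev x n v ω ∂P + 2 * ∫⁻ z, d z ∂(halfLine.prod halfLine) := by
  calc ∫⁻ ω, slabDev x n u ω ∂P
      ≤ ∫⁻ ω, (slabDev x n v ω + slabMean x n d ω + ∫⁻ z, d z ∂(halfLine.prod halfLine)) ∂P := by
        refine lintegral_mono_ae ?_
        filter_upwards [ae_slabDev_le hx hM hu hv hufin hvfin huv hvu] with ω hω using hω n hn
    _ = _ := by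
        rw [lintegral_add_right _ measurable_const, lintegral_add_right _
          (measurable_slabMean hx n hd), lintegral_slabMean hx hM hn hd, lintegral_const,
          measure_univ, mul_one, two_mul, add_assoc]

theorem lintegral_ofReal_ne_top_of_integrable (hf : Integrable f) :
    ∫⁻ z, ENNReal.ofReal (f z) ∂(halfLine.prod halfLine) ≠ ∞ := by
  rw [halfLine_prod]
  exact ((setLIntegral_le_lintegral _ _).trans_lt hf.lintegral_lt_top).ne

theorem lintegral_gridFun_ne_top {r : ℕ} (c : Fin r → Fin r → ℝ≥0) {C : Fin r → Set ℝ}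
    (hC : ∀ p, MeasurableSet (C p)) (hCfin : ∀ p, halfLine (C p) ≠ ∞) :
    ∫⁻ z, gridFun c C z ∂(halfLine.prod halfLine) ≠ ∞ := by
  rw [lintegral_gridFun c hC]
  exact ENNReal.sum_ne_top.2 fun p _ => ENNReal.sum_ne_top.2 fun q _ =>
    ENNReal.mul_ne_top ENNReal.coe_ne_top (ENNReal.mul_ne_top (hCfin p) (hCfin q))

/-- Slab means of integrable functions converge in mean. -/
theorem tendsto_lintegral_slabDev (hx : ∀ i, Measurable (x i))
    (hM : IsPoissonRandomMeasure (atomMeasure x) (halfLine.prod halfLine) P)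
    (hf0 : ∀ z, 0 ≤ f z) (hfm : Measurable f) (hf : Integrable f) :
    Tendsto (fun n : ℕ => ∫⁻ ω, slabDev x n (fun z => ENNReal.ofReal (f z)) ω ∂P) atTop
      (𝓝 0) := by
  rw [ENNReal.tendsto_atTop_zero]
  intro ε hε
  have hε4 : ε / 2 / 2 ≠ 0 := (ENNReal.half_pos (ENNReal.half_pos hε.ne').ne').ne'
  obtain ⟨r, c, C, d, hC, -, hCfin, hd, h1, h2, h3⟩ := exists_gridFun_near hf0 hfm hf hε4
  have hlim := tendsto_lintegral_slabDev_gridFun hx hM c hC hCfin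
  rw [ENNReal.tendsto_atTop_zero] at hlim
  obtain ⟨N, hN⟩ := hlim (ε / 2) (ENNReal.half_pos hε.ne')
  refine ⟨max N 2, fun n hn => ?_⟩
  calc ∫⁻ ω, slabDev x n (fun z => ENNReal.ofReal (f z)) ω ∂P
      ≤ ∫⁻ ω, slabDev x n (gridFun c C) ω ∂P + 2 * ∫⁻ z, d z ∂(halfLine.prod halfLine) :=
        lintegral_slabDev_le hx hM hfm.ennreal_ofReal (measurable_gridFun c hC) hd
          (lintegral_ofReal_ne_top_of_integrable hf) (lintegral_gridFun_ne_top c hC hCfin) h1 h2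
          ((le_max_right _ _).trans hn)
    _ ≤ ε / 2 + 2 * (ε / 2 / 2) := by gcongr; exact hN n ((le_max_left _ _).trans hn)
    _ = ε := by rw [two_mul, ENNReal.add_halves, ENNReal.add_halves]

/-- With `N` fixed first, the step function may be chosen so close to `f` that Markov's inequality,
summed over the finitely many times up to `N`, makes the approximation error as small as desired.
The loss from `ε` to `2 * ε` leaves room for that error. -/
theorem mul_measure_exists_slabDev_le_of_le (hx : ∀ i, Measurable (x i))
    (hM : IsPoissonRandomMeasure (atomMeasure x) (halfLine.prod halfLine) P)
    (hf0 : ∀ z, 0 ≤ f z) (hfm : Measurable f) (hf : Integrable f) {n₀ : ℕ} (hn₀ : 2 ≤ n₀)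
    (N : ℕ) {ε : ℝ≥0} (hε : ε ≠ 0) :
    ε * P {ω | ∃ n, n₀ ≤ n ∧ n ≤ N ∧
        2 * ε < slabDev x n (fun z => ENNReal.ofReal (f z)) ω} ≤
      ∫⁻ ω, slabDev x n₀ (fun z => ENNReal.ofReal (f z)) ω ∂P := by
  refine ENNReal.le_of_forall_pos_le_add fun δ hδ _ => ?_
  -- The total cost is `K * κ`: `2 * κ` for returning from the step function to `f` at `n₀`, and `2
  -- * κ` for Markov's inequality at each time. The bound `κ ≤ ε / 2` absorbs `∫ d`.
  set K : ℝ≥0 := 2 + 2 * (Finset.Icc n₀ N).card with hK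
  have hK0 : 0 < K := by positivity
  set κ : ℝ≥0 := min (ε / 2) (δ / K) with hκdef
  have hκ0 : 0 < κ := lt_min (by positivity) (by positivity)
  have hκε : (κ : ℝ≥0∞) ≤ ε / 2 := by
    have : (κ : ℝ≥0∞) ≤ ((ε / 2 : ℝ≥0) : ℝ≥0∞) := by exact_mod_cast min_le_left _ _
    simpa using this
  have hκδ : (K : ℝ≥0∞) * κ ≤ δ := by
    have : K * κ ≤ δ := by
      calc K * κ ≤ K * (δ / K) := by gcongr; exact min_le_right _ _
        _ = δ := mul_div_cancel₀ _ hK0.ne'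
    exact_mod_cast this
  obtain ⟨r, c, C, d, hC, hdisj, hCfin, hd, h1, h2, h3⟩ := exists_gridFun_near hf0 hfm hf
    (κ := κ) (by exact_mod_cast hκ0.ne')
  set F : ℝ × ℝ → ℝ≥0∞ := fun z => ENNReal.ofReal (f z) with hF
  have hFfin := lintegral_ofReal_ne_top_of_integrable hf
  have hhfin := lintegral_gridFun_ne_top c hC hCfin
  have hsub : {ω | ∃ n, n₀ ≤ n ∧ n ≤ N ∧ 2 * ε < slabDev x n F ω} ≤ᵐ[P]
      ({ω | ∃ n, n₀ ≤ n ∧ n ≤ N ∧ ε < slabDev x n (gridFun c C) ω} ∪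
        ⋃ n ∈ Finset.Icc n₀ N, {ω | (ε / 2 : ℝ≥0∞) ≤ slabMean x n d ω} : Set Ω) := by
    filter_upwards [ae_slabDev_le hx hM hfm.ennreal_ofReal (measurable_gridFun c hC) hFfin hhfin
      h1 h2] with ω hω
    rintro ⟨n, hn1, hn2, hn3⟩
    by_contra hcon
    have hA : slabDev x n (gridFun c C) ω ≤ ε := by
      by_contra hlt
      exact hcon (Or.inl ⟨n, hn1, hn2, not_le.1 hlt⟩)
    have hB : slabMean x n d ω ≤ ε / 2 := by
      by_contra hlt
      exact hcon (Or.inr (mem_iUnion₂.2 ⟨n, Finset.mem_Icc.2 ⟨hn1, hn2⟩, (not_le.1 hlt).le⟩))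
    refine absurd hn3 (not_lt.2 ?_)
    calc slabDev x n F ω ≤ ε + ε / 2 + ε / 2 :=
          (hω n (hn₀.trans hn1)).trans (add_le_add (add_le_add hA hB) (h3.trans hκε))
      _ = 2 * ε := by rw [add_assoc, ENNReal.add_halves, two_mul]
  have hmark : ∀ n ∈ Finset.Icc n₀ N,
      (ε : ℝ≥0∞) * P {ω | (ε / 2 : ℝ≥0∞) ≤ slabMean x n d ω} ≤ 2 * κ := by
    intro n hn
    have hn2 : 2 ≤ n := hn₀.trans (Finset.mem_Icc.1 hn).1
    have := mul_meas_ge_le_lintegral (μ := P) (measurable_slabMean hx n hd) (ε / 2 : ℝ≥0∞)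
    rw [lintegral_slabMean hx hM hn2 hd] at this
    calc (ε : ℝ≥0∞) * P {ω | (ε / 2 : ℝ≥0∞) ≤ slabMean x n d ω}
        = 2 * ((ε / 2 : ℝ≥0∞) * P {ω | (ε / 2 : ℝ≥0∞) ≤ slabMean x n d ω}) := by
          rw [← mul_assoc, two_mul, ENNReal.add_halves]
      _ ≤ 2 * κ := by gcongr; exact this.trans h3
  calc (ε : ℝ≥0∞) * P {ω | ∃ n, n₀ ≤ n ∧ n ≤ N ∧ 2 * ε < slabDev x n F ω}
      ≤ ε * (P {ω | ∃ n, n₀ ≤ n ∧ n ≤ N ∧ ε < slabDev x n (gridFun c C) ω} +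
          ∑ n ∈ Finset.Icc n₀ N, P {ω | (ε / 2 : ℝ≥0∞) ≤ slabMean x n d ω}) := by
        gcongr
        exact (measure_mono_ae hsub).trans ((measure_union_le _ _).trans
          (add_le_add_right (measure_biUnion_finset_le _ _) _))
    _ = ε * P {ω | ∃ n, n₀ ≤ n ∧ n ≤ N ∧ ε < slabDev x n (gridFun c C) ω} +
          ∑ n ∈ Finset.Icc n₀ N, ε * P {ω | (ε / 2 : ℝ≥0∞) ≤ slabMean x n d ω} := by
        rw [mul_add, Finset.mul_sum]
    _ ≤ ∫⁻ ω, slabDev x n₀ (gridFun c C) ω ∂P + ∑ n ∈ Finset.Icc n₀ N, 2 * (κ : ℝ≥0∞) :=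
        add_le_add (mul_measure_exists_slabDev_gridFun_le hM c hC hdisj hCfin hn₀ N ε)
          (Finset.sum_le_sum hmark)
    _ ≤ (∫⁻ ω, slabDev x n₀ F ω ∂P + 2 * κ) + ∑ n ∈ Finset.Icc n₀ N, 2 * (κ : ℝ≥0∞) := by
        gcongr
        refine (lintegral_slabDev_le hx hM (measurable_gridFun c hC) hfm.ennreal_ofReal hd hhfin
          hFfin h2 h1 hn₀).trans ?_
        gcongr
    _ = ∫⁻ ω, slabDev x n₀ F ω ∂P + K * κ := by
        rw [Finset.sum_const, nsmul_eq_mul, hK]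
        push_cast
        ring
    _ ≤ ∫⁻ ω, slabDev x n₀ F ω ∂P + δ := by gcongr

theorem mul_measure_exists_slabDev_le (hx : ∀ i, Measurable (x i))
    (hM : IsPoissonRandomMeasure (atomMeasure x) (halfLine.prod halfLine) P)
    (hf0 : ∀ z, 0 ≤ f z) (hfm : Measurable f) (hf : Integrable f) {n₀ : ℕ} (hn₀ : 2 ≤ n₀)
    {ε : ℝ≥0} (hε : ε ≠ 0) :
    ε * P {ω | ∃ n, n₀ ≤ n ∧ 2 * ε < slabDev x n (fun z => ENNReal.ofReal (f z)) ω} ≤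
      ∫⁻ ω, slabDev x n₀ (fun z => ENNReal.ofReal (f z)) ω ∂P := by
  have hU : {ω | ∃ n, n₀ ≤ n ∧ 2 * ε < slabDev x n (fun z => ENNReal.ofReal (f z)) ω} =
      ⋃ N, {ω | ∃ n, n₀ ≤ n ∧ n ≤ N ∧ 2 * ε < slabDev x n (fun z => ENNReal.ofReal (f z)) ω} := by
    ext ω
    simp only [mem_ofPred_eq, mem_iUnion]
    exact ⟨fun ⟨n, h1, h2⟩ => ⟨n, n, h1, le_rfl, h2⟩, fun ⟨_, n, h1, _, h2⟩ => ⟨n, h1, h2⟩⟩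
  have hmono : Monotone fun N =>
      {ω | ∃ n, n₀ ≤ n ∧ n ≤ N ∧ 2 * ε < slabDev x n (fun z => ENNReal.ofReal (f z)) ω} :=
    fun N N' h ω ⟨n, h1, h2, h3⟩ => ⟨n, h1, h2.trans h, h3⟩
  rw [hU, hmono.measure_iUnion, ENNReal.mul_iSup]
  exact iSup_le fun N => mul_measure_exists_slabDev_le_of_le hx hM hf0 hfm hf hn₀ N hε

/-- The strong law of large numbers for slab means. -/
theorem ae_tendsto_slabDev (hx : ∀ i, Measurable (x i))
    (hM : IsPoissonRandomMeasure (atomMeasure x) (halfLine.prod halfLine) P)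
    (hf0 : ∀ z, 0 ≤ f z) (hfm : Measurable f) (hf : Integrable f) :
    ∀ᵐ ω ∂P, Tendsto (fun n => slabDev x n (fun z => ENNReal.ofReal (f z)) ω) atTop (𝓝 0) := by
  have hev : ∀ j : ℕ, ∀ᵐ ω ∂P, ∃ n₀, ∀ n, n₀ ≤ n →
      slabDev x n (fun z => ENNReal.ofReal (f z)) ω ≤ 2 * ((1 / (j + 1) : ℝ≥0) : ℝ≥0∞) := by
    intro j
    set ε : ℝ≥0 := 1 / (j + 1) with hεdef
    have hε : ε ≠ 0 := by positivity
    rw [ae_iff]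
    have hlim := tendsto_lintegral_slabDev hx hM hf0 hfm hf
    -- Exceeding `2 * ε` infinitely often entails exceeding it after any `n₀`, so the maximal
    -- inequality bounds this by the mean deviation at `n₀`, which tends to zero.
    have hle : (ε : ℝ≥0∞) * P {ω | ¬∃ n₀, ∀ n, n₀ ≤ n →
        slabDev x n (fun z => ENNReal.ofReal (f z)) ω ≤ 2 * (ε : ℝ≥0∞)} ≤ 0 := by
      refine ge_of_tendsto hlim ?_
      filter_upwards [eventually_ge_atTop 2] with n₀ hn₀
      refine le_trans ?_ (mul_measure_exists_slabDev_le hx hM hf0 hfm hf hn₀ hε)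
      gcongr
      intro h
      push Not at h
      exact h n₀
    have := le_antisymm hle zero_le
    rcases mul_eq_zero.1 this with h | h
    · exact absurd (by exact_mod_cast h) hε
    · exact h
  filter_upwards [ae_all_iff.2 hev] with ω hω
  rw [ENNReal.tendsto_atTop_zero]
  intro ε hε
  have hl : Tendsto (fun j : ℕ => 2 * ((1 / (j + 1) : ℝ≥0) : ℝ≥0∞)) atTop (𝓝 0) := by
    have h1 : Tendsto (fun j : ℕ => ((1 / (j + 1) : ℝ≥0) : ℝ≥0∞)) atTop (𝓝 ((0 : ℝ≥0) : ℝ≥0∞)) :=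
      ENNReal.tendsto_coe.2 tendsto_one_div_add_atTop_nhds_zero_nat
    simpa using ENNReal.Tendsto.const_mul (a := 2) h1 (Or.inr (by simp))
  obtain ⟨j, hj⟩ := ((tendsto_order.1 hl).2 ε hε).exists
  obtain ⟨n₀, hn₀⟩ := hω j
  exact ⟨n₀, fun n hn => (hn₀ n hn).trans hj.le⟩

end SlabLimit

/-! ### Passage along squares and summable means. -/

section Interpolation

/-- Convergence of `f (n ^ 2) / n ^ 4` implies convergence of `f α / α ^ 2` for monotone `f`. -/
theorem tendsto_div_sq_of_monotone {f : ℝ → ℝ} (hf : MonotoneOn f (Ioi 0)) (hf0 : ∀ t, 0 ≤ f t)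
    {L : ℝ} (h : Tendsto (fun m : ℕ => f (((m : ℝ) + 1) ^ 2) / ((m : ℝ) + 1) ^ 4) atTop (𝓝 L)) :
    Tendsto (fun t => f t / t ^ 2) atTop (𝓝 L) := by
  have h1 : Tendsto (fun m : ℕ => ((m : ℝ) + 1) / ((m : ℝ) + 2)) atTop (𝓝 1) := by
    have h2 : Tendsto (fun m : ℕ => 1 - 1 / (((m + 1 : ℕ) : ℝ) + 1)) atTop (𝓝 (1 - 0)) :=
      tendsto_const_nhds.sub
        ((tendsto_add_atTop_iff_nat 1).2 tendsto_one_div_add_atTop_nhds_zero_nat)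
    rw [sub_zero] at h2
    refine h2.congr fun m => ?_
    push_cast
    field_simp
    ring
  have hlow : Tendsto (fun m : ℕ => f (((m : ℝ) + 1) ^ 2) / ((m : ℝ) + 2) ^ 4) atTop (𝓝 L) := by
    have := h.mul (h1.pow 4)
    rw [one_pow, mul_one] at this
    refine this.congr fun m => ?_
    field_simp
  have hupp : Tendsto (fun m : ℕ => f (((m : ℝ) + 2) ^ 2) / ((m : ℝ) + 1) ^ 4) atTop (𝓝 L) := by
    have h3 := ((tendsto_add_atTop_iff_nat 1).2 h).mul ((h1.inv₀ one_ne_zero).pow 4)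
    rw [inv_one, one_pow, mul_one] at h3
    refine h3.congr fun m => ?_
    push_cast
    have e : (m : ℝ) + 1 + 1 = m + 2 := by ring
    rw [e]
    field_simp
  -- With `m = ⌊√t⌋₊ - 1` one has `(m + 1) ^ 2 ≤ t ≤ (m + 2) ^ 2`; the shift by one matches the
  -- indexing of the hypothesis.
  have hm : Tendsto (fun t : ℝ => ⌊√t⌋₊ - 1) atTop atTop :=
    (tendsto_sub_atTop_nat 1).comp (tendsto_nat_floor_atTop.comp Real.tendsto_sqrt_atTop)
  refine tendsto_of_tendsto_of_tendsto_of_le_of_le' (hlow.comp hm) (hupp.comp hm) ?_ ?_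
  all_goals
    filter_upwards [eventually_ge_atTop (1 : ℝ)] with t ht
    have ht0 : 0 < t := by linarith
    have hs1 : 1 ≤ √t := Real.one_le_sqrt.2 ht
    have hfl : 1 ≤ ⌊√t⌋₊ := (Nat.one_le_floor_iff _).2 hs1
    obtain ⟨m, hmt⟩ := Nat.exists_eq_add_of_le' hfl
    have hl : ((m : ℝ) + 1) ≤ √t := by
      have := Nat.floor_le (Real.sqrt_nonneg t)
      rw [hmt] at this
      exact_mod_cast this
    have hu : √t ≤ (m : ℝ) + 2 := by
      have := (Nat.lt_floor_add_one (√t)).le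
      rw [hmt] at this
      push_cast at this
      linarith
    have hm0 : (0 : ℝ) ≤ m := Nat.cast_nonneg m
    have hl2 : ((m : ℝ) + 1) ^ 2 ≤ t := by
      rw [← Real.sq_sqrt ht0.le]; exact pow_le_pow_left₀ (by positivity) hl 2
    have hu2 : t ≤ ((m : ℝ) + 2) ^ 2 := by
      conv_lhs => rw [← Real.sq_sqrt ht0.le]
      exact pow_le_pow_left₀ (Real.sqrt_nonneg t) hu 2
    have hl4 : ((m : ℝ) + 1) ^ 4 ≤ t ^ 2 := by
      have := pow_le_pow_left₀ (by positivity) hl2 2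
      rw [← pow_mul] at this
      exact this
    have hu4 : t ^ 2 ≤ ((m : ℝ) + 2) ^ 4 := by
      have := pow_le_pow_left₀ ht0.le hu2 2
      rw [← pow_mul] at this
      exact this
    simp only [Function.comp_apply, hmt, Nat.add_sub_cancel]
  · exact div_le_div₀ (hf0 _) (hf (mem_Ioi.2 (by positivity)) ht0 hl2) (by positivity) hu4
  · exact div_le_div₀ (hf0 _) (hf ht0 (mem_Ioi.2 (by positivity)) hu2) (by positivity) hl4

/-- Nonnegative random variables whose means are `O(1 / n ^ 2)` converge to zero almost surely. -/
theorem ae_tendsto_zero_of_lintegral_le {Ω : Type*} [MeasurableSpace Ω] {P : Measure Ω}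
    {X : ℕ → Ω → ℝ≥0∞} (hX : ∀ m, Measurable (X m)) {K : ℝ≥0∞} (hK : K ≠ ∞)
    (h : ∀ m : ℕ, ∫⁻ ω, X m ω ∂P ≤ K / (((m + 1) ^ 2 : ℕ) : ℝ≥0∞)) :
    ∀ᵐ ω ∂P, Tendsto (fun m => X m ω) atTop (𝓝 0) := by
  have hsum : Summable fun m : ℕ => 1 / (((m + 1 : ℕ) : ℝ) ^ 2) :=
    (summable_nat_add_iff 1).2 (Real.summable_one_div_nat_pow.2 one_lt_two)
  have hfin : ∑' m, ∫⁻ ω, X m ω ∂P ≠ ∞ := by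
    refine ((ENNReal.tsum_le_tsum h).trans_lt ?_).ne
    have e : ∀ m : ℕ, K / (((m + 1) ^ 2 : ℕ) : ℝ≥0∞) =
        K * ENNReal.ofReal (1 / (((m + 1 : ℕ) : ℝ) ^ 2)) := by
      intro m
      rw [div_eq_mul_inv, one_div, ENNReal.ofReal_inv_of_pos (by positivity), ← Nat.cast_pow,
        ENNReal.ofReal_natCast]
    simp_rw [e]
    rw [ENNReal.tsum_mul_left]
    exact ENNReal.mul_lt_top hK.lt_top hsum.tsum_ofReal_lt_top
  -- A nonnegative series with finite mean is almost surely finite, so its terms tend to zero.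
  rw [← lintegral_tsum fun m => (hX m).aemeasurable] at hfin
  filter_upwards [ae_lt_top (Measurable.tsum hX) hfin] with ω hω
  exact ENNReal.tendsto_atTop_zero_of_tsum_ne_top hω.ne

end Interpolation

/-! ### Edge counts as weighted sums of link indicators. -/

section Graph

variable {W : ℝ → ℝ → ℝ}

/-- The graphon function, extended by zero outside the open quadrant. -/
noncomputable def quadrantFun (W : ℝ → ℝ → ℝ) : ℝ × ℝ → ℝ :=
  (Ioi (0 : ℝ) ×ˢ Ioi (0 : ℝ)).indicator fun p => W p.1 p.2

theorem quadrantFun_of_pos {y z : ℝ} (hy : 0 < y) (hz : 0 < z) :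
    quadrantFun W (y, z) = W y z :=
  indicator_of_mem (mk_mem_prod (mem_Ioi.2 hy) (mem_Ioi.2 hz)) _

theorem IsGraphonFunction.quadrantFun_mem (hW : IsGraphonFunction W) (z : ℝ × ℝ) :
    quadrantFun W z ∈ Icc (0 : ℝ) 1 := by
  by_cases h : z ∈ Ioi (0 : ℝ) ×ˢ Ioi (0 : ℝ)
  · rw [quadrantFun, indicator_of_mem h]
    exact hW.mem_Icc _ _ (le_of_lt h.1) (le_of_lt h.2)
  · rw [quadrantFun, indicator_of_notMem h]; simp

theorem measurableSet_quadrant : MeasurableSet (Ioi (0 : ℝ) ×ˢ Ioi (0 : ℝ)) :=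
  measurableSet_Ioi.prod measurableSet_Ioi

/-- Measurability of `W` is known only on the closed quadrant; retracting the plane onto it by `max
· 0` changes nothing on the open quadrant. -/
theorem IsGraphonFunction.measurable_quadrantFun (hW : IsGraphonFunction W) :
    Measurable (quadrantFun W) := by
  have h : Measurable fun z : ℝ × ℝ => W (max z.1 0) (max z.2 0) := by
    have hm : Measurable fun z : ℝ × ℝ =>
        ((⟨max z.1 0, mem_Ici.2 (le_max_right _ _)⟩, ⟨max z.2 0, mem_Ici.2 (le_max_right _ _)⟩) :
          Ici (0 : ℝ) × Ici (0 : ℝ)) :=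
      ((measurable_fst.max measurable_const).subtype_mk).prodMk
        ((measurable_snd.max measurable_const).subtype_mk)
    exact hW.measurable.comp hm
  have e : quadrantFun W = (Ioi (0 : ℝ) ×ˢ Ioi (0 : ℝ)).indicator
      fun z : ℝ × ℝ => W (max z.1 0) (max z.2 0) := by
    refine indicator_congr fun z hz => ?_
    rw [max_eq_left (le_of_lt hz.1), max_eq_left (le_of_lt hz.2)]
  rw [e]
  exact h.indicator measurableSet_quadrant

theorem IsGraphonFunction.integrable_quadrantFun (hW : IsGraphonFunction W) :
    Integrable (quadrantFun W) :=
  (integrable_indicator_iff measurableSet_quadrant).2 hW.integrable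

theorem IsGraphonFunction.lintegral_quadrantFun (hW : IsGraphonFunction W) :
    ∫⁻ z, ENNReal.ofReal (quadrantFun W z) ∂(halfLine.prod halfLine) =
      ENNReal.ofReal (graphonMass W) := by
  rw [halfLine_prod, graphonMass, ofReal_integral_eq_lintegral_ofReal hW.integrable]
  · refine setLIntegral_congr_fun measurableSet_quadrant fun z hz => ?_
    simp only [quadrantFun, indicator_of_mem hz]
  · filter_upwards [ae_restrict_mem measurableSet_quadrant] with z hz
    exact (hW.mem_Icc _ _ (le_of_lt hz.1) (le_of_lt hz.2)).1

theorem IsGraphonFunction.lintegral_diag_ne_top (hW : IsGraphonFunction W) :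
    ∫⁻ y, ENNReal.ofReal (quadrantFun W (y, y)) ∂halfLine ≠ ∞ := by
  have : ∫⁻ y, ENNReal.ofReal (quadrantFun W (y, y)) ∂halfLine =
      ∫⁻ y in Ioi 0, ENNReal.ofReal (W y y) :=
    setLIntegral_congr_fun measurableSet_Ioi fun y hy => by
      simp only [quadrantFun_of_pos (mem_Ioi.1 hy) (mem_Ioi.1 hy)]
  rw [this]
  exact hW.integrable_diag.lintegral_lt_top.ne

theorem lintegral_leInd_halfLine {t : ℝ} : ∫⁻ s, leInd s t ∂halfLine = ENNReal.ofReal t := by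
  have : (fun s => leInd s t) = (Iic t).indicator 1 := by
    ext s; simp [leInd, indicator_apply]
  rw [this, lintegral_indicator_one measurableSet_Iic, Measure.restrict_apply measurableSet_Iic,
    Iic_inter_Ioi, Real.volume_Ioc, sub_zero]

theorem measurable_leInd_left (t : ℝ) : Measurable fun s => leInd s t :=
  measurable_leInd measurable_id measurable_const

variable {Ω : Type*} {θ ϑ : ℕ → Ω → ℝ} {U : ℕ → ℕ → Ω → ℝ}

/-- The indicator that `e` is a pair of distinct indices of points born up to time `t`. -/
noncomputable def edgeWeight (t : ℝ) (a : ℕ → ℝ × ℝ) (e : ℕ × ℕ) : ℝ≥0∞ :=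
  if e.1 ≠ e.2 then leInd (a e.1).1 t * leInd (a e.2).1 t else 0

/-- The indicator that `e` is a repeated index of a point born up to time `t`. -/
noncomputable def loopWeight (t : ℝ) (a : ℕ → ℝ × ℝ) (e : ℕ × ℕ) : ℝ≥0∞ :=
  if e.1 = e.2 then leInd (a e.1).1 t else 0

/-- The link probability of the pair `e`. -/
noncomputable def linkProb (W : ℝ → ℝ → ℝ) (a : ℕ → ℝ × ℝ) (e : ℕ × ℕ) : ℝ :=
  quadrantFun W ((a e.1).2, (a e.2).2)

/-- The number of links among the pairs weighted by `c`. -/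
noncomputable def linkSum (W : ℝ → ℝ → ℝ) (θ ϑ : ℕ → Ω → ℝ) (U : ℕ → ℕ → Ω → ℝ)
    (c : (ℕ → ℝ × ℝ) → ℕ × ℕ → ℝ≥0∞) (ω : Ω) : ℝ≥0∞ :=
  ∑' e : ℕ × ℕ, c (fun i => (θ i ω, ϑ i ω)) e *
    leInd (U e.1 e.2 ω) (linkProb W (fun i => (θ i ω, ϑ i ω)) e)

/-- The sum of the link probabilities of the pairs weighted by `c`. -/
noncomputable def probSum (W : ℝ → ℝ → ℝ) (θ ϑ : ℕ → Ω → ℝ)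
    (c : (ℕ → ℝ × ℝ) → ℕ × ℕ → ℝ≥0∞) (ω : Ω) : ℝ≥0∞ :=
  ∑' e : ℕ × ℕ, c (fun i => (θ i ω, ϑ i ω)) e *
    ENNReal.ofReal (linkProb W (fun i => (θ i ω, ϑ i ω)) e)

theorem numEdges_mono {s t : ℝ} (hst : s ≤ t) (ω : Ω) :
    numEdges W θ ϑ U s ω ≤ numEdges W θ ϑ U t ω := by
  have hp : ∀ i, present θ s i ω ≤ present θ t i ω := by
    intro i
    unfold present
    split_ifs with h1 h2
    · exact le_rfl
    · exact absurd (h1.trans hst) h2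
    · exact zero_le
    · exact le_rfl
  unfold numEdges
  refine add_le_add (mul_le_mul_right (ENNReal.tsum_le_tsum fun i => ENNReal.tsum_le_tsum fun j =>
    ?_) _) (ENNReal.tsum_le_tsum fun i => ?_)
  · split_ifs
    · exact mul_le_mul' (mul_le_mul' le_rfl (hp i)) (hp j)
    · exact le_rfl
  · exact mul_le_mul' le_rfl (hp i)

/-- Edges and loops take the common form of a link count whose weights and probabilities depend on
the points alone, to which independence of the array applies. -/
theorem numEdges_eq_of_pos {ω : Ω} (hω : ∀ i, 0 < ϑ i ω) (t : ℝ) :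
    numEdges W θ ϑ U t ω = 1 / 2 * linkSum W θ ϑ U (edgeWeight t) ω +
      linkSum W θ ϑ U (loopWeight t) ω := by
  unfold numEdges linkSum
  rw [ENNReal.tsum_prod', ENNReal.tsum_prod']
  congr 1
  · congr 1
    refine tsum_congr fun i => tsum_congr fun j => ?_
    simp only [edgeWeight, linkProb, quadrantFun_of_pos (hω i) (hω j)]
    split_ifs
    · change leInd (U i j ω) (W (ϑ i ω) (ϑ j ω)) * leInd (θ i ω) t * leInd (θ j ω) t = _
      ring
    · simp
  · refine tsum_congr fun i => ?_
    rw [tsum_eq_single i]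
    · simp only [loopWeight, linkProb, quadrantFun_of_pos (hω i) (hω i), if_true]
      exact mul_comm _ _
    · intro j hj
      simp [loopWeight, hj.symm]

theorem probSum_edgeWeight (t : ℝ) (ω : Ω) :
    probSum W θ ϑ (edgeWeight t) ω = pairSum (fun i ω => (θ i ω, ϑ i ω))
      (timeKernel (fun s => leInd s t) (fun s => leInd s t)
        fun z => ENNReal.ofReal (quadrantFun W z)) ω := by
  unfold probSum pairSum
  rw [ENNReal.tsum_prod']
  refine tsum_congr fun i => tsum_congr fun j => ?_
  simp only [edgeWeight, linkProb, timeKernel]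
  split_ifs <;> simp

theorem probSum_loopWeight (t : ℝ) (ω : Ω) :
    probSum W θ ϑ (loopWeight t) ω =
      ∑' i, leInd (θ i ω) t * ENNReal.ofReal (quadrantFun W (ϑ i ω, ϑ i ω)) := by
  unfold probSum
  rw [ENNReal.tsum_prod']
  refine tsum_congr fun i => ?_
  rw [tsum_eq_single i]
  · simp [loopWeight, linkProb]
  · intro j hj
    simp [loopWeight, hj.symm]

theorem measurable_edgeWeight (t : ℝ) (e : ℕ × ℕ) : Measurable fun a => edgeWeight t a e := by
  have h : ∀ i : ℕ, Measurable fun a : ℕ → ℝ × ℝ => leInd (a i).1 t := fun i =>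
    measurable_leInd (measurable_pi_apply i).fst measurable_const
  unfold edgeWeight
  split_ifs
  · exact (h _).mul (h _)
  · exact measurable_const

theorem measurable_loopWeight (t : ℝ) (e : ℕ × ℕ) : Measurable fun a => loopWeight t a e := by
  unfold loopWeight
  split_ifs
  · exact measurable_leInd (measurable_pi_apply e.1).fst measurable_const
  · exact measurable_const

theorem edgeWeight_le_one (t : ℝ) (a : ℕ → ℝ × ℝ) (e : ℕ × ℕ) : edgeWeight t a e ≤ 1 := by
  unfold edgeWeight
  split_ifs
  · exact mul_le_one' (leInd_le_one _ _) (leInd_le_one _ _)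
  · exact zero_le

theorem IsGraphonFunction.measurable_linkProb (hW : IsGraphonFunction W) (e : ℕ × ℕ) :
    Measurable fun a => linkProb W a e :=
  hW.measurable_quadrantFun.comp
    ((measurable_pi_apply e.1).snd.prodMk (measurable_pi_apply e.2).snd)

/-- Pairs of points in distinct slabs up to time `n` are pairs of points up to time `n`. -/
theorem slabKernel_le_timeKernel (n : ℕ) (f : ℝ × ℝ → ℝ≥0∞) (e : (ℝ × ℝ) × (ℝ × ℝ)) :
    slabKernel n f e ≤ timeKernel (fun s => leInd s n) (fun s => leInd s n) f e := by
  have hle : ∀ t : ℝ, ∑ k ∈ Finset.range n, (slab k).indicator (1 : ℝ → ℝ≥0∞) t ≤ leInd t n := by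
    intro t
    by_cases h : ∃ k ∈ Finset.range n, t ∈ slab k
    · obtain ⟨k, hk, htk⟩ := h
      rw [Finset.sum_eq_single k]
      · have h1 : ((k : ℕ) : ℝ) + 1 ≤ n := by exact_mod_cast Finset.mem_range.1 hk
        rw [indicator_of_mem htk, leInd, if_pos (htk.2.trans h1), Pi.one_apply]
      · intro l _ hl
        exact indicator_of_notMem (fun h => Set.disjoint_left.1 (disjoint_slab hl) h htk) _
      · exact fun h => absurd hk h
    · push Not at h
      rw [Finset.sum_eq_zero fun k hk => indicator_of_notMem (h k hk) _]
      exact zero_le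
  calc slabKernel n f e
      ≤ ∑ k ∈ Finset.range n, ∑ l ∈ Finset.range n,
          timeKernel ((slab k).indicator 1) ((slab l).indicator 1) f e :=
        Finset.sum_le_sum fun k _ => Finset.sum_le_sum fun l _ => by
          split_ifs
          · exact le_rfl
          · exact zero_le
    _ = (∑ k ∈ Finset.range n, (slab k).indicator (1 : ℝ → ℝ≥0∞) e.1.1) *
          (∑ l ∈ Finset.range n, (slab l).indicator (1 : ℝ → ℝ≥0∞) e.2.1) * f (e.1.2, e.2.2) := by
        rw [Finset.sum_mul_sum, Finset.sum_mul]
        refine Finset.sum_congr rfl fun k _ => ?_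
        rw [Finset.sum_mul]
        rfl
    _ ≤ _ := mul_le_mul' (mul_le_mul' (hle _) (hle _)) le_rfl

end Graph

/-! ### Asymptotics of the number of edges. -/

section GraphLimit

variable {Ω : Type*} [MeasurableSpace Ω] {P : Measure Ω} {W : ℝ → ℝ → ℝ} {θ ϑ : ℕ → Ω → ℝ}
  {U : ℕ → ℕ → Ω → ℝ}

theorem IsGraphInput.measurable_point (hG : IsGraphInput P θ ϑ U) (i : ℕ) :
    Measurable fun ω => (θ i ω, ϑ i ω) :=
  (hG.measurable_θ i).prodMk (hG.measurable_ϑ i)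

theorem IsGraphInput.isPoisson (hG : IsGraphInput P θ ϑ U) :
    IsPoissonRandomMeasure (atomMeasure fun i ω => (θ i ω, ϑ i ω)) (halfLine.prod halfLine) P := by
  rw [halfLine_prod]
  exact hG.poisson

/-- By Campbell's formula the mean number of points outside the open quadrant is zero. -/
theorem IsGraphInput.ae_pos (hG : IsGraphInput P θ ϑ U) : ∀ᵐ ω ∂P, ∀ i, 0 < ϑ i ω := by
  have hm : Measurable ((Ioi (0 : ℝ) ×ˢ Ioi (0 : ℝ))ᶜ.indicator (1 : ℝ × ℝ → ℝ≥0∞)) :=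
    measurable_one.indicator measurableSet_quadrant.compl
  have hmi : ∀ i, Measurable fun ω =>
      (Ioi (0 : ℝ) ×ˢ Ioi (0 : ℝ))ᶜ.indicator (1 : ℝ × ℝ → ℝ≥0∞) (θ i ω, ϑ i ω) := fun i =>
    hm.comp (hG.measurable_point i)
  have h := hG.isPoisson.campbell hG.measurable_point hm
  rw [lintegral_indicator_one measurableSet_quadrant.compl, halfLine_prod,
    Measure.restrict_apply measurableSet_quadrant.compl, compl_inter_self, measure_empty,
    lintegral_eq_zero_iff (Measurable.tsum hmi)] at h
  filter_upwards [h] with ω hω i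
  have hi := ENNReal.tsum_eq_zero.1 hω i
  by_contra hneg
  rw [indicator_of_mem (show (θ i ω, ϑ i ω) ∈ (Ioi (0 : ℝ) ×ˢ Ioi (0 : ℝ))ᶜ from
    fun hmem => hneg hmem.2)] at hi
  simp at hi

theorem measurable_probSum (hW : IsGraphonFunction W) (hG : IsGraphInput P θ ϑ U)
    {c : (ℕ → ℝ × ℝ) → ℕ × ℕ → ℝ≥0∞} (hc : ∀ e, Measurable fun a => c a e) :
    Measurable (probSum W θ ϑ c) :=
  (measurable_tsum_ofReal hc hW.measurable_linkProb).comp hG.measurable_atoms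

theorem measurable_linkSum (hW : IsGraphonFunction W) (hG : IsGraphInput P θ ϑ U)
    {c : (ℕ → ℝ × ℝ) → ℕ × ℕ → ℝ≥0∞} (hc : ∀ e, Measurable fun a => c a e) :
    Measurable (linkSum W θ ϑ U c) :=
  (measurable_tsum_leInd hc hW.measurable_linkProb).comp
    (hG.measurable_atoms.prodMk hG.measurable_array)

theorem lintegral_probSum_edgeWeight (hW : IsGraphonFunction W) (hG : IsGraphInput P θ ϑ U)
    (t : ℝ) : ∫⁻ ω, probSum W θ ϑ (edgeWeight t) ω ∂P =
      ENNReal.ofReal t ^ 2 * ENNReal.ofReal (graphonMass W) := by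
  have hw := hW.measurable_quadrantFun.ennreal_ofReal
  simp_rw [probSum_edgeWeight]
  rw [hG.isPoisson.lintegral_pairSum hG.measurable_point
    (measurable_timeKernel (measurable_leInd_left t) (measurable_leInd_left t) hw),
    lintegral_timeKernel (measurable_leInd_left t) (measurable_leInd_left t) hw,
    lintegral_leInd_halfLine, hW.lintegral_quadrantFun, sq]

theorem lintegral_probSum_loopWeight (hW : IsGraphonFunction W) (hG : IsGraphInput P θ ϑ U)
    (t : ℝ) : ∫⁻ ω, probSum W θ ϑ (loopWeight t) ω ∂P =
      ENNReal.ofReal t * ∫⁻ y, ENNReal.ofReal (quadrantFun W (y, y)) ∂halfLine := by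
  have hw : Measurable fun y => ENNReal.ofReal (quadrantFun W (y, y)) :=
    (hW.measurable_quadrantFun.comp (measurable_id.prodMk measurable_id)).ennreal_ofReal
  simp_rw [probSum_loopWeight]
  rw [hG.isPoisson.campbell hG.measurable_point
    (g := fun z => leInd z.1 t * ENNReal.ofReal (quadrantFun W (z.2, z.2)))
    (((measurable_leInd_left t).comp measurable_fst).mul (hw.comp measurable_snd)),
    lintegral_prod_mul (measurable_leInd_left t).aemeasurable hw.aemeasurable,
    lintegral_leInd_halfLine]

theorem ae_numEdges_eq (hG : IsGraphInput P θ ϑ U) :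
    ∀ᵐ ω ∂P, ∀ t, numEdges W θ ϑ U t ω = 1 / 2 * linkSum W θ ϑ U (edgeWeight t) ω +
      linkSum W θ ϑ U (loopWeight t) ω := by
  filter_upwards [hG.ae_pos] with ω hω t using numEdges_eq_of_pos hω t

theorem aemeasurable_numEdges (hW : IsGraphonFunction W) (hG : IsGraphInput P θ ϑ U) (t : ℝ) :
    AEMeasurable (numEdges W θ ϑ U t) P := by
  refine ⟨fun ω => 1 / 2 * linkSum W θ ϑ U (edgeWeight t) ω + linkSum W θ ϑ U (loopWeight t) ω,
    ((measurable_linkSum hW hG (measurable_edgeWeight t)).const_mul _).add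
      (measurable_linkSum hW hG (measurable_loopWeight t)), ?_⟩
  filter_upwards [ae_numEdges_eq hG] with ω hω using hω t

/-- The contribution of pairs of points in a common slab is negligible along squares. -/
theorem ae_tendsto_sameSlab (hW : IsGraphonFunction W) (hG : IsGraphInput P θ ϑ U) :
    ∀ᵐ ω ∂P, Tendsto (fun m : ℕ => (probSum W θ ϑ (edgeWeight (((m + 1) ^ 2 : ℕ) : ℝ)) ω -
      pairSum (fun i ω => (θ i ω, ϑ i ω))
        (slabKernel ((m + 1) ^ 2) fun z => ENNReal.ofReal (quadrantFun W z)) ω) /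
          (((m + 1) ^ 2 : ℕ) : ℝ≥0∞) ^ 2) atTop (𝓝 0) := by
  have hw := hW.measurable_quadrantFun.ennreal_ofReal
  have hps : ∀ n, Measurable (pairSum (fun i ω => (θ i ω, ϑ i ω))
      (slabKernel n fun z => ENNReal.ofReal (quadrantFun W z))) := fun n =>
    measurable_pairSum hG.measurable_point (measurable_slabKernel n hw)
  refine ae_tendsto_zero_of_lintegral_le (fun m =>
    ((measurable_probSum hW hG (measurable_edgeWeight _)).sub (hps _)).div_const _)
    (K := ENNReal.ofReal (graphonMass W)) ENNReal.ofReal_ne_top fun m => ?_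
  set n : ℕ := (m + 1) ^ 2 with hn
  have hn0 : (n : ℝ≥0∞) ≠ 0 := by rw [Nat.cast_ne_zero]; positivity
  have hnt : (n : ℝ≥0∞) ≠ ∞ := ENNReal.natCast_ne_top n
  have hsub : Measurable fun ω => probSum W θ ϑ (edgeWeight (n : ℝ)) ω -
      pairSum (fun i ω => (θ i ω, ϑ i ω))
        (slabKernel n fun z => ENNReal.ofReal (quadrantFun W z)) ω :=
    (measurable_probSum hW hG (measurable_edgeWeight _)).sub (hps n)
  have hIs : ∫⁻ ω, pairSum (fun i ω => (θ i ω, ϑ i ω))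
      (slabKernel n fun z => ENNReal.ofReal (quadrantFun W z)) ω ∂P =
        ((n * (n - 1) : ℕ) : ℝ≥0∞) * ENNReal.ofReal (graphonMass W) := by
    rw [hG.isPoisson.lintegral_pairSum hG.measurable_point (measurable_slabKernel n hw),
      lintegral_slabKernel n hw, hW.lintegral_quadrantFun]
  simp_rw [div_eq_mul_inv]
  rw [lintegral_mul_const _ hsub,
    lintegral_sub (hps n) (by rw [hIs]; finiteness) (ae_of_all _ fun ω => by
      rw [probSum_edgeWeight]
      exact pairSum_mono (slabKernel_le_timeKernel n _) ω),
    hIs, lintegral_probSum_edgeWeight hW hG, ENNReal.ofReal_natCast]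
  -- Of mean mass `n²`, distinct slabs account for `n (n - 1)`. The remaining `n`, divided by `n²`,
  -- is `1 / (m + 1) ^ 2`, hence summable.
  have h1 : (n : ℝ≥0∞) ^ 2 * ENNReal.ofReal (graphonMass W) -
      ((n * (n - 1) : ℕ) : ℝ≥0∞) * ENNReal.ofReal (graphonMass W) =
        n * ENNReal.ofReal (graphonMass W) := by
    refine ENNReal.sub_eq_of_eq_add (by finiteness) ?_
    rw [← add_mul, ← Nat.cast_pow, ← Nat.cast_add]
    congr 2
    obtain ⟨k, hk⟩ : ∃ k, n = k + 1 := Nat.exists_eq_succ_of_ne_zero (by positivity)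
    rw [hk, Nat.add_sub_cancel]
    ring
  rw [h1, sq, ENNReal.mul_inv (Or.inl hn0) (Or.inl hnt)]
  calc (n : ℝ≥0∞) * ENNReal.ofReal (graphonMass W) * ((n : ℝ≥0∞)⁻¹ * (n : ℝ≥0∞)⁻¹)
      = ((n : ℝ≥0∞) * (n : ℝ≥0∞)⁻¹) * (ENNReal.ofReal (graphonMass W) * (n : ℝ≥0∞)⁻¹) := by ring
    _ = _ := by rw [ENNReal.mul_inv_cancel hn0 hnt, one_mul]
    _ ≤ _ := le_rfl

variable [IsProbabilityMeasure P]

theorem lintegral_linkSum_eq (hW : IsGraphonFunction W) (hG : IsGraphInput P θ ϑ U)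
    {c : (ℕ → ℝ × ℝ) → ℕ × ℕ → ℝ≥0∞} (hc : ∀ e, Measurable fun a => c a e) :
    ∫⁻ ω, linkSum W θ ϑ U c ω ∂P = ∫⁻ ω, probSum W θ ϑ c ω ∂P :=
  hG.lintegral_linkSum hc hW.measurable_linkProb fun _ _ => hW.quadrantFun_mem _

theorem lintegral_numEdges (hW : IsGraphonFunction W) (hG : IsGraphInput P θ ϑ U) (t : ℝ) :
    ∫⁻ ω, numEdges W θ ϑ U t ω ∂P =
      1 / 2 * (ENNReal.ofReal t ^ 2 * ENNReal.ofReal (graphonMass W)) +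
        ENNReal.ofReal t * ∫⁻ y, ENNReal.ofReal (quadrantFun W (y, y)) ∂halfLine := by
  rw [← lintegral_probSum_edgeWeight hW hG, ← lintegral_probSum_loopWeight hW hG,
    ← lintegral_linkSum_eq hW hG (measurable_edgeWeight t),
    ← lintegral_linkSum_eq hW hG (measurable_loopWeight t),
    ← lintegral_const_mul _ (measurable_linkSum hW hG (measurable_edgeWeight t)),
    ← lintegral_add_right _ (measurable_linkSum hW hG (measurable_loopWeight t))]
  refine lintegral_congr_ae ?_
  filter_upwards [ae_numEdges_eq hG] with ω hω using hω t

theorem lintegral_numEdges_ne_top (hW : IsGraphonFunction W) (hG : IsGraphInput P θ ϑ U)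
    (t : ℝ) : ∫⁻ ω, numEdges W θ ϑ U t ω ∂P ≠ ∞ := by
  rw [lintegral_numEdges hW hG]
  have := hW.lintegral_diag_ne_top
  finiteness

/-- Monotonicity in `t` reduces the uncountably many times to the integers. -/
theorem ae_numEdges_ne_top (hW : IsGraphonFunction W) (hG : IsGraphInput P θ ϑ U) :
    ∀ᵐ ω ∂P, ∀ t : ℝ, numEdges W θ ϑ U t ω ≠ ∞ := by
  have h : ∀ᵐ ω ∂P, ∀ n : ℕ, numEdges W θ ϑ U n ω < ∞ := ae_all_iff.2 fun n =>
    ae_lt_top' (aemeasurable_numEdges hW hG n) (lintegral_numEdges_ne_top hW hG n)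
  filter_upwards [h] with ω hω t
  obtain ⟨n, hn⟩ := exists_nat_ge t
  exact ((numEdges_mono hn ω).trans_lt (hω n)).ne

theorem integral_numEdges (hW : IsGraphonFunction W) (hG : IsGraphInput P θ ϑ U) {t : ℝ}
    (ht : 0 ≤ t) : ∫ ω, (numEdges W θ ϑ U t ω).toReal ∂P =
      t ^ 2 * graphonMass W / 2 +
        t * (∫⁻ y, ENNReal.ofReal (quadrantFun W (y, y)) ∂halfLine).toReal := by
  have hD := hW.lintegral_diag_ne_top
  rw [integral_toReal (aemeasurable_numEdges hW hG t)
    (ae_lt_top' (aemeasurable_numEdges hW hG t) (lintegral_numEdges_ne_top hW hG t)),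
    lintegral_numEdges hW hG, ENNReal.toReal_add (by finiteness) (by finiteness)]
  simp only [ENNReal.toReal_mul, ENNReal.toReal_pow, ENNReal.toReal_ofReal ht,
    ENNReal.toReal_ofReal hW.integral_pos.le, graphonMass, ENNReal.toReal_div, ENNReal.toReal_one,
    ENNReal.toReal_ofNat]
  ring

/-- The sum of the link probabilities satisfies the law of large numbers along squares. -/
theorem ae_tendsto_probSum (hW : IsGraphonFunction W) (hG : IsGraphInput P θ ϑ U) :
    ∀ᵐ ω ∂P, Tendsto (fun m : ℕ =>
      (probSum W θ ϑ (edgeWeight (((m + 1) ^ 2 : ℕ) : ℝ)) ω).toReal /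
        (((m + 1) ^ 2 : ℕ) : ℝ) ^ 2) atTop (𝓝 (graphonMass W)) := by
  have hw := hW.measurable_quadrantFun.ennreal_ofReal
  have hfin : ∀ᵐ ω ∂P, ∀ n : ℕ, probSum W θ ϑ (edgeWeight n) ω < ∞ := ae_all_iff.2 fun n =>
    ae_lt_top (measurable_probSum hW hG (measurable_edgeWeight _))
      (by rw [lintegral_probSum_edgeWeight hW hG]; finiteness)
  filter_upwards [hfin, ae_tendsto_sameSlab hW hG, ae_tendsto_slabDev hG.measurable_point
    hG.isPoisson (fun z => (hW.quadrantFun_mem z).1) hW.measurable_quadrantFun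
    hW.integrable_quadrantFun] with ω h1 h2 h3
  set x : ℕ → Ω → ℝ × ℝ := fun i ω => (θ i ω, ϑ i ω) with hx
  set F : ℝ × ℝ → ℝ≥0∞ := fun z => ENNReal.ofReal (quadrantFun W z) with hF
  have hsq : Tendsto (fun m : ℕ => (m + 1) ^ 2) atTop atTop :=
    tendsto_atTop_mono (fun m => show m ≤ (m + 1) ^ 2 by nlinarith) tendsto_id
  have hmean : Tendsto (fun m : ℕ => (slabMean x ((m + 1) ^ 2) F ω).toReal) atTop
      (𝓝 (graphonMass W)) := by
    have h4 : Tendsto (fun n => ‖(slabMean x n F ω).toReal - graphonMass W‖ₑ) atTop (𝓝 0) := by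
      simpa only [slabDev, hF, hW.lintegral_quadrantFun,
        ENNReal.toReal_ofReal (show 0 ≤ graphonMass W from hW.integral_pos.le)] using h3
    have h5 : Tendsto (fun n => (slabMean x n F ω).toReal) atTop (𝓝 (graphonMass W)) := by
      rw [tendsto_iff_edist_tendsto_0]
      simpa only [edist_eq_enorm_sub] using h4
    exact h5.comp hsq
  -- This is `n (n - 1) / n²`, which converts the normalisation of the slab mean to the one by `n²`.
  have hratio : Tendsto (fun m : ℕ => 1 - 1 / (((m + 1) ^ 2 : ℕ) : ℝ)) atTop (𝓝 1) := by
    have : Tendsto (fun m : ℕ => 1 / (((m + 1) ^ 2 : ℕ) : ℝ)) atTop (𝓝 0) :=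
      tendsto_one_div_atTop_nhds_zero_nat.comp hsq
    simpa using this.const_sub 1
  have hrem := (ENNReal.tendsto_toReal ENNReal.zero_ne_top).comp h2
  have hsum := (hmean.mul hratio).add hrem
  rw [mul_one, ENNReal.toReal_zero, add_zero] at hsum
  refine hsum.congr' ?_
  filter_upwards [eventually_ge_atTop 1] with m hm
  simp only [Function.comp_apply]
  set n : ℕ := (m + 1) ^ 2 with hn
  have hn1 : 1 < n := by rw [hn]; nlinarith
  have hle : pairSum x (slabKernel n F) ω ≤ probSum W θ ϑ (edgeWeight n) ω := by
    rw [probSum_edgeWeight]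
    exact pairSum_mono (slabKernel_le_timeKernel n _) ω
  have hnr : (1 : ℝ) < n := by exact_mod_cast hn1
  simp only [ENNReal.toReal_div, ENNReal.toReal_pow, ENNReal.toReal_natCast,
    ENNReal.toReal_sub_of_le hle (h1 n).ne, slabMean]
  rw [Nat.cast_mul, Nat.cast_sub hn1.le, Nat.cast_one]
  have h6 : (n : ℝ) - 1 ≠ 0 := by linarith
  have h7 : (n : ℝ) ≠ 0 := by linarith
  field_simp
  ring

/-- The number of links deviates little from the sum of the link probabilities. -/
theorem ae_tendsto_linkSum_sub (hW : IsGraphonFunction W) (hG : IsGraphInput P θ ϑ U) :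
    ∀ᵐ ω ∂P, Tendsto (fun m : ℕ =>
      ((linkSum W θ ϑ U (edgeWeight (((m + 1) ^ 2 : ℕ) : ℝ)) ω).toReal -
        (probSum W θ ϑ (edgeWeight (((m + 1) ^ 2 : ℕ) : ℝ)) ω).toReal) /
        (((m + 1) ^ 2 : ℕ) : ℝ) ^ 2) atTop (𝓝 0) := by
  have hX : ∀ t : ℝ, Measurable fun ω => ENNReal.ofReal
      (((linkSum W θ ϑ U (edgeWeight t) ω).toReal -
        (probSum W θ ϑ (edgeWeight t) ω).toReal) ^ 2) := fun t =>
    (((measurable_linkSum hW hG (measurable_edgeWeight t)).ennreal_toReal.sub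
      (measurable_probSum hW hG (measurable_edgeWeight t)).ennreal_toReal).pow_const
        2).ennreal_ofReal
  have hlim := ae_tendsto_zero_of_lintegral_le (P := P)
    (X := fun m ω => ENNReal.ofReal
      (((linkSum W θ ϑ U (edgeWeight (((m + 1) ^ 2 : ℕ) : ℝ)) ω).toReal -
        (probSum W θ ϑ (edgeWeight (((m + 1) ^ 2 : ℕ) : ℝ)) ω).toReal) ^ 2) /
          (((m + 1) ^ 2 : ℕ) : ℝ≥0∞) ^ 4)
    (fun m => (hX _).div_const _) (K := 2 * ENNReal.ofReal (graphonMass W)) (by finiteness)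
    fun m => by
      set n : ℕ := (m + 1) ^ 2 with hn
      have hn0 : (n : ℝ≥0∞) ≠ 0 := by rw [Nat.cast_ne_zero]; positivity
      have hn1 : (1 : ℝ≥0∞) ≤ n := by exact_mod_cast Nat.one_le_iff_ne_zero.2 (by positivity)
      have hnt : (n : ℝ≥0∞) ≠ ∞ := ENNReal.natCast_ne_top n
      have hmean := lintegral_probSum_edgeWeight hW hG (n : ℝ)
      rw [ENNReal.ofReal_natCast] at hmean
      have hvar := hG.lintegral_sq_linkSum_sub_le (measurable_edgeWeight (n : ℝ))
        hW.measurable_linkProb (edgeWeight_le_one _) (fun _ _ => hW.quadrantFun_mem _)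
        (by
          change ∫⁻ ω, probSum W θ ϑ (edgeWeight (n : ℝ)) ω ∂P ≠ ∞
          rw [hmean]; finiteness)
      change ∫⁻ ω, ENNReal.ofReal (((linkSum W θ ϑ U (edgeWeight (n : ℝ)) ω).toReal -
        (probSum W θ ϑ (edgeWeight (n : ℝ)) ω).toReal) ^ 2) ∂P ≤
          2 * ∫⁻ ω, probSum W θ ϑ (edgeWeight (n : ℝ)) ω ∂P at hvar
      rw [hmean] at hvar
      simp_rw [div_eq_mul_inv]
      rw [lintegral_mul_const _ (hX _)]
      calc _ ≤ 2 * ((n : ℝ≥0∞) ^ 2 * ENNReal.ofReal (graphonMass W)) * ((n : ℝ≥0∞) ^ 4)⁻¹ := by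
            gcongr
        -- One power of `n` is given away: a bound of order `1 / n = 1 / (m + 1) ^ 2` is already
        -- summable.
        _ ≤ 2 * ((n : ℝ≥0∞) ^ 2 * ENNReal.ofReal (graphonMass W)) * ((n : ℝ≥0∞) ^ 3)⁻¹ := by
            gcongr
            norm_num
        _ = 2 * ENNReal.ofReal (graphonMass W) *
              (((n : ℝ≥0∞) ^ 2 * ((n : ℝ≥0∞) ^ 2)⁻¹) * (n : ℝ≥0∞)⁻¹) := by
            rw [pow_succ (n : ℝ≥0∞) 2, ENNReal.mul_inv (Or.inr hnt) (Or.inr hn0)]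
            ring
        _ = _ := by
            rw [ENNReal.mul_inv_cancel (pow_ne_zero 2 hn0) (ENNReal.pow_ne_top hnt), one_mul]
  filter_upwards [hlim] with ω hω
  have h1 := (ENNReal.tendsto_toReal ENNReal.zero_ne_top).comp hω
  have h2 := (Real.continuous_sqrt.tendsto 0).comp h1
  rw [Real.sqrt_zero] at h2
  rw [tendsto_zero_iff_abs_tendsto_zero]
  refine h2.congr fun m => ?_
  simp only [Function.comp_apply, ENNReal.toReal_div, ENNReal.toReal_pow, ENNReal.toReal_natCast]
  rw [ENNReal.toReal_ofReal (sq_nonneg _), ← Real.sqrt_sq_eq_abs, div_pow]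
  congr 2
  rw [← pow_mul]

theorem ae_tendsto_linkSum_loop (hW : IsGraphonFunction W) (hG : IsGraphInput P θ ϑ U) :
    ∀ᵐ ω ∂P, Tendsto (fun m : ℕ =>
      linkSum W θ ϑ U (loopWeight (((m + 1) ^ 2 : ℕ) : ℝ)) ω /
        (((m + 1) ^ 2 : ℕ) : ℝ≥0∞) ^ 2) atTop (𝓝 0) := by
  refine ae_tendsto_zero_of_lintegral_le (fun m =>
    (measurable_linkSum hW hG (measurable_loopWeight _)).div_const _)
    hW.lintegral_diag_ne_top fun m => ?_
  set n : ℕ := (m + 1) ^ 2 with hn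
  have hn0 : (n : ℝ≥0∞) ≠ 0 := by rw [Nat.cast_ne_zero]; positivity
  have hnt : (n : ℝ≥0∞) ≠ ∞ := ENNReal.natCast_ne_top n
  simp_rw [div_eq_mul_inv]
  rw [lintegral_mul_const _ (measurable_linkSum hW hG (measurable_loopWeight _)),
    lintegral_linkSum_eq hW hG (measurable_loopWeight _), lintegral_probSum_loopWeight hW hG,
    ENNReal.ofReal_natCast, sq, ENNReal.mul_inv (Or.inl hn0) (Or.inl hnt)]
  set D := ∫⁻ y, ENNReal.ofReal (quadrantFun W (y, y)) ∂halfLine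
  calc (n : ℝ≥0∞) * D * ((n : ℝ≥0∞)⁻¹ * (n : ℝ≥0∞)⁻¹)
      = ((n : ℝ≥0∞) * (n : ℝ≥0∞)⁻¹) * (D * (n : ℝ≥0∞)⁻¹) := by ring
    _ = D * (n : ℝ≥0∞)⁻¹ := by rw [ENNReal.mul_inv_cancel hn0 hnt, one_mul]
    _ ≤ _ := le_rfl

/-- Along squares the count is half of `probSum` plus its link fluctuation, plus the loops; only the
first part survives division by `t ^ 2`, and monotonicity fills in the other times. -/
theorem ae_tendsto_numEdges (hW : IsGraphonFunction W) (hG : IsGraphInput P θ ϑ U) :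
    ∀ᵐ ω ∂P, Tendsto (fun t : ℝ => (numEdges W θ ϑ U t ω).toReal / t ^ 2) atTop
      (𝓝 (graphonMass W / 2)) := by
  filter_upwards [ae_numEdges_ne_top hW hG, ae_numEdges_eq hG, ae_tendsto_probSum hW hG,
    ae_tendsto_linkSum_sub hW hG, ae_tendsto_linkSum_loop hW hG] with ω h1 h2 h3 h4 h5
  refine tendsto_div_sq_of_monotone (fun s _ t _ hst =>
    ENNReal.toReal_mono (h1 t) (numEdges_mono hst ω)) (fun _ => ENNReal.toReal_nonneg) ?_
  have h6 := (((h3.add h4).const_mul (1 / 2))).add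
    ((ENNReal.tendsto_toReal ENNReal.zero_ne_top).comp h5)
  rw [add_zero, ENNReal.toReal_zero, add_zero, one_div_mul_eq_div] at h6
  refine h6.congr fun m => ?_
  have hcast : ((m : ℝ) + 1) ^ 2 = (((m + 1) ^ 2 : ℕ) : ℝ) := by push_cast; ring
  have hcast4 : ((m : ℝ) + 1) ^ 4 = (((m + 1) ^ 2 : ℕ) : ℝ) ^ 2 := by push_cast; ring
  rw [hcast, hcast4]
  set n : ℕ := (m + 1) ^ 2
  have h7 := h1 n
  rw [h2 n] at h7 ⊢
  rw [ENNReal.toReal_add (ENNReal.add_ne_top.1 h7).1 (ENNReal.add_ne_top.1 h7).2]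
  simp only [Function.comp_apply, ENNReal.toReal_div, ENNReal.toReal_pow, ENNReal.toReal_natCast,
    ENNReal.toReal_mul, ENNReal.toReal_one, ENNReal.toReal_ofNat]
  ring

theorem isEquivalent_of_tendsto_div_sq {f : ℝ → ℝ} {c : ℝ} (hc : 0 < c)
    (h : Tendsto (fun t => f t / t ^ 2) atTop (𝓝 (c / 2))) :
    f ~[atTop] fun t => t ^ 2 * c / 2 := by
  rw [isEquivalent_iff_tendsto_one]
  · have h1 := h.div_const (c / 2)
    rw [div_self (by positivity)] at h1
    refine h1.congr fun t => ?_
    simp only [Pi.div_apply]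
    rw [div_div, mul_div_assoc]
  · filter_upwards [eventually_gt_atTop 0] with t ht
    positivity

end GraphLimit

theorem proposition2 {Ω : Type*} [MeasurableSpace Ω] (P : Measure Ω) [IsProbabilityMeasure P]
    (W : ℝ → ℝ → ℝ) (hW : IsGraphonFunction W)
    (θ ϑ : ℕ → Ω → ℝ) (U : ℕ → ℕ → Ω → ℝ) (hG : IsGraphInput P θ ϑ U) :
    (∀ᵐ ω ∂P, (∀ α : ℝ, 0 < α → numEdges W θ ϑ U α ω ≠ ∞) ∧
      (fun α : ℝ => (numEdges W θ ϑ U α ω).toReal) ~[atTop]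
        (fun α : ℝ => α ^ 2 * graphonMass W / 2)) ∧
    (∀ α : ℝ, 0 < α → Integrable (fun ω => (numEdges W θ ϑ U α ω).toReal) P) ∧
    (fun α : ℝ => ∫ ω, (numEdges W θ ϑ U α ω).toReal ∂P) ~[atTop]
      (fun α : ℝ => α ^ 2 * graphonMass W / 2) := by
  have hmass : 0 < graphonMass W := hW.integral_pos
  refine ⟨?_, fun α _ => integrable_toReal_of_lintegral_ne_top (aemeasurable_numEdges hW hG α)
    (lintegral_numEdges_ne_top hW hG α), ?_⟩
  · filter_upwards [ae_numEdges_ne_top hW hG, ae_tendsto_numEdges hW hG] with ω h1 h2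
    exact ⟨fun α _ => h1 α, isEquivalent_of_tendsto_div_sq hmass h2⟩
  · refine isEquivalent_of_tendsto_div_sq hmass ?_
    set D := (∫⁻ y, ENNReal.ofReal (quadrantFun W (y, y)) ∂halfLine).toReal with hD
    -- For `α > 0` the mean divided by `α ^ 2` equals this expression exactly, the second term
    -- coming from the loops.
    have h : Tendsto (fun α : ℝ => graphonMass W / 2 + D * α⁻¹) atTop
        (𝓝 (graphonMass W / 2 + D * 0)) :=
      (tendsto_inv_atTop_zero.const_mul D).const_add _
    rw [mul_zero, add_zero] at h
    refine h.congr' ?_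
    filter_upwards [eventually_gt_atTop 0] with α hα
    rw [integral_numEdges hW hG hα.le, ← hD]
    field_simp
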